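/- Let $n>2$, let $V$ be a finite-dimensional real inner product space and $W$ a finite-dimensional real normed space, and let $W\times V\to V$ be a bilinear product, used to form $\nu\wedge\omega$ for $W$-valued 1-forms $\nu$ and $V$-valued forms $\omega$ (for instance $W=\mathbb R$ with scalar multiplication). Let $\Omega\subset\mathbb R^n$ be a bounded domain of type A, i.e. there is $A>0$ with $|\Omega\cap B_t(x)|\ge A\,t^n$ for all $x\in\Omega$ and $0<t<\operatorname{diam}\Omega$. Let $B\subset\Omega$ be an open ball and $\Sigma\subset B$ a compact set of Hausdorff codimension at least $\mu$, i.e. $\dim_H\Sigma\le n-\mu$. Let $\kappa,q>0$, $k_0\ge 0$, $Q_{crit}\in(0,\infty]$, and let $\rho$ be continuous on $[0,Q_{crit})$ and $C^1$ on $(0,Q_{crit})$ with $$\kappa^{-1}(Q+k_0)^q\le\rho(Q)+2Q\rho'(Q)\le\kappa(Q+k_0)^q\qquad(0<Q<Q_{crit}).$$ Let $\omega$ be a $V$-valued form of degree at least $1$ and $\nu$ a $W$-valued $1$-form, both of class $C^1$ on $\Omega\setminus\Sigma$, such that $Q=|\omega|^2<Q_{crit}$ and $$\delta(\rho(Q)\,\omega)=0,\qquad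 d\omega=\nu\wedge\omega\qquad\text{on }\Omega\setminus\Sigma,$$ where $|\cdot|$ and $\delta$ (the formal adjoint of $d$) refer to the Euclidean metric. Assume: - if $n>4$: $\frac{2n}{n-2}<\mu<n$ and $\omega\in L^{n(q+1)}(B)$; - if $n=3$ or $4$: $2<\mu\le n$ and $\omega\in L^{4(q+1)\beta\gamma_1}(B)\cap L^{4(q+1)\gamma_2}(B)$, where $\beta=\frac{\mu-\varepsilon}{\mu-2-\varepsilon}$ with $0<\varepsilon<\mu-2$, and $\frac12<\gamma_1<\gamma_2$; - $|\nabla\nu|+|\nu|^2\in L^s(B)$ for some $s>n/2$. Then $\omega$ is bounded on $K\setminus\Sigma$ for every compact $K\subset\Omega$. Moreover the bound is uniform over the subcritical range: for compact $K\subset B$ and $M\in\mathbb R$, if $k_0\le M$ and the $L^P(B)$ norms of $\omega$ (for the exponents $P$ above) and the $L^s(B)$ norm of $|\nabla\nu|+|\nu|^2$ are at most $M$, then $\sup_{K\setminus\Sigma}|\omega|\le C$, where $C$ depends only on $n$, the degree of $\omega$, $V$, $W$, the product $W\times V\to V$, $\kappa,q,s,\mu,\varepsilon,\gamma_1,\gamma_2,B,K,M$;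 in particular $C$ does not depend on $Q_{crit}$, on the particular $\rho$, $\Sigma$, $\Omega$, $\omega$, $\nu$, nor on $k_0\in[0,M]$, so it does not degenerate as $k_0\to0$. -/

import Mathlib

open MeasureTheory Set
open scoped ENNReal

namespace HodgeVorticity

/-- Euclidean `n`-space. -/
abbrev Space (n : ℕ) : Type := EuclideanSpace ℝ (Fin n)

/-- The `i`-th vector of the standard orthonormal basis of `ℝⁿ`. -/
noncomputable def basisVec {n : ℕ} (i : Fin n) : Space n := EuclideanSpace.single i (1 : ℝ)

section Forms

variable {n p : ℕ} {V : Type*} [NormedAddCommGroup V] [InnerProductSpace ℝ V]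

/-- `Q = ω ∧ ∗ω = |ω|²`, the Euclidean norm squared of a `V`-valued `p`-covector: the sum of
`|ω(e_{i₁}, …, e_{iₚ})|²` over increasing multi-indices, written as `1/p!` times the sum over all
multi-indices. -/
noncomputable def normSq (ω : Space n [⋀^Fin p]→L[ℝ] V) : ℝ :=
  (p.factorial : ℝ)⁻¹ * ∑ I : Fin p → Fin n, ‖ω (fun j => basisVec (I j))‖ ^ 2

/-- The Euclidean norm `|ω| = √Q` of a `V`-valued `p`-covector. -/
noncomputable def formNorm (ω : Space n [⋀^Fin p]→L[ℝ] V) : ℝ := Real.sqrt (normSq ω)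

/-- The codifferential `δ` on `(p+1)`-forms, the formal adjoint of `d` with respect to the Euclidean
metric: `δα = - ∑ i, ι_{e_i} (∂_i α)`. -/
noncomputable def codiff (α : Space n → Space n [⋀^Fin (p + 1)]→L[ℝ] V) (x : Space n) :
    Space n [⋀^Fin p]→L[ℝ] V :=
  -∑ i : Fin n, (fderiv ℝ α x (basisVec i)).curryLeft (basisVec i)

variable {W : Type*} [NormedAddCommGroup W] [NormedSpace ℝ W]

/-- The wedge product `ν ∧ ω` of a `W`-valued 1-covector and a `V`-valued `p`-covector with respect
to a bilinear product `m : W × V → V`: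
`(ν ∧ ω)(v₀, …, vₚ) = ∑ i, (-1)^i m(ν(vᵢ), ω(v₀, …, v̂ᵢ, …, vₚ))`. -/
noncomputable def wedge (m : W →L[ℝ] V →L[ℝ] V) (ν : Space n →L[ℝ] W)
    (ω : Space n [⋀^Fin p]→L[ℝ] V) : Space n [⋀^Fin (p + 1)]→L[ℝ] V :=
  ContinuousAlternatingMap.alternatizeUncurryFin
    (((ContinuousLinearMap.compContinuousAlternatingMapCLM ℝ (Space n) V V (Fin p)).flip ω).comp
      (m.comp ν))

theorem wedge_apply (m : W →L[ℝ] V →L[ℝ] V) (ν : Space n →L[ℝ] W)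
    (ω : Space n [⋀^Fin p]→L[ℝ] V) (v : Fin (p + 1) → Space n) :
    wedge m ν ω v = ∑ i : Fin (p + 1), (-1 : ℤ) ^ (i : ℕ) • m (ν (v i)) (ω (i.removeNth v)) := by
  simp [wedge, ContinuousAlternatingMap.alternatizeUncurryFin_apply]

end Forms

/-- A bounded type-A domain: a bounded, connected open set `Ω` such that, for some `A > 0`, every
ball of radius `r < diam Ω` centred in `Ω` meets `Ω` in a set of measure at least `A rⁿ`. -/
structure IsTypeADomain {n : ℕ} (Ω : Set (Space n)) : Prop where
  isOpen : IsOpen Ω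
  isConnected : IsConnected Ω
  isBounded : Bornology.IsBounded Ω
  exists_measure_ge : ∃ A : ℝ, 0 < A ∧ ∀ x ∈ Ω, ∀ r : ℝ, 0 < r → r < Metric.diam Ω →
    ENNReal.ofReal (A * r ^ n) ≤ volume (Ω ∩ Metric.ball x r)

/-- The set of subcritical values `Q ∈ [0, Qcrit)`, where `Qcrit ∈ [0, ∞]`. -/
def subcritical (Qcrit : ℝ≥0∞) : Set ℝ := {Q | 0 ≤ Q ∧ ENNReal.ofReal Q < Qcrit}

/-- The power-type condition on the density:
`κ⁻¹ (Q + k₀)^q ≤ ρ(Q) + 2 Q ρ'(Q) ≤ κ (Q + k₀)^q` on the subcritical range, for a density that is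
continuous on that range and `C¹` at its positive points. Differentiability at `Q = 0` is not asked
for, so that `ρ(Q) = Q^q` with `0 < q < 1` is allowed; by continuity nothing needs to be said
at `Q = 0`. -/
structure PowerDensity (κ q k₀ : ℝ) (Qcrit : ℝ≥0∞) (ρ : ℝ → ℝ) : Prop where
  continuousOn : ContinuousOn ρ (subcritical Qcrit)
  contDiffOn : ContDiffOn ℝ 1 ρ (subcritical Qcrit ∩ Ioi 0)
  lower : ∀ Q ∈ subcritical Qcrit, 0 < Q → κ⁻¹ * (Q + k₀) ^ q ≤ ρ Q + 2 * Q * deriv ρ Q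
  upper : ∀ Q ∈ subcritical Qcrit, 0 < Q → ρ Q + 2 * Q * deriv ρ Q ≤ κ * (Q + k₀) ^ q

/-- `(ω, ν)` is a classical subcritical solution of `δ(ρ(Q) ω) = 0`, `dω = ν ∧ ω` on the
open set `U`. -/
structure IsClassicalSolution {n p : ℕ} {V W : Type*}
    [NormedAddCommGroup V] [InnerProductSpace ℝ V] [NormedAddCommGroup W] [NormedSpace ℝ W]
    (m : W →L[ℝ] V →L[ℝ] V) (Qcrit : ℝ≥0∞) (ρ : ℝ → ℝ) (U : Set (Space n))
    (ω : Space n → Space n [⋀^Fin (p + 1)]→L[ℝ] V) (ν : Space n → Space n →L[ℝ] W) : Prop where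
  contDiffOn_form : ContDiffOn ℝ 1 ω U
  contDiffOn_vorticity : ContDiffOn ℝ 1 ν U
  mem_subcritical : ∀ x ∈ U, normSq (ω x) ∈ subcritical Qcrit
  codiff_eq : ∀ x ∈ U, codiff (fun y => ρ (normSq (ω y)) • ω y) x = 0
  extDeriv_eq : ∀ x ∈ U, extDeriv ω x = wedge m (ν x) (ω x)

/-- The admissible range of the codimension `μ` and of the auxiliary exponents: for `n > 4`,
`2n/(n-2) < μ < n`; for `n = 3, 4`, `2 < μ ≤ n`, `ε > 0` small enough for `β` to be defined and
positive, and `1/2 < γ₁ < γ₂`. (For `n > 4` the numbers `ε, γ₁, γ₂` play no role.) -/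
def AdmissibleExponents (n : ℕ) (μ ε γ₁ γ₂ : ℝ) : Prop :=
  if 4 < n then 2 * (n : ℝ) / (n - 2) < μ ∧ μ < n
  else 2 < μ ∧ μ ≤ n ∧ 0 < ε ∧ ε < μ - 2 ∧ 1 / 2 < γ₁ ∧ γ₁ < γ₂

/-- The exponents `P` for which `ω` is required to be in `L^P(B)`: `n(q+1)` if `n > 4`; both
`4(q+1)βγ₁` with `β = (μ-ε)/(μ-2-ε)` and `4(q+1)γ₂` if `n = 3, 4`. -/
noncomputable def integrabilityExponents (n : ℕ) (q μ ε γ₁ γ₂ : ℝ) : Set ℝ :=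
  if 4 < n then {n * (q + 1)}
  else {4 * (q + 1) * ((μ - ε) / (μ - 2 - ε)) * γ₁, 4 * (q + 1) * γ₂}

/-- All data and hypotheses: `Ω` is a type-A domain, the ball `B` lies in `Ω`, the compact singular
set `S ⊆ B` has (Hausdorff) codimension at least `μ`, the density satisfies the power-type
condition, `(ω, ν)` solves the system on `Ω ∖ S`, and `ω`, `|∇ν| + |ν|²` have the required
integrability on `B` (integrals over `B ∖ S`, as `S` is a null set off which the fields are given). -/
structure SingularSolution {n p : ℕ} {V W : Type*}
    [NormedAddCommGroup V] [InnerProductSpace ℝ V] [NormedAddCommGroup W] [NormedSpace ℝ W]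
    (m : W →L[ℝ] V →L[ℝ] V) (κ q s μ ε γ₁ γ₂ : ℝ) (B : Set (Space n))
    (k₀ : ℝ) (Qcrit : ℝ≥0∞) (ρ : ℝ → ℝ) (Ω S : Set (Space n))
    (ω : Space n → Space n [⋀^Fin (p + 1)]→L[ℝ] V) (ν : Space n → Space n →L[ℝ] W) : Prop where
  domain : IsTypeADomain Ω
  ball_subset : B ⊆ Ω
  isCompact_sing : IsCompact S
  sing_subset : S ⊆ B
  dimH_sing_le : dimH S ≤ ENNReal.ofReal (n - μ)
  k₀_nonneg : 0 ≤ k₀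
  density : PowerDensity κ q k₀ Qcrit ρ
  solution : IsClassicalSolution m Qcrit ρ (Ω \ S) ω ν
  memLp_form : ∀ P ∈ integrabilityExponents n q μ ε γ₁ γ₂,
    MemLp (fun x => formNorm (ω x)) (ENNReal.ofReal P) (volume.restrict (B \ S))
  memLp_vorticity :
    MemLp (fun x => ‖fderiv ℝ ν x‖ + ‖ν x‖ ^ 2) (ENNReal.ofReal s) (volume.restrict (B \ S))

end HodgeVorticity

open HodgeVorticity

/-! The proof is a Caccioppoli inequality off `S`, a removability argument across `S`, and a De
Giorgi iteration, with constants tracked so that only the fixed parameters and `M` enter.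

Energy. Write `Q = |ω|²`, `a = ρ(Q) ω` and `b = η² f(Q) ω`, with `f` a truncation vanishing for `Q ≤
k`. Formally `∫ ⟨δa, δb⟩ = 0`, and exchanging the two derivatives turns this into `∫ ∑ ⟨ι_l ∂_k a,
ι_k ∂_l b⟩ = 0`. The exchange needs only `C¹` fields, since it is obtained by differentiating a
translation parameter (`integral_inner_fderiv_comm`). Since exterior multiplication is adjoint to
contraction, the new integrand (`mixedForm`) is a coercive quadratic form in `∇ω` up to terms
containing `dω = ν ∧ ω`, which are of order zero in `ω`. Coercivity means that `ρ` and `ρ + 2Qρ'`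
are both comparable to `Q^q`. For `Q ≥ 1` this holds with constants independent of `Qcrit` and of
`k₀ ∈ [0, M]` (`PowerDensity.bounds`), and so only levels `k ≥ 1` are used. The outcome is
`energy_inequality`: the Dirichlet integral of `η Q^((q+1)/2) f(Q)` is at most a constant times `∫
Q^(q+1) (|∇η|² + η²|ν|²)` over `{Q > k}`.

Removability. For a suitable `2 < t < μ` the set `S` has zero `(n - t)`-dimensional Hausdorff
measure, hence there are cutoffs `ξ`, zero near `S`, with `∫ |∇ξ|^t` arbitrarily small
(`exists_capacity_cutoff`). Testing with `ηξ` costs `∫ Q^(q+1) |∇ξ|²`, which tends to zero by Hölder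
as soon as `Q^(q+1)` is in `L^(t/(t-2))`; the assumed integrability of `ω` is what supplies this.
The Sobolev inequality and Fatou then give an estimate that no longer sees `S`
(`reverse_sobolev_of_caccioppoli`).

Iteration. Because `s > n/2`, the conjugate exponent of `s` lies strictly below the Sobolev gain
`n/(n-2)`. The recursion over shrinking balls and rising levels is therefore superlinear, and `Q` is
bounded on a smaller ball (`exists_sup_bound_of_reverse_sobolev`). For a compact subset of `Ω`, the
part outside a smaller ball containing `S` is handled by continuity. -/

namespace HodgeVorticity

/-! ### Algebra of covectors: contraction, exterior multiplication and norms. -/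

section Algebra

open ContinuousAlternatingMap
open scoped RealInnerProductSpace

variable {n p : ℕ} {V : Type*} [NormedAddCommGroup V] [InnerProductSpace ℝ V]

/-- The inner product space of coordinate families of `V`-valued `p`-covectors. -/
abbrev Coords (n p : ℕ) (V : Type*) : Type _ := PiLp 2 (fun _ : Fin p → Fin n => V)

/-- The normalised coordinates of a covector: an isometry for the norm `formNorm`. -/
noncomputable def coords : (Space n [⋀^Fin p]→L[ℝ] V) →L[ℝ] Coords n p V :=
  (√(p.factorial : ℝ))⁻¹ •
    ((PiLp.continuousLinearEquiv 2 ℝ (fun _ : Fin p → Fin n => V)).symm.toContinuousLinearMap ∘L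
      ContinuousLinearMap.pi fun I =>
        ContinuousAlternatingMap.apply ℝ (Space n) V (fun j => basisVec (I j)))

theorem coords_apply (α : Space n [⋀^Fin p]→L[ℝ] V) (I : Fin p → Fin n) :
    coords α I = (√(p.factorial : ℝ))⁻¹ • α (fun j => basisVec (I j)) := by
  simp [coords]

theorem inner_coords (α β : Space n [⋀^Fin p]→L[ℝ] V) :
    ⟪coords α, coords β⟫ = (p.factorial : ℝ)⁻¹ *
      ∑ I : Fin p → Fin n, ⟪α (fun j => basisVec (I j)), β (fun j => basisVec (I j))⟫ := by
  simp only [PiLp.inner_apply, coords_apply, inner_smul_left, inner_smul_right, Finset.mul_sum]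
  refine Finset.sum_congr rfl fun I _ => ?_
  have : (√(p.factorial : ℝ))⁻¹ * (√(p.factorial : ℝ))⁻¹ = (p.factorial : ℝ)⁻¹ := by
    rw [← mul_inv, Real.mul_self_sqrt (by positivity)]
  simp only [RCLike.conj_to_real]
  rw [← mul_assoc, this]

theorem norm_coords_sq (α : Space n [⋀^Fin p]→L[ℝ] V) : ‖coords α‖ ^ 2 = normSq α := by
  rw [← real_inner_self_eq_norm_sq, inner_coords, normSq]
  simp

/-- Contraction `α ↦ ι_v α` of covectors with a vector. -/
noncomputable def contract (v : Space n) :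
    (Space n [⋀^Fin (p + 1)]→L[ℝ] V) →L[ℝ] (Space n [⋀^Fin p]→L[ℝ] V) :=
  (ContinuousLinearMap.apply ℝ (Space n [⋀^Fin p]→L[ℝ] V) v) ∘L
    (curryLeftLI (𝕜 := ℝ) (E := Space n) (F := V) (n := p)).toContinuousLinearMap

theorem contract_eq (v : Space n) (α : Space n [⋀^Fin (p + 1)]→L[ℝ] V) :
    contract v α = α.curryLeft v := rfl

theorem contract_apply (v : Space n) (α : Space n [⋀^Fin (p + 1)]→L[ℝ] V) (w : Fin p → Space n) :
    contract v α w = α (Matrix.vecCons v w) := rfl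

/-- Exterior multiplication is adjoint to contraction. -/
theorem inner_coords_alternatizeUncurryFin (L : Space n →L[ℝ] Space n [⋀^Fin p]→L[ℝ] V)
    (β : Space n [⋀^Fin (p + 1)]→L[ℝ] V) :
    ⟪coords (alternatizeUncurryFin L), coords β⟫ =
      ∑ k, ⟪coords (L (basisVec k)), coords (contract (basisVec k) β)⟫ := by
  -- All `p + 1` slots contribute equally: moving slot `i` to the front in `β` costs `(-1)^i`, which
  -- cancels the sign of the alternatization. The resulting factor `p + 1` turns `1/(p+1)!` into
  -- `1/p!`.
  have key : ∀ i : Fin (p + 1), ∑ I : Fin (p + 1) → Fin n,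
      ⟪(-1 : ℤ) ^ (i : ℕ) • L (basisVec (I i)) (i.removeNth fun j => basisVec (I j)),
        β (fun j => basisVec (I j))⟫ =
      ∑ k, ∑ J : Fin p → Fin n, ⟪L (basisVec k) (fun j => basisVec (J j)),
        contract (basisVec k) β (fun j => basisVec (J j))⟫ := by
    intro i
    rw [← Fintype.sum_prod_type', ← (Fin.insertNthEquiv (fun _ => Fin n) i).sum_comp]
    refine Finset.sum_congr rfl fun x _ => ?_
    have h1 : (fun j => basisVec ((Fin.insertNthEquiv (fun _ => Fin n) i) x j) :
        Fin (p + 1) → Space n) = i.insertNth (basisVec x.1) (fun j => basisVec (x.2 j)) := by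
      ext j : 1
      refine Fin.succAboveCases i ?_ (fun j => ?_) j <;> simp [Fin.insertNthEquiv]
    rw [h1, contract_apply, ← β.neg_one_pow_smul_map_insertNth i]
    simp only [Fin.insertNthEquiv_apply, Fin.insertNth_apply_same, Fin.removeNth_insertNth]
    rcases neg_one_pow_eq_or ℤ (i : ℕ) with h | h <;> simp [h]
  simp only [inner_coords, alternatizeUncurryFin_apply, sum_inner]
  rw [Finset.sum_comm, Finset.sum_congr rfl fun i _ => key i, ← Finset.mul_sum]
  simp only [Finset.sum_const, Finset.card_univ, Fintype.card_fin, Nat.factorial_succ]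
  have : (p.factorial : ℝ) ≠ 0 := by positivity
  push_cast
  field_simp
  simp

/-- The anticommutation of contraction with exterior multiplication. -/
theorem contract_alternatizeUncurryFin (D : Space n →L[ℝ] Space n [⋀^Fin (p + 1)]→L[ℝ] V)
    (v : Space n) :
    contract v (alternatizeUncurryFin D) = D v - alternatizeUncurryFin (contract v ∘L D) := by
  ext w
  rw [contract_apply, alternatizeUncurryFin_apply, Fin.sum_univ_succ]
  simp only [ContinuousAlternatingMap.sub_apply, alternatizeUncurryFin_apply]
  have h0 : Fin.removeNth 0 (Matrix.vecCons v w) = w := by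
    ext j : 1; simp [Fin.removeNth]
  have hs : ∀ i : Fin (p + 1), Fin.removeNth i.succ (Matrix.vecCons v w) =
      Matrix.vecCons v (Fin.removeNth i w) := by
    intro i
    ext j : 1
    refine Fin.cases ?_ (fun j => ?_) j <;> simp [Fin.removeNth]
  simp only [h0, hs, Fin.val_zero, pow_zero, one_smul, Fin.val_succ, pow_succ, Matrix.cons_val_zero,
    Matrix.cons_val_succ, ContinuousLinearMap.comp_apply, contract_apply]
  simp [sub_eq_add_neg, Finset.sum_neg_distrib]

/-- Adjointness and anticommutation combined. With `D = ∇ω`, the alternatization is `dω`, so the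
transposed contraction returns the full derivative `D v` up to an error seen only through `dω`. This
is the source of coercivity. -/
theorem sum_inner_coords_contract (D : Space n →L[ℝ] Space n [⋀^Fin (p + 1)]→L[ℝ] V)
    (β : Space n [⋀^Fin (p + 1)]→L[ℝ] V) (v : Space n) :
    ∑ k, ⟪coords (contract v (D (basisVec k))), coords (contract (basisVec k) β)⟫ =
      ⟪coords (D v), coords β⟫ - ⟪coords (contract v (alternatizeUncurryFin D)), coords β⟫ := by
  rw [contract_alternatizeUncurryFin, map_sub, inner_sub_left,
    inner_coords_alternatizeUncurryFin]
  simp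

theorem sum_smul_basisVec (v : Space n) : ∑ k, v k • basisVec k = v := by
  ext j
  simp [basisVec, Finset.sum_apply, Pi.single_apply]

theorem contract_eq_sum (v : Space n) (α : Space n [⋀^Fin (p + 1)]→L[ℝ] V) :
    contract v α = ∑ k, v k • contract (basisVec k) α := by
  conv_lhs => rw [← sum_smul_basisVec v, contract_eq, _root_.map_sum]
  simp [contract_eq]

/-- `|ι_v ω| ≤ |v| |ω|` -/
theorem norm_coords_contract_sq_le (ω : Space n [⋀^Fin (p + 1)]→L[ℝ] V) (v : Space n) :
    ‖coords (contract v ω)‖ ^ 2 ≤ ‖v‖ ^ 2 * ‖coords ω‖ ^ 2 := by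
  -- For `D = v♭ ⊗ ω` the alternatization is `v ∧ ω`, and the preceding identity becomes Pythagoras:
  -- `|ι_v ω|² + |v ∧ ω|² = |v|² |ω|²`.
  set D : Space n →L[ℝ] Space n [⋀^Fin (p + 1)]→L[ℝ] V := (innerSL ℝ v).smulRight ω with hD
  have hDk : ∀ k, D (basisVec k) = v k • ω := fun k => by
    simp [hD, basisVec, EuclideanSpace.inner_single_right]
  have h1 := sum_inner_coords_contract D ω v
  have hDv : D v = ‖v‖ ^ 2 • ω := by simp [hD]
  have h2 : 0 ≤ ⟪coords (contract v (alternatizeUncurryFin D)), coords ω⟫ := by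
    have h3 := inner_coords_alternatizeUncurryFin D (alternatizeUncurryFin D)
    have h4 : ⟪coords (contract v (alternatizeUncurryFin D)), coords ω⟫ =
        ∑ k, ⟪coords (D (basisVec k)),
          coords (contract (basisVec k) (alternatizeUncurryFin D))⟫ := by
      rw [contract_eq_sum v, _root_.map_sum, sum_inner]
      refine Finset.sum_congr rfl fun k _ => ?_
      rw [hDk, map_smul, map_smul, inner_smul_left, inner_smul_left, real_inner_comm]
    rw [h4, ← h3, real_inner_self_eq_norm_sq]
    positivity
  have h5 : ∑ k, ⟪coords (contract v (D (basisVec k))), coords (contract (basisVec k) ω)⟫ =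
      ‖coords (contract v ω)‖ ^ 2 := by
    rw [← real_inner_self_eq_norm_sq]
    have h6 : coords (contract v ω) = ∑ k, v k • coords (contract (basisVec k) ω) := by
      rw [contract_eq_sum v, _root_.map_sum]; simp
    nth_rewrite 2 [h6]
    rw [inner_sum]
    refine Finset.sum_congr rfl fun k _ => ?_
    rw [hDk, map_smul, map_smul, inner_smul_left, inner_smul_right]
    rfl
  rw [h5, hDv, map_smul, inner_smul_left, real_inner_self_eq_norm_sq] at h1
  simp at h1
  linarith

theorem norm_apply_basisVec_sq_le (ω : Space n [⋀^Fin p]→L[ℝ] V) (I : Fin p → Fin n) :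
    ‖ω (fun j => basisVec (I j))‖ ^ 2 ≤ p.factorial * normSq ω := by
  have : (p.factorial : ℝ) ≠ 0 := by positivity
  rw [normSq, mul_inv_cancel_left₀ this]
  exact Finset.single_le_sum (f := fun I : Fin p → Fin n => ‖ω (fun j => basisVec (I j))‖ ^ 2)
    (fun _ _ => by positivity) (Finset.mem_univ I)

variable {W : Type*} [NormedAddCommGroup W] [NormedSpace ℝ W]

theorem norm_basisVec (i : Fin n) : ‖(basisVec i : Space n)‖ = 1 := by
  simp [basisVec]

theorem normSq_wedge_le (m : W →L[ℝ] V →L[ℝ] V) (ν : Space n →L[ℝ] W)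
    (ω : Space n [⋀^Fin p]→L[ℝ] V) :
    normSq (wedge m ν ω) ≤ (n : ℝ) ^ (p + 1) * (p + 1) ^ 2 * ‖m‖ ^ 2 * p.factorial *
      (‖ν‖ ^ 2 * normSq ω) := by
  have hQ : 0 ≤ normSq ω := by rw [← norm_coords_sq]; positivity
  have h1 : ∀ I : Fin (p + 1) → Fin n, ‖wedge m ν ω (fun j => basisVec (I j))‖ ^ 2 ≤
      (p + 1) ^ 2 * ‖m‖ ^ 2 * p.factorial * (‖ν‖ ^ 2 * normSq ω) := by
    intro I
    have h2 : ‖wedge m ν ω (fun j => basisVec (I j))‖ ≤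
        (p + 1) * (‖m‖ * ‖ν‖ * √(p.factorial * normSq ω)) := by
      rw [wedge_apply]
      refine (norm_sum_le _ _).trans ?_
      refine (Finset.sum_le_card_nsmul _ _ (‖m‖ * ‖ν‖ * √(p.factorial * normSq ω)) ?_).trans ?_
      · intro i _
        have : ‖(-1 : ℤ) ^ (i : ℕ) • m (ν (basisVec (I i)))
            (ω (i.removeNth fun j => basisVec (I j)))‖ = ‖m (ν (basisVec (I i)))
            (ω (i.removeNth fun j => basisVec (I j)))‖ := by
          rcases neg_one_pow_eq_or ℤ (i : ℕ) with h | h <;> simp [h]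
        rw [this]
        refine (ContinuousLinearMap.le_opNorm₂ _ _ _).trans ?_
        gcongr
        · simpa [norm_basisVec] using ν.le_opNorm (basisVec (I i))
        · exact Real.le_sqrt_of_sq_le (norm_apply_basisVec_sq_le ω (i.removeNth I))
      · simp
    calc _ ≤ ((p + 1) * (‖m‖ * ‖ν‖ * √(p.factorial * normSq ω))) ^ 2 := by gcongr
      _ = _ := by
        rw [mul_pow, mul_pow, mul_pow, Real.sq_sqrt (by positivity)]; ring
  calc normSq (wedge m ν ω) ≤ 1 * ∑ I : Fin (p + 1) → Fin n,
        (p + 1) ^ 2 * ‖m‖ ^ 2 * p.factorial * (‖ν‖ ^ 2 * normSq ω) := by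
        rw [normSq]
        gcongr with I
        · exact inv_le_one_of_one_le₀ (by exact_mod_cast Nat.one_le_iff_ne_zero.2 (by positivity))
        · exact h1 I
    _ = _ := by simp; ring

/-- Applied to `dω = ν ∧ ω`, it makes the error terms of the energy estimate of order zero in `ω`.
The constant is crude: it counts multi-indices and drops the normalising factorial. -/
theorem norm_coords_contract_wedge_sq_le (m : W →L[ℝ] V →L[ℝ] V) (ν : Space n →L[ℝ] W)
    (ω : Space n [⋀^Fin p]→L[ℝ] V) :
    ∑ k, ‖coords (contract (basisVec k) (wedge m ν ω))‖ ^ 2 ≤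
      n * ((n : ℝ) ^ (p + 1) * (p + 1) ^ 2 * ‖m‖ ^ 2 * p.factorial) * (‖ν‖ ^ 2 * normSq ω) := by
  calc _ ≤ ∑ _k : Fin n, (n : ℝ) ^ (p + 1) * (p + 1) ^ 2 * ‖m‖ ^ 2 * p.factorial *
      (‖ν‖ ^ 2 * normSq ω) := by
        refine Finset.sum_le_sum fun k _ => ?_
        refine (norm_coords_contract_sq_le _ _).trans ?_
        rw [norm_basisVec, norm_coords_sq]
        simpa using normSq_wedge_le m ν ω
    _ = _ := by simp; ring

end Algebra

/-! ### Exchanging two derivatives for `C¹` functions. -/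

section IntegrationByParts

open scoped RealInnerProductSpace Topology

variable {n : ℕ} {H : Type*} [NormedAddCommGroup H] [InnerProductSpace ℝ H]

theorem continuous_fderiv_apply_const {H : Type*} [NormedAddCommGroup H] [NormedSpace ℝ H]
    {g : Space n → H} (hg : ContDiff ℝ 1 g) (v : Space n) :
    Continuous fun x => fderiv ℝ g x v :=
  (hg.continuous_fderiv one_ne_zero).clm_apply continuous_const

theorem hasCompactSupport_inner_left {f g : Space n → H} (hf : HasCompactSupport f) :
    HasCompactSupport fun x => ⟪f x, g x⟫ :=
  hf.mono fun x hx h => hx (by simp [h])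

/-- With no second derivatives at hand, the outer derivative is taken in a translation parameter; it
then falls on `g`, and `f` need only be continuous. -/
theorem hasDerivAt_integral_inner_translate {f g : Space n → H} (hf : Continuous f)
    (hfc : HasCompactSupport f) (hg : ContDiff ℝ 1 g) (hgc : HasCompactSupport g) (v : Space n) :
    HasDerivAt (fun h : ℝ => ∫ x, ⟪f x, g (x + h • v)⟫) (∫ x, ⟪f x, fderiv ℝ g x v⟫) 0 := by
  obtain ⟨C, hC⟩ := (hgc.fderiv ℝ).exists_bound_of_continuous (hg.continuous_fderiv one_ne_zero)
  have h := hasDerivAt_integral_of_dominated_loc_of_deriv_le (μ := (volume : Measure (Space n)))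
    (s := univ) (x₀ := (0 : ℝ)) (F := fun h x => ⟪f x, g (x + h • v)⟫)
    (F' := fun h x => ⟪f x, fderiv ℝ g (x + h • v) v⟫)
    (bound := fun x => ‖f x‖ * (C * ‖v‖)) Filter.univ_mem ?_ ?_ ?_ ?_ ?_ ?_
  · simpa using h.2
  · refine Filter.Eventually.of_forall fun h => Continuous.aestronglyMeasurable ?_
    exact hf.inner (hg.continuous.comp (by fun_prop))
  · refine Continuous.integrable_of_hasCompactSupport ?_ (hasCompactSupport_inner_left hfc)
    exact hf.inner (hg.continuous.comp (by fun_prop))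
  · refine Continuous.aestronglyMeasurable ?_
    exact hf.inner ((continuous_fderiv_apply_const hg v).comp (by fun_prop))
  · refine Filter.Eventually.of_forall fun x h _ => ?_
    refine (norm_inner_le_norm _ _).trans ?_
    gcongr
    exact (ContinuousLinearMap.le_opNorm _ _).trans (by gcongr; exact hC _)
  · refine (Continuous.integrable_of_hasCompactSupport hf.norm hfc.norm).mul_const _
  · refine Filter.Eventually.of_forall fun x h _ => ?_
    have h1 : HasDerivAt (fun h : ℝ => x + h • v) v h := by
      simpa using ((hasDerivAt_id h).smul_const v).const_add x
    have h2 := ((hg.differentiable one_ne_zero) (x + h • v)).hasFDerivAt.comp_hasDerivAt h h1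
    simpa using (hasDerivAt_const h (f x)).inner ℝ h2

/-- Second-order integration by parts, for functions with only one continuous derivative. -/
theorem integral_inner_fderiv_comm {a b : Space n → H} (ha : ContDiff ℝ 1 a)
    (hac : HasCompactSupport a) (hb : ContDiff ℝ 1 b) (hbc : HasCompactSupport b)
    (u v : Space n) :
    ∫ x, ⟪fderiv ℝ a x u, fderiv ℝ b x v⟫ = ∫ x, ⟪fderiv ℝ a x v, fderiv ℝ b x u⟫ := by
  have hau := continuous_fderiv_apply_const ha u
  have hbu := continuous_fderiv_apply_const hb u
  have hauc : HasCompactSupport fun x => fderiv ℝ a x u := hac.fderiv_apply ℝ u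
  have hbuc : HasCompactSupport fun x => fderiv ℝ b x u := hbc.fderiv_apply ℝ u
  have h1 := hasDerivAt_integral_inner_translate hau hauc hb hbc v
  have h2 := hasDerivAt_integral_inner_translate hbu hbuc ha hac (-v)
  -- Ordinary integration by parts in direction `u` against the translate of `b`, followed by a
  -- change of variables moving the translation onto `a`. Differentiating both sides at `h = 0` is
  -- the claim.
  have h3 : ∀ h : ℝ, ∫ x, ⟪fderiv ℝ a x u, b (x + h • v)⟫ =
      - ∫ x, ⟪fderiv ℝ b x u, a (x + h • (-v))⟫ := by
    intro h
    have hbt : ContDiff ℝ 1 fun x => b (x + h • v) := hb.comp (by fun_prop)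
    have hfd : ∀ x, fderiv ℝ (fun x => b (x + h • v)) x = fderiv ℝ b (x + h • v) := fun x =>
      fderiv_comp_add_right _
    have e1 := integral_bilinear_fderiv_right_eq_neg_left_of_integrable
      (μ := (volume : Measure (Space n))) (f := a) (g := fun x => b (x + h • v)) (v := u)
      (B := innerSL ℝ) ?_ ?_ ?_ (fun x _ => ha.differentiable one_ne_zero x)
      (fun x _ => hbt.differentiable one_ne_zero x)
    · simp only [hfd] at e1
      change ∫ x, ⟪a x, fderiv ℝ b (x + h • v) u⟫ =
        - ∫ x, ⟪fderiv ℝ a x u, b (x + h • v)⟫ at e1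
      have e2 : ∫ x, ⟪fderiv ℝ b x u, a (x + h • (-v))⟫ =
          ∫ x, ⟪a x, fderiv ℝ b (x + h • v) u⟫ := by
        rw [← integral_add_right_eq_self _ (h • v)]
        simp [real_inner_comm]
      rw [e2, e1, neg_neg]
    · exact (hau.inner hbt.continuous).integrable_of_hasCompactSupport
        (hasCompactSupport_inner_left hauc)
    · exact (ha.continuous.inner (continuous_fderiv_apply_const hbt u)).integrable_of_hasCompactSupport
        (hasCompactSupport_inner_left hac)
    · exact (ha.continuous.inner hbt.continuous).integrable_of_hasCompactSupport
        (hasCompactSupport_inner_left hac)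
  simp only [h3] at h1
  have h4 := h1.unique h2.neg
  rw [h4, ← integral_neg]
  simp [real_inner_comm]

end IntegrationByParts

/-! ### The weak identity replacing `∫ ⟨δa, δb⟩ = 0`. -/

section Divergence

open scoped RealInnerProductSpace Topology

variable {n p : ℕ} {V : Type*} [NormedAddCommGroup V] [InnerProductSpace ℝ V]

theorem fderiv_coords_contract {a : Space n → Space n [⋀^Fin (p + 1)]→L[ℝ] V}
    {x : Space n} (ha : DifferentiableAt ℝ a x) (v w : Space n) :
    fderiv ℝ (fun y => coords (contract v (a y))) x w = coords (contract v (fderiv ℝ a x w)) := by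
  have h := (coords ∘L contract v : (Space n [⋀^Fin (p + 1)]→L[ℝ] V) →L[ℝ] _).hasFDerivAt.comp x
    ha.hasFDerivAt
  exact congrArg (fun L => L w) h.fderiv

/-- The quadratic form obtained from `⟨δa, δb⟩` by interchanging the two derivatives. -/
noncomputable def mixedForm (a b : Space n →L[ℝ] Space n [⋀^Fin (p + 1)]→L[ℝ] V) : ℝ :=
  ∑ k, ∑ l, ⟪coords (contract (basisVec l) (a (basisVec k))),
    coords (contract (basisVec k) (b (basisVec l)))⟫

theorem continuousOn_mixedForm {X : Type*} [TopologicalSpace X] {s : Set X}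
    {a b : X → Space n →L[ℝ] Space n [⋀^Fin (p + 1)]→L[ℝ] V} (ha : ContinuousOn a s)
    (hb : ContinuousOn b s) : ContinuousOn (fun x => mixedForm (a x) (b x)) s := by
  unfold mixedForm
  refine continuousOn_finsetSum _ fun k _ => continuousOn_finsetSum _ fun l _ => ?_
  exact ((coords ∘L contract (basisVec l)).continuous.comp_continuousOn
    (ha.clm_apply continuousOn_const)).inner ((coords ∘L contract (basisVec k)).continuous.comp_continuousOn
    (hb.clm_apply continuousOn_const))

/-- Exchanging derivatives in each pair `(k, l)` pairs `∑ l, ∂_l (ι_l a) = -δa` with `∂_k (ι_k b)`.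
This product vanishes pointwise, as `δa = 0` on the support of `b`. -/
theorem integral_mixedForm_of_contDiff {a b : Space n → Space n [⋀^Fin (p + 1)]→L[ℝ] V}
    (ha : ContDiff ℝ 1 a) (hac : HasCompactSupport a) (hb : ContDiff ℝ 1 b)
    (hbc : HasCompactSupport b) (hδ : ∀ x ∈ tsupport b, codiff a x = 0) :
    ∫ x, mixedForm (fderiv ℝ a x) (fderiv ℝ b x) = 0 := by
  set A : Fin n → Space n → Coords n p V := fun l y => coords (contract (basisVec l) (a y)) with hA
  set B : Fin n → Space n → Coords n p V := fun l y => coords (contract (basisVec l) (b y)) with hB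
  have cA : ∀ l, ContDiff ℝ 1 (A l) := fun l =>
    (coords (V := V) ∘L contract (n := n) (p := p) (basisVec l)).contDiff.comp ha
  have cB : ∀ l, ContDiff ℝ 1 (B l) := fun l =>
    (coords (V := V) ∘L contract (n := n) (p := p) (basisVec l)).contDiff.comp hb
  have sA : ∀ l, HasCompactSupport (A l) := fun l => hac.mono fun x hx h => hx (by simp [hA, h])
  have sB : ∀ l, HasCompactSupport (B l) := fun l => hbc.mono fun x hx h => hx (by simp [hB, h])
  have int : ∀ i j u v, Integrable fun x => ⟪fderiv ℝ (A i) x u, fderiv ℝ (B j) x v⟫ :=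
    fun i j u v => ((continuous_fderiv_apply_const (cA i) u).inner
      (continuous_fderiv_apply_const (cB j) v)).integrable_of_hasCompactSupport
      (hasCompactSupport_inner_left ((sA i).fderiv_apply ℝ u))
  have fA : ∀ x l v, coords (contract (basisVec l) (fderiv ℝ a x v)) = fderiv ℝ (A l) x v :=
    fun x l v => (fderiv_coords_contract (ha.differentiable one_ne_zero x) _ _).symm
  have fB : ∀ x l v, coords (contract (basisVec l) (fderiv ℝ b x v)) = fderiv ℝ (B l) x v :=
    fun x l v => (fderiv_coords_contract (hb.differentiable one_ne_zero x) _ _).symm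
  simp only [mixedForm, fA, fB]
  have e1 : ∀ k, ∫ x, ∑ l, ⟪fderiv ℝ (A l) x (basisVec k), fderiv ℝ (B k) x (basisVec l)⟫ =
      ∫ x, ⟪∑ l, fderiv ℝ (A l) x (basisVec l), fderiv ℝ (B k) x (basisVec k)⟫ := by
    intro k
    simp only [sum_inner]
    rw [integral_finsetSum _ fun l _ => int l k _ _, integral_finsetSum _ fun l _ => int l k _ _]
    exact Finset.sum_congr rfl fun l _ =>
      integral_inner_fderiv_comm (cA l) (sA l) (cB k) (sB k) (basisVec k) (basisVec l)
  rw [integral_finsetSum _ fun k _ => integrable_finsetSum _ fun l _ => int l k _ _]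
  refine Finset.sum_eq_zero fun k _ => ?_
  rw [e1, ← integral_zero (Space n) ℝ (μ := volume)]
  congr 1 with x
  by_cases hx : x ∈ tsupport b
  · have := congrArg coords (hδ x hx)
    rw [codiff, map_neg, map_zero, neg_eq_zero, _root_.map_sum] at this
    have h2 : ∑ i, fderiv ℝ (A i) x (basisVec i) = 0 := by
      rw [← this]
      exact Finset.sum_congr rfl fun i _ => (fA x i (basisVec i)).symm
    rw [h2, inner_zero_left]
  · rw [← fB, fderiv_of_notMem_tsupport ℝ hx]
    simp

/-- The integrand sees `a` only on `tsupport b`, so `a` may be multiplied by a cutoff equal to one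
near that set, which makes it globally `C¹` with compact support. -/
theorem integral_mixedForm {U : Set (Space n)} (hU : IsOpen U)
    {a b : Space n → Space n [⋀^Fin (p + 1)]→L[ℝ] V}
    (ha : ContDiffOn ℝ 1 a U) (hb : ContDiff ℝ 1 b)
    (hbc : HasCompactSupport b) (hbU : tsupport b ⊆ U) (hδ : ∀ x ∈ U, codiff a x = 0) :
    ∫ x, mixedForm (fderiv ℝ a x) (fderiv ℝ b x) = 0 := by
  obtain ⟨R, hR⟩ := hbc.isCompact.isBounded.subset_ball 0
  -- Intersecting `U` with a ball gives the cutoff compact support.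
  obtain ⟨f, hf0, hf1, -⟩ := exists_contMDiffMap_zero_one_nhds_of_isClosed
    (modelWithCornersSelf ℝ (Space n)) (n := 1)
    (hU.inter (Metric.isOpen_ball (ε := R) (x := (0 : Space n)))).isClosed_compl
    (isClosed_tsupport b)
    (disjoint_compl_left_iff_subset.2 (subset_inter hbU hR))
  have hfs : tsupport f ⊆ U ∩ Metric.ball 0 R := by
    intro x hx
    by_contra h
    exact (notMem_tsupport_iff_eventuallyEq.2 
      (eventually_nhdsSet_iff_forall.1 hf0 x h)) hx
  have hfd : ContDiff ℝ 1 f := f.contMDiff.contDiff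
  have hfc : HasCompactSupport f := (isCompact_closedBall (0 : Space n) R).of_isClosed_subset
    (isClosed_tsupport _) ((hfs.trans inter_subset_right).trans Metric.ball_subset_closedBall)
  have hfa : ContDiff ℝ 1 fun x => f x • a x := by
    rw [contDiff_iff_contDiffAt]
    intro x
    by_cases hx : x ∈ tsupport f
    · exact hfd.contDiffAt.smul (ha.contDiffAt (hU.mem_nhds (hfs hx).1))
    · have : (fun x => f x • a x) =ᶠ[𝓝 x] fun _ => 0 :=
        (notMem_tsupport_iff_eventuallyEq.1 hx).mono fun y hy => by simp [hy]
      exact contDiffAt_const.congr_of_eventuallyEq this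
  have heq : ∀ x ∈ tsupport b, (fun x => f x • a x) =ᶠ[𝓝 x] a := fun x hx =>
    (eventually_nhdsSet_iff_forall.1 hf1 x hx).mono fun y hy => by simp [hy]
  have h := integral_mixedForm_of_contDiff hfa (hfc.mono fun x hx h => hx (by simp [h])) hb hbc
    fun x hx => by
      rw [codiff, (heq x hx).fderiv_eq]
      exact hδ x (hbU hx)
  rw [← h]
  congr 1 with x
  by_cases hx : x ∈ tsupport b
  · rw [(heq x hx).fderiv_eq]
  · simp [fderiv_of_notMem_tsupport ℝ hx, mixedForm]

end Divergence

/-! ### Ellipticity bounds for the density, uniform in `k₀` and `Qcrit`. -/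

section Density

open scoped RealInnerProductSpace Topology

variable {κ q k₀ : ℝ} {Qcrit : ℝ≥0∞} {ρ : ℝ → ℝ}

theorem subcritical_of_le {Q Q' : ℝ} (hQ : Q ∈ subcritical Qcrit) (h0 : 0 ≤ Q') (h : Q' ≤ Q) :
    Q' ∈ subcritical Qcrit :=
  ⟨h0, (ENNReal.ofReal_le_ofReal h).trans_lt hQ.2⟩

theorem isOpen_subcritical_inter_Ioi : IsOpen (subcritical Qcrit ∩ Ioi 0) := by
  have : subcritical Qcrit ∩ Ioi 0 = {Q | ENNReal.ofReal Q < Qcrit} ∩ Ioi 0 := by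
    ext Q
    simp only [subcritical, mem_inter_iff, mem_ofPred_eq, mem_Ioi]
    exact ⟨fun h => ⟨h.1.2, h.2⟩, fun h => ⟨⟨h.2.le, h.1⟩, h.2⟩⟩
  rw [this]
  exact (isOpen_lt ENNReal.continuous_ofReal continuous_const).inter isOpen_Ioi

theorem PowerDensity.differentiableAt (h : PowerDensity κ q k₀ Qcrit ρ) {Q : ℝ}
    (hQ : Q ∈ subcritical Qcrit) (h0 : 0 < Q) : DifferentiableAt ℝ ρ Q :=
  (h.contDiffOn.contDiffAt (isOpen_subcritical_inter_Ioi.mem_nhds ⟨hQ, h0⟩)).differentiableAt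
    one_ne_zero

/-- The derivative of `t ↦ t ρ(t²)` is `ρ(Q) + 2 Q ρ'(Q)` at `Q = t²`. -/
theorem PowerDensity.hasDerivAt (h : PowerDensity κ q k₀ Qcrit ρ) {t : ℝ}
    (hQ : t ^ 2 ∈ subcritical Qcrit) (h0 : 0 < t) :
    HasDerivAt (fun t => t * ρ (t ^ 2)) (ρ (t ^ 2) + 2 * t ^ 2 * deriv ρ (t ^ 2)) t := by
  have h1 : HasDerivAt (fun t : ℝ => t ^ 2) (2 * t) t := by simpa using hasDerivAt_pow 2 t
  have h2 : HasDerivAt (fun t => ρ (t ^ 2)) (deriv ρ (t ^ 2) * (2 * t)) t :=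
    HasDerivAt.comp t (h₂ := ρ) (h.differentiableAt hQ (by positivity)).hasDerivAt h1
  refine ((hasDerivAt_id t).fun_mul h2).congr_deriv ?_
  simp
  ring

theorem PowerDensity.continuousOn_mul (h : PowerDensity κ q k₀ Qcrit ρ) {T : ℝ}
    (hQ : T ^ 2 ∈ subcritical Qcrit) :
    ContinuousOn (fun t => t * ρ (t ^ 2)) (Icc 0 T) := by
  refine continuousOn_id.mul (h.continuousOn.comp (by fun_prop) fun t ht => ?_)
  exact subcritical_of_le hQ (by positivity) (by gcongr; exacts [ht.1, ht.2])

/-- The function `t ρ(t²)` vanishes at `t = 0` and its derivative on `(0, T)` is at most `κ (T² +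
k₀)^q`; integrate. Only continuity of `ρ` at zero is needed. -/
theorem PowerDensity.le_of_mem (h : PowerDensity κ q k₀ Qcrit ρ) (hκ : 0 < κ) (hq : 0 < q)
    (hk : 0 ≤ k₀) {T : ℝ} (hQ : T ^ 2 ∈ subcritical Qcrit) (h0 : 0 < T) :
    ρ (T ^ 2) ≤ κ * (T ^ 2 + k₀) ^ q := by
  have hmem : ∀ t ∈ Ioo 0 T, t ^ 2 ∈ subcritical Qcrit := fun t ht =>
    subcritical_of_le hQ (by positivity) (by gcongr; exacts [ht.1.le, ht.2.le])
  have hd : ∀ t ∈ Ioo 0 T, HasDerivAt (fun t => κ * (T ^ 2 + k₀) ^ q * t - t * ρ (t ^ 2))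
      (κ * (T ^ 2 + k₀) ^ q - (ρ (t ^ 2) + 2 * t ^ 2 * deriv ρ (t ^ 2))) t := fun t ht => by
    simpa using ((hasDerivAt_id t).const_mul (κ * (T ^ 2 + k₀) ^ q)).fun_sub
      (h.hasDerivAt (hmem t ht) ht.1)
  have hm : MonotoneOn (fun t => κ * (T ^ 2 + k₀) ^ q * t - t * ρ (t ^ 2)) (Icc 0 T) := by
    refine monotoneOn_of_deriv_nonneg (convex_Icc 0 T)
      ((by fun_prop : Continuous fun t => κ * (T ^ 2 + k₀) ^ q * t).continuousOn.sub
        (h.continuousOn_mul hQ)) ?_ ?_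
    · rw [interior_Icc]
      exact fun t ht => (hd t ht).differentiableAt.differentiableWithinAt
    · rw [interior_Icc]
      intro t ht
      rw [(hd t ht).deriv, sub_nonneg]
      refine (h.upper _ (hmem t ht) (pow_pos ht.1 2)).trans ?_
      gcongr
      exacts [ht.1.le, ht.2.le]
  have := hm (left_mem_Icc.2 h0.le) (right_mem_Icc.2 h0.le) h0.le
  simp only [mul_zero, zero_mul, sub_zero, sub_nonneg] at this
  exact le_of_mul_le_mul_left (by linarith) h0

/-- A lower bound `c` for the derivative of `t ρ(t²)`, in monotone form. It serves twice in the
lower bound for `ρ`, with `c = 0` and with `c > 0`. -/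
theorem PowerDensity.monotoneOn (h : PowerDensity κ q k₀ Qcrit ρ)
    {A T : ℝ} (hA : 0 ≤ A) (hQ : T ^ 2 ∈ subcritical Qcrit) {c : ℝ}
    (hc : ∀ t ∈ Ioo A T, c ≤ κ⁻¹ * (t ^ 2 + k₀) ^ q) :
    MonotoneOn (fun t => t * ρ (t ^ 2) - c * t) (Icc A T) := by
  have hmem : ∀ t ∈ Ioo A T, t ^ 2 ∈ subcritical Qcrit := fun t ht =>
    subcritical_of_le hQ (by positivity) (by gcongr; exacts [hA.trans ht.1.le, ht.2.le])
  have hd : ∀ t ∈ Ioo A T, HasDerivAt (fun t => t * ρ (t ^ 2) - c * t)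
      ((ρ (t ^ 2) + 2 * t ^ 2 * deriv ρ (t ^ 2)) - c) t := fun t ht => by
    simpa using (h.hasDerivAt (hmem t ht) (hA.trans_lt ht.1)).fun_sub
      ((hasDerivAt_id t).const_mul c)
  refine monotoneOn_of_deriv_nonneg (convex_Icc A T)
    (((h.continuousOn_mul hQ).mono (Icc_subset_Icc_left hA)).sub
      (by fun_prop : Continuous fun t => c * t).continuousOn) ?_ ?_
  · rw [interior_Icc]
    exact fun t ht => (hd t ht).differentiableAt.differentiableWithinAt
  · rw [interior_Icc]
    intro t ht
    rw [(hd t ht).deriv, sub_nonneg]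
    exact (hc t ht).trans (h.lower _ (hmem t ht) (pow_pos (hA.trans_lt ht.1) 2))

/-- Integrate the lower bound over `[T/2, T]`, where it is at least its value with `t = T/2` and `k₀
= 0`; on `[0, T/2]` monotonicity alone is used. The bound is free of `k₀` and so survives `k₀ → 0`.
-/
theorem PowerDensity.ge_of_mem (h : PowerDensity κ q k₀ Qcrit ρ) (hκ : 0 < κ) (hq : 0 < q)
    (hk : 0 ≤ k₀) {T : ℝ} (hQ : T ^ 2 ∈ subcritical Qcrit) (h0 : 0 < T) :
    κ⁻¹ / 2 * ((T / 2) ^ 2) ^ q ≤ ρ (T ^ 2) := by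
  have h1 := h.monotoneOn le_rfl hQ (c := 0) fun t _ => by positivity
  have h2 := h1 (left_mem_Icc.2 h0.le) (show T / 2 ∈ Icc 0 T by constructor <;> linarith)
    (by positivity)
  have h3 := h.monotoneOn (A := T / 2) (by positivity) hQ (c := κ⁻¹ * ((T / 2) ^ 2) ^ q)
    fun t ht => by
      have := ht.1
      gcongr
      have : (T / 2) ^ 2 ≤ t ^ 2 := by gcongr
      linarith
  have h4 := h3 (left_mem_Icc.2 (by linarith)) (right_mem_Icc.2 (by linarith)) (by linarith)
  simp only [zero_mul, sub_zero] at h2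
  refine le_of_mul_le_mul_left ?_ h0
  simp only at h4
  nlinarith

/-- On `Q ≥ 1` both eigenvalues of the linearised density are comparable to `Q ^ q`, uniformly for
bounded `k₀`. -/
theorem PowerDensity.bounds (h : PowerDensity κ q k₀ Qcrit ρ) (hκ : 0 < κ) (hq : 0 < q)
    (hk : 0 ≤ k₀) {M : ℝ} (hM : k₀ ≤ M) {Q : ℝ} (hQ : Q ∈ subcritical Qcrit) (h1 : 1 ≤ Q) :
    (κ⁻¹ / 2 * (1 / 4) ^ q * Q ^ q ≤ ρ Q ∧ ρ Q ≤ κ * (1 + M) ^ q * Q ^ q) ∧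
    κ⁻¹ / 2 * (1 / 4) ^ q * Q ^ q ≤ ρ Q + 2 * Q * deriv ρ Q ∧
      ρ Q + 2 * Q * deriv ρ Q ≤ κ * (1 + M) ^ q * Q ^ q := by
  have h0 : 0 < Q := by linarith
  have hs : √Q ^ 2 = Q := Real.sq_sqrt h0.le
  -- Here `Q ≥ 1` enters: `Q + k₀ ≤ (1 + M) Q`.
  have hup : κ * (Q + k₀) ^ q ≤ κ * (1 + M) ^ q * Q ^ q := by
    rw [mul_assoc, ← Real.mul_rpow (by linarith) h0.le]
    gcongr
    nlinarith
  have e1 : κ⁻¹ / 2 * (1 / 4) ^ q * Q ^ q = κ⁻¹ / 2 * ((√Q / 2) ^ 2) ^ q := by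
    rw [mul_assoc, ← Real.mul_rpow (by norm_num) h0.le, div_pow, hs]
    congr 2
    ring
  refine ⟨⟨?_, ?_⟩, ?_, ?_⟩
  · have := h.ge_of_mem hκ hq hk (T := √Q) (by rwa [hs]) (by positivity)
    rw [hs] at this
    rwa [e1]
  · have := h.le_of_mem hκ hq hk (T := √Q) (by rwa [hs]) (by positivity)
    rw [hs] at this
    exact this.trans hup
  · refine le_trans ?_ (h.lower Q hQ h0)
    have e2 : (1 / 4 : ℝ) ^ q * Q ^ q ≤ (Q + k₀) ^ q := by
      rw [← Real.mul_rpow (by norm_num) h0.le]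
      gcongr
      linarith
    have : 0 < κ⁻¹ := by positivity
    have : 0 ≤ (1 / 4 : ℝ) ^ q * Q ^ q := by positivity
    nlinarith
  · exact (h.upper Q hQ h0).trans hup

end Density

/-! ### The scalar inequality behind the energy estimate. -/

section Pointwise

open scoped RealInnerProductSpace Topology

-- Dictionary: `W = Q^q`, `r = |ω|`, `d = |∇ω|`, `gq = |∇Q|`, `g = |∇η|`, and `e` measures `dω`. The
-- variables `s1`, …, `s4` are cross terms, `Ggq` and `Gqq` inner products of contractions of `ω`
-- with `∇η` and `∇Q`. The two quadratic terms in the gradient are coercive because `ρ` and `ρ +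
-- 2r²ρ'` both lie in `[cW, ΘW]`; Young's inequality absorbs the rest.
set_option maxHeartbeats 1000000 in
theorem caccioppoli_pointwise {c Θ W ρ ρ' r η f f' d e gq g s1 s2 s3 s4 Ggq Gqq : ℝ}
    (hc : 0 < c) (hΘ : 0 < Θ) (hW : 0 < W) (hr : 0 < r) (hf : 0 ≤ f) (hf' : 0 ≤ f')
    (hd : 0 ≤ d) (he : 0 ≤ e) (hgq : 0 ≤ gq) (hg : 0 ≤ g)
    (hρ1 : c * W ≤ ρ) (hρ2 : ρ ≤ Θ * W) (hρ3 : c * W ≤ ρ + 2 * r ^ 2 * ρ')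
    (hρ4 : ρ + 2 * r ^ 2 * ρ' ≤ Θ * W) (hgqd : gq ≤ 2 * r * d)
    (h1 : |s1| ≤ e * d) (h2 : |s2| ≤ gq * e * r) (h3 : |s3| ≤ g * gq) (h4 : |s4| ≤ g * e * r)
    (hG0 : 0 ≤ Gqq) (hG1 : Gqq ≤ r ^ 2 * gq ^ 2) (hG : |Ggq| ≤ r ^ 2 * g * gq) :
    c / 2 * W * (η ^ 2 * f * d ^ 2) ≤
      (η ^ 2 * f * (ρ * (d ^ 2 - s1) + ρ' * (gq ^ 2 / 2 - s2)) +
        ρ * (2 * η * f * (s3 / 2 - s4) + η ^ 2 * f' * (gq ^ 2 / 2 - s2)) +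
        ρ' * (2 * η * f * Ggq + η ^ 2 * f' * Gqq)) +
      (20 * Θ ^ 2 / c + Θ) * W * (η ^ 2 * f * e ^ 2 + η ^ 2 * f' * (e ^ 2 * r ^ 2) +
        f * (g ^ 2 * r ^ 2)) := by
  have hρ0 : 0 < ρ := lt_of_lt_of_le (by positivity) hρ1
  -- The difference of two numbers in `[cW, ΘW]` is at most `ΘW` in absolute value, and here it is
  -- `2r²ρ'`.
  have hP : |ρ'| * r ^ 2 ≤ Θ * W / 2 := by
    have : 0 < c * W := by positivity
    rcases abs_cases ρ' with ⟨h, _⟩ | ⟨h, _⟩ <;> rw [h] <;> nlinarith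
  -- If `ρ' ≥ 0`, drop its term and use `ρ ≥ cW`. If `ρ' < 0`, the bound `gq² ≤ 4r²d²` reduces the
  -- expression to `(ρ + 2r²ρ') d²`. `B1` follows the same pattern.
  have A1 : c * W * d ^ 2 ≤ ρ * d ^ 2 + ρ' * (gq ^ 2 / 2) := by
    have h5 : gq ^ 2 ≤ 4 * r ^ 2 * d ^ 2 := by
      calc gq ^ 2 ≤ (2 * r * d) ^ 2 := by gcongr
        _ = _ := by ring
    rcases le_total 0 ρ' with h | h
    · have := mul_nonneg h (sq_nonneg gq)
      nlinarith [sq_nonneg d]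
    · have := mul_le_mul_of_nonpos_left h5 h
      nlinarith [sq_nonneg d]
  have A2 : ρ * s1 ≤ Θ * W * (e * d) :=
    calc ρ * s1 ≤ ρ * (e * d) := by gcongr; exact (le_abs_self _).trans h1
      _ ≤ _ := by gcongr
  have A3 : ρ' * s2 ≤ Θ * W * (e * d) :=
    calc ρ' * s2 ≤ |ρ'| * |s2| := by rw [← abs_mul]; exact le_abs_self _
      _ ≤ |ρ'| * ((2 * r * d) * e * r) := by gcongr; exact h2.trans (by gcongr)
      _ = (|ρ'| * r ^ 2) * (2 * (e * d)) := by ring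
      _ ≤ (Θ * W / 2) * (2 * (e * d)) := by gcongr
      _ = _ := by ring
  have B1 : c * W * (gq ^ 2 / 2) ≤ ρ * (gq ^ 2 / 2) + ρ' * Gqq := by
    rcases le_total 0 ρ' with h | h
    · have := mul_nonneg h hG0
      nlinarith [sq_nonneg gq]
    · have := mul_le_mul_of_nonpos_left hG1 h
      nlinarith [sq_nonneg gq]
  have B2 : ρ * s2 ≤ Θ * W * (gq * e * r) :=
    calc ρ * s2 ≤ ρ * (gq * e * r) := by gcongr; exact (le_abs_self _).trans h2
      _ ≤ _ := by gcongr
  have C1 : -(2 * |η| * f * (Θ * W * (g * r * (2 * d + e)))) ≤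
      2 * η * f * (ρ * (s3 / 2 - s4) + ρ' * Ggq) := by
    have h5 : |ρ * (s3 / 2 - s4) + ρ' * Ggq| ≤ Θ * W * (g * r * (2 * d + e)) := by
      have h6 : |s3 / 2 - s4| ≤ g * gq / 2 + g * e * r := by
        refine (abs_sub _ _).trans ?_
        rw [abs_div, abs_two]
        linarith
      calc |ρ * (s3 / 2 - s4) + ρ' * Ggq| ≤ |ρ * (s3 / 2 - s4)| + |ρ' * Ggq| := abs_add_le _ _
        _ = ρ * |s3 / 2 - s4| + |ρ'| * |Ggq| := by rw [abs_mul, abs_mul, abs_of_pos hρ0]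
        _ ≤ (Θ * W) * (g * gq / 2 + g * e * r) + |ρ'| * (r ^ 2 * g * gq) := by gcongr
        _ = (Θ * W) * (g * gq / 2 + g * e * r) + (|ρ'| * r ^ 2) * (g * gq) := by ring
        _ ≤ (Θ * W) * (g * gq / 2 + g * e * r) + (Θ * W / 2) * (g * gq) := by gcongr
        _ = Θ * W * (g * (gq + e * r)) := by ring
        _ ≤ Θ * W * (g * (2 * r * d + e * r)) := by gcongr
        _ = _ := by ring
    have h7 : |2 * η * f * (ρ * (s3 / 2 - s4) + ρ' * Ggq)| ≤
        2 * |η| * f * (Θ * W * (g * r * (2 * d + e))) := by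
      rw [abs_mul, abs_mul, abs_mul, abs_two, abs_of_nonneg hf]
      gcongr
    linarith [neg_abs_le (2 * η * f * (ρ * (s3 / 2 - s4) + ρ' * Ggq))]
  -- Writing `Θ = z c` makes the defects in the three Young inequalities explicit sums of squares
  -- with nonnegative coefficients.
  obtain ⟨z, rfl⟩ : ∃ z, Θ = z * c := ⟨Θ / c, by field_simp⟩
  have hz : 0 < z := pos_of_mul_pos_left hΘ hc.le
  have hzc : (z * c) ^ 2 / c = z ^ 2 * c := by field_simp
  have e20 : 20 * (z * c) ^ 2 / c = 20 * (z ^ 2 * c) := by rw [← hzc]; ring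
  rw [e20]
  set Θ := z * c
  have young1 : 2 * Θ * (e * d) ≤ c / 4 * d ^ 2 + 4 * (z ^ 2 * c) * e ^ 2 := by
    have : c / 4 * d ^ 2 + 4 * (z ^ 2 * c) * e ^ 2 - 2 * (z * c) * (e * d) =
      c * (d / 2 - 2 * z * e) ^ 2 := by ring
    have : 0 ≤ c * (d / 2 - 2 * z * e) ^ 2 := by positivity
    linarith
  have young2 : Θ * (gq * e * r) ≤ c * (gq ^ 2 / 2) + z ^ 2 * c * (e ^ 2 * r ^ 2) := by
    have : c * (gq ^ 2 / 2) + z ^ 2 * c * (e ^ 2 * r ^ 2) - z * c * (gq * e * r) =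
      c / 2 * ((gq - z * (e * r)) ^ 2 + (z * (e * r)) ^ 2) := by ring
    have : 0 ≤ c / 2 * ((gq - z * (e * r)) ^ 2 + (z * (e * r)) ^ 2) := by positivity
    linarith
  have young3 : 2 * |η| * (Θ * (g * r * (2 * d + e))) ≤
      c / 4 * (η ^ 2 * d ^ 2) + (16 * (z ^ 2 * c) + Θ) * (g ^ 2 * r ^ 2) +
        Θ * (η ^ 2 * e ^ 2) := by
    rw [← sq_abs η]
    generalize |η| = y
    have : c / 4 * (y ^ 2 * d ^ 2) + (16 * (z ^ 2 * c) + z * c) * (g ^ 2 * r ^ 2) +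
        z * c * (y ^ 2 * e ^ 2) - 2 * y * (z * c * (g * r * (2 * d + e))) =
      c * (y * d / 2 - 4 * z * (g * r)) ^ 2 + z * c * (g * r - y * e) ^ 2 := by ring
    have : 0 ≤ c * (y * d / 2 - 4 * z * (g * r)) ^ 2 + z * c * (g * r - y * e) ^ 2 := by
      positivity
    linarith
  have T1 : W * (η ^ 2 * f * (c * d ^ 2 - 2 * Θ * (e * d))) ≤
      η ^ 2 * f * (ρ * (d ^ 2 - s1) + ρ' * (gq ^ 2 / 2 - s2)) := by
    have : 0 ≤ η ^ 2 * f := by positivity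
    have := mul_le_mul_of_nonneg_left (show W * (c * d ^ 2 - 2 * Θ * (e * d)) ≤
      ρ * (d ^ 2 - s1) + ρ' * (gq ^ 2 / 2 - s2) by linarith) this
    linarith
  have T2 : W * (η ^ 2 * f' * (c * (gq ^ 2 / 2) - Θ * (gq * e * r))) ≤
      η ^ 2 * f' * (ρ * (gq ^ 2 / 2 - s2) + ρ' * Gqq) := by
    have : 0 ≤ η ^ 2 * f' := by positivity
    have := mul_le_mul_of_nonneg_left (show W * (c * (gq ^ 2 / 2) - Θ * (gq * e * r)) ≤
      ρ * (gq ^ 2 / 2 - s2) + ρ' * Gqq by linarith) this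
    linarith
  have E1 : W * (η ^ 2 * f) * (2 * Θ * (e * d)) ≤
      W * (η ^ 2 * f) * (c / 4 * d ^ 2 + 4 * (z ^ 2 * c) * e ^ 2) := by gcongr
  have E2 : W * (η ^ 2 * f') * (Θ * (gq * e * r)) ≤
      W * (η ^ 2 * f') * (c * (gq ^ 2 / 2) + z ^ 2 * c * (e ^ 2 * r ^ 2)) := by gcongr
  have E3 : W * f * (2 * |η| * (Θ * (g * r * (2 * d + e)))) ≤
      W * f * (c / 4 * (η ^ 2 * d ^ 2) + (16 * (z ^ 2 * c) + Θ) * (g ^ 2 * r ^ 2) +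
        Θ * (η ^ 2 * e ^ 2)) := by gcongr
  have N1 : 0 ≤ (z ^ 2 * c) * (W * (η ^ 2 * f * e ^ 2)) := by positivity
  have N2 : 0 ≤ (z ^ 2 * c) * (W * (η ^ 2 * f' * (e ^ 2 * r ^ 2))) := by positivity
  have N3 : 0 ≤ (z ^ 2 * c) * (W * (f * (g ^ 2 * r ^ 2))) := by positivity
  have N4 : 0 ≤ Θ * (W * (η ^ 2 * f' * (e ^ 2 * r ^ 2))) := by positivity
  clear_value Θ
  generalize z ^ 2 * c = X at *
  linarith only [T1, T2, C1, E1, E2, E3, N1, N2, N3, N4]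

end Pointwise

/-! ### The same inequality for forms. -/

section PointwiseForms

open ContinuousAlternatingMap
open scoped RealInnerProductSpace Topology

variable {n p : ℕ} {V : Type*} [NormedAddCommGroup V] [InnerProductSpace ℝ V]

theorem abs_sum_inner_le {ι H : Type*} [Fintype ι] [NormedAddCommGroup H] [InnerProductSpace ℝ H]
    (x y : ι → H) : |∑ i, ⟪x i, y i⟫| ≤ √(∑ i, ‖x i‖ ^ 2) * √(∑ i, ‖y i‖ ^ 2) :=
  calc |∑ i, ⟪x i, y i⟫| ≤ ∑ i, |⟪x i, y i⟫| := Finset.abs_sum_le_sum_abs _ _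
    _ ≤ ∑ i, ‖x i‖ * ‖y i‖ := Finset.sum_le_sum fun _ _ => abs_real_inner_le_norm _ _
    _ ≤ _ := Real.sum_mul_le_sqrt_mul_sqrt _ _ _

theorem abs_sum_mul_inner_le {H : Type*} [NormedAddCommGroup H] [InnerProductSpace ℝ H]
    (v : Space n) (x : Fin n → H) (o : H) :
    |∑ i, v i * ⟪x i, o⟫| ≤ ‖v‖ * √(∑ i, ‖x i‖ ^ 2) * ‖o‖ := by
  have h := abs_sum_inner_le x fun i => v i • o
  have h1 : √(∑ i, ‖v i • o‖ ^ 2) = ‖v‖ * ‖o‖ := by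
    simp only [norm_smul, mul_pow, ← Finset.sum_mul]
    rw [← EuclideanSpace.norm_sq_eq, Real.sqrt_mul (by positivity), Real.sqrt_sq (norm_nonneg _), Real.sqrt_sq (norm_nonneg _)]
  simp only [inner_smul_right] at h
  rw [h1] at h
  linarith

/-- The gradient of `|ω|²` determined by the gradient `D` of `ω`. -/
noncomputable def gradNormSq (D : Space n →L[ℝ] Space n [⋀^Fin p]→L[ℝ] V)
    (ω : Space n [⋀^Fin p]→L[ℝ] V) : Space n :=
  WithLp.toLp 2 fun k => 2 * ⟪coords (D (basisVec k)), coords ω⟫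

/-- The squared norm of a gradient. -/
noncomputable def gradSq (D : Space n →L[ℝ] Space n [⋀^Fin p]→L[ℝ] V) : ℝ :=
  ∑ k, ‖coords (D (basisVec k))‖ ^ 2

theorem gradSq_nonneg (D : Space n →L[ℝ] Space n [⋀^Fin p]→L[ℝ] V) : 0 ≤ gradSq D :=
  Finset.sum_nonneg fun _ _ => by positivity

theorem norm_gradNormSq_sq_le (D : Space n →L[ℝ] Space n [⋀^Fin p]→L[ℝ] V)
    (ω : Space n [⋀^Fin p]→L[ℝ] V) :
    ‖gradNormSq D ω‖ ^ 2 ≤ 4 * normSq ω * gradSq D := by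
  rw [EuclideanSpace.real_norm_sq_eq, gradSq, Finset.mul_sum]
  refine Finset.sum_le_sum fun k _ => ?_
  have h := abs_real_inner_le_norm (coords (D (basisVec k))) (coords ω)
  rw [← norm_coords_sq, ← sq_abs]
  simp only [gradNormSq, abs_mul, abs_two]
  calc _ ≤ (2 * (‖coords (D (basisVec k))‖ * ‖coords ω‖)) ^ 2 := by gcongr
    _ = _ := by ring

/-- Expand for `∇a = ρ D + r ⊗ ω` and `∇b = ψ D + t ⊗ ω`. In every product containing a `D`, the
contraction identity leaves an ordinary inner product minus a `dω` term; only the product of the two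
`ω` terms keeps its contractions. -/
theorem mixedForm_eq {a b D : Space n →L[ℝ] Space n [⋀^Fin (p + 1)]→L[ℝ] V}
    {ω : Space n [⋀^Fin (p + 1)]→L[ℝ] V} {ρ ψ : ℝ} {r t : Space n}
    (ha : ∀ k, a (basisVec k) = ρ • D (basisVec k) + r k • ω)
    (hb : ∀ k, b (basisVec k) = ψ • D (basisVec k) + t k • ω) :
    mixedForm a b =
      ψ * (ρ * (gradSq D - ∑ k, ⟪coords (contract (basisVec k) (alternatizeUncurryFin D)),
          coords (D (basisVec k))⟫) +
        ∑ k, r k * (⟪coords (D (basisVec k)), coords ω⟫ -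
          ⟪coords (contract (basisVec k) (alternatizeUncurryFin D)), coords ω⟫)) +
      ρ * ∑ k, t k * (⟪coords (D (basisVec k)), coords ω⟫ -
          ⟪coords (contract (basisVec k) (alternatizeUncurryFin D)), coords ω⟫) +
      ⟪coords (contract t ω), coords (contract r ω)⟫ := by
  have h1 : ∀ l β, ∑ k, ⟪coords (contract (basisVec l) (D (basisVec k))),
      coords (contract (basisVec k) β)⟫ = ⟪coords (D (basisVec l)), coords β⟫ -
        ⟪coords (contract (basisVec l) (alternatizeUncurryFin D)), coords β⟫ := fun l β =>
    sum_inner_coords_contract D β (basisVec l)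
  have h2 : ⟪coords (contract t ω), coords (contract r ω)⟫ =
      ∑ k, ∑ l, r k * t l * ⟪coords (contract (basisVec l) ω),
        coords (contract (basisVec k) ω)⟫ := by
    rw [contract_eq_sum t, contract_eq_sum r, _root_.map_sum, _root_.map_sum, inner_sum]
    refine Finset.sum_congr rfl fun k _ => ?_
    rw [sum_inner]
    refine Finset.sum_congr rfl fun l _ => ?_
    rw [map_smul, map_smul, real_inner_smul_left, real_inner_smul_right]
    ring
  have h3 : mixedForm a b =
      ρ * ψ * (∑ l, ∑ k, ⟪coords (contract (basisVec l) (D (basisVec k))),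
        coords (contract (basisVec k) (D (basisVec l)))⟫) +
      ρ * (∑ l, t l * ∑ k, ⟪coords (contract (basisVec l) (D (basisVec k))),
        coords (contract (basisVec k) ω)⟫) +
      ψ * (∑ k, r k * ∑ l, ⟪coords (contract (basisVec k) (D (basisVec l))),
        coords (contract (basisVec l) ω)⟫) +
      ∑ k, ∑ l, r k * t l * ⟪coords (contract (basisVec l) ω),
        coords (contract (basisVec k) ω)⟫ := by
    simp only [Finset.mul_sum]
    rw [Finset.sum_comm (f := fun l k => ρ * ψ * _), Finset.sum_comm (f := fun l k => ρ * (t l * _))]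
    simp only [← Finset.sum_add_distrib]
    refine Finset.sum_congr rfl fun k _ => Finset.sum_congr rfl fun l _ => ?_
    rw [ha, hb]
    simp only [map_add, map_smul, inner_add_left, inner_add_right, real_inner_smul_left,
      real_inner_smul_right]
    rw [real_inner_comm (coords (contract (basisVec k) (D (basisVec l))))
      (coords (contract (basisVec l) ω))]
    ring
  rw [h3, h2]
  simp only [h1]
  have h4 : ∑ k, (⟪coords (D (basisVec k)), coords (D (basisVec k))⟫ -
      ⟪coords (contract (basisVec k) (alternatizeUncurryFin D)), coords (D (basisVec k))⟫) =
      gradSq D - ∑ k, ⟪coords (contract (basisVec k) (alternatizeUncurryFin D)),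
          coords (D (basisVec k))⟫ := by
    rw [Finset.sum_sub_distrib, gradSq]
    simp only [real_inner_self_eq_norm_sq]
  rw [h4]
  ring

/-- The hypotheses on `a` and `b` are the product rule for `ρ(Q) ω` and for the test form `η² f(Q)
ω`, with `g = ∇η`. -/
theorem caccioppoli_mixedForm {c Θ W ρ ρ' η f f' : ℝ} {g : Space n}
    {a b D : Space n →L[ℝ] Space n [⋀^Fin (p + 1)]→L[ℝ] V}
    {ω : Space n [⋀^Fin (p + 1)]→L[ℝ] V}
    (hc : 0 < c) (hΘ : 0 < Θ) (hW : 0 < W) (hω : 0 < normSq ω) (hf : 0 ≤ f) (hf' : 0 ≤ f')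
    (hρ1 : c * W ≤ ρ) (hρ2 : ρ ≤ Θ * W) (hρ3 : c * W ≤ ρ + 2 * normSq ω * ρ')
    (hρ4 : ρ + 2 * normSq ω * ρ' ≤ Θ * W)
    (ha : ∀ k, a (basisVec k) = ρ • D (basisVec k) + (ρ' * gradNormSq D ω k) • ω)
    (hb : ∀ k, b (basisVec k) = (η ^ 2 * f) • D (basisVec k) +
      (2 * η * f * g k + η ^ 2 * f' * gradNormSq D ω k) • ω) :
    c / 2 * W * (η ^ 2 * f * gradSq D) ≤ mixedForm a b +
      (20 * Θ ^ 2 / c + Θ) * W *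
        ((η ^ 2 * f + η ^ 2 * f' * normSq ω) *
          ∑ k, ‖coords (contract (basisVec k) (alternatizeUncurryFin D))‖ ^ 2 +
        f * (‖g‖ ^ 2 * normSq ω)) := by
  set E : Fin n → Coords n (p + 1) V :=
    fun k => coords (contract (basisVec k) (alternatizeUncurryFin D)) with hE
  set qv := gradNormSq D ω with hqv
  set o := coords ω with ho
  have hr0 : 0 < ‖o‖ := by
    rw [← norm_coords_sq] at hω
    exact norm_pos_iff.2 fun h => by rw [← ho, h] at hω; simp at hω
  have hr2 : ‖o‖ ^ 2 = normSq ω := norm_coords_sq ω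
  rw [← hr2] at hρ3 hρ4 ⊢
  have hd2 : √(gradSq D) ^ 2 = gradSq D := Real.sq_sqrt (gradSq_nonneg D)
  have he2 : √(∑ k, ‖E k‖ ^ 2) ^ 2 = ∑ k, ‖E k‖ ^ 2 :=
    Real.sq_sqrt (Finset.sum_nonneg fun _ _ => by positivity)
  have hgq : ‖qv‖ ≤ 2 * ‖o‖ * √(gradSq D) := by
    refine le_of_sq_le_sq ?_ (by positivity)
    refine (norm_gradNormSq_sq_le D ω).trans (le_of_eq ?_)
    rw [mul_pow, mul_pow, hd2, hr2]; ring
  have hGq := norm_coords_contract_sq_le ω qv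
  have hGg := norm_coords_contract_sq_le ω g
  have hG' : ∀ v, ‖coords (contract v ω)‖ ≤ ‖v‖ * ‖o‖ := fun v =>
    le_of_sq_le_sq ((norm_coords_contract_sq_le ω v).trans (by rw [mul_pow])) (by positivity)
  have hG : |⟪coords (contract g ω), coords (contract qv ω)⟫| ≤ ‖o‖ ^ 2 * ‖g‖ * ‖qv‖ :=
    (abs_real_inner_le_norm _ _).trans
      ((mul_le_mul (hG' g) (hG' qv) (norm_nonneg _) (by positivity)).trans (by ring_nf; rfl))
  have key := caccioppoli_pointwise (η := η) (s1 := ∑ k, ⟪E k, coords (D (basisVec k))⟫)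
    (s2 := ∑ k, qv k * ⟪E k, o⟫) (s3 := ∑ k, g k * qv k) (s4 := ∑ k, g k * ⟪E k, o⟫)
    (Ggq := ⟪coords (contract g ω), coords (contract qv ω)⟫)
    (Gqq := ‖coords (contract qv ω)‖ ^ 2) hc hΘ hW hr0 hf hf' (Real.sqrt_nonneg (gradSq D))
    (Real.sqrt_nonneg (∑ k, ‖E k‖ ^ 2)) (norm_nonneg qv) (norm_nonneg g) hρ1 hρ2 hρ3 hρ4 hgq
    (abs_sum_inner_le _ _) (abs_sum_mul_inner_le _ _ _) ?_ (abs_sum_mul_inner_le _ _ _)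
    (by positivity) (by linarith) hG
  swap
  · have := abs_real_inner_le_norm qv g
    rw [PiLp.inner_apply] at this
    simpa [mul_comm] using this
  have hmix := mixedForm_eq (r := ρ' • qv) (t := (2 * η * f) • g + (η ^ 2 * f') • qv)
    (by simpa using ha) (by simpa using hb)
  have hqq : ∑ k, qv k * ⟪coords (D (basisVec k)), o⟫ = ‖qv‖ ^ 2 / 2 := by
    rw [EuclideanSpace.real_norm_sq_eq, Finset.sum_div]
    refine Finset.sum_congr rfl fun k _ => ?_
    simp only [hqv, gradNormSq]
    ring
  have hgk : ∑ k, g k * ⟪coords (D (basisVec k)), o⟫ = (∑ k, g k * qv k) / 2 := by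
    rw [Finset.sum_div]
    refine Finset.sum_congr rfl fun k _ => ?_
    simp only [hqv, gradNormSq]
    ring
  have hsum1 : ∑ k, (ρ' • qv) k * (⟪coords (D (basisVec k)), o⟫ - ⟪E k, o⟫) =
      ρ' * (‖qv‖ ^ 2 / 2 - ∑ k, qv k * ⟪E k, o⟫) := by
    rw [← hqq, ← Finset.sum_sub_distrib, Finset.mul_sum]
    refine Finset.sum_congr rfl fun k _ => ?_
    simp
    ring
  have hsum2 : ∑ k, ((2 * η * f) • g + (η ^ 2 * f') • qv) k *
      (⟪coords (D (basisVec k)), o⟫ - ⟪E k, o⟫) =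
      2 * η * f * ((∑ k, g k * qv k) / 2 - ∑ k, g k * ⟪E k, o⟫) +
      η ^ 2 * f' * (‖qv‖ ^ 2 / 2 - ∑ k, qv k * ⟪E k, o⟫) := by
    rw [← hqq, ← hgk, ← Finset.sum_sub_distrib, ← Finset.sum_sub_distrib, Finset.mul_sum,
      Finset.mul_sum, ← Finset.sum_add_distrib]
    refine Finset.sum_congr rfl fun k _ => ?_
    simp
    ring
  have hsum3 : ⟪coords (contract ((2 * η * f) • g + (η ^ 2 * f') • qv) ω),
      coords (contract (ρ' • qv) ω)⟫ =
      ρ' * (2 * η * f * ⟪coords (contract g ω), coords (contract qv ω)⟫ +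
        η ^ 2 * f' * ‖coords (contract qv ω)‖ ^ 2) := by
    rw [← real_inner_self_eq_norm_sq]
    simp only [contract_eq, map_add, map_smul, inner_add_left, real_inner_smul_left,
      real_inner_smul_right]
    ring
  rw [hsum1, hsum2, hsum3] at hmix
  rw [hmix]
  rw [hd2, he2] at key
  refine key.trans (le_of_eq ?_)
  ring

end PointwiseForms

/-! ### The truncation and the level function. -/

section Truncation

open ContinuousAlternatingMap
open scoped RealInnerProductSpace Topology

/-- The `C¹` truncation `((1 - k/Q)₊)²`, vanishing for `Q ≤ k`. -/
noncomputable def trunc (k Q : ℝ) : ℝ := max (1 - k / Q) 0 ^ 2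

/-- The derivative of `trunc k`. -/
noncomputable def truncDeriv (k Q : ℝ) : ℝ := 2 * max (1 - k / Q) 0 * (k / Q ^ 2)

theorem hasDerivAt_max_zero_sq (x : ℝ) :
    HasDerivAt (fun x : ℝ => max x 0 ^ 2) (2 * max x 0) x := by
  rcases lt_trichotomy x 0 with h | rfl | h
  · have : (fun x : ℝ => max x 0 ^ 2) =ᶠ[𝓝 x] fun _ => 0 := by
      filter_upwards [Iio_mem_nhds h] with y hy
      simp [max_eq_right (le_of_lt (show y < 0 from hy))]
    simpa [max_eq_right h.le] using (hasDerivAt_const x (0 : ℝ)).congr_of_eventuallyEq this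
  · rw [hasDerivAt_iff_isLittleO]
    simp only [sub_zero, max_self, ne_eq, OfNat.ofNat_ne_zero, not_false_eq_true, zero_pow,
      mul_zero, smul_eq_mul]
    have h1 : (fun x : ℝ => max x 0 ^ 2) =O[𝓝 0] fun x => x ^ 2 := by
      refine Asymptotics.isBigO_of_le _ fun x => ?_
      rcases le_total x 0 with h | h <;> simp [h, sq_nonneg]
    refine h1.trans_isLittleO ?_
    simpa using Asymptotics.isLittleO_pow_pow (𝕜 := ℝ) (m := 1) (n := 2) (by norm_num)
  · have : (fun x : ℝ => max x 0 ^ 2) =ᶠ[𝓝 x] fun x => x ^ 2 := by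
      filter_upwards [Ioi_mem_nhds h] with y hy
      simp [max_eq_left (le_of_lt (show (0 : ℝ) < y from hy))]
    have h2 := (hasDerivAt_pow 2 x).congr_of_eventuallyEq this
    simpa [max_eq_left h.le] using h2

theorem hasDerivAt_trunc (k : ℝ) {Q : ℝ} (hQ : 0 < Q) :
    HasDerivAt (trunc k) (truncDeriv k Q) Q := by
  have h1 : HasDerivAt (fun Q : ℝ => 1 - k / Q) (k / Q ^ 2) Q := by
    have := ((hasDerivAt_inv hQ.ne').const_mul k).const_sub 1
    refine (this.congr_of_eventuallyEq (Filter.Eventually.of_forall fun y => ?_)).congr_deriv ?_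
    · simp [div_eq_mul_inv]
    · field_simp
  exact HasDerivAt.comp Q (h₂ := fun x : ℝ => max x 0 ^ 2) (hasDerivAt_max_zero_sq (1 - k / Q)) h1

theorem contDiffOn_trunc (k : ℝ) : ContDiffOn ℝ 1 (trunc k) (Ioi 0) := by
  rw [show (1 : WithTop ℕ∞) = 0 + 1 from rfl, contDiffOn_succ_iff_deriv_of_isOpen isOpen_Ioi]
  refine ⟨fun Q hQ => (hasDerivAt_trunc k hQ).differentiableAt.differentiableWithinAt, by simp, ?_⟩
  rw [contDiffOn_zero]
  have : ContinuousOn (truncDeriv k) (Ioi 0) := by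
    unfold truncDeriv
    refine ContinuousOn.mul (continuousOn_const.mul (ContinuousOn.sup (continuousOn_const.sub
      (continuousOn_const.div continuousOn_id fun _ hQ => ne_of_gt hQ)) continuousOn_const))
      (continuousOn_const.div (by fun_prop) fun Q hQ => pow_ne_zero 2 (ne_of_gt hQ))
  exact this.congr fun Q hQ => (hasDerivAt_trunc k hQ).deriv

theorem trunc_nonneg (k Q : ℝ) : 0 ≤ trunc k Q := by unfold trunc; positivity

theorem truncDeriv_nonneg {k : ℝ} (hk : 0 ≤ k) (Q : ℝ) : 0 ≤ truncDeriv k Q := by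
  unfold truncDeriv; positivity

theorem one_sub_div_nonpos {k Q : ℝ} (hQ : 0 < Q) (h : Q ≤ k) : 1 - k / Q ≤ 0 := by
  rw [sub_nonpos, le_div_iff₀ hQ]; linarith

theorem trunc_of_le {k Q : ℝ} (hQ : 0 < Q) (h : Q ≤ k) : trunc k Q = 0 := by
  simp [trunc, one_sub_div_nonpos hQ h]

theorem truncDeriv_of_le {k Q : ℝ} (hQ : 0 < Q) (h : Q ≤ k) : truncDeriv k Q = 0 := by
  simp [truncDeriv, one_sub_div_nonpos hQ h]

theorem trunc_le_one {k Q : ℝ} (hk : 0 ≤ k) (hQ : 0 < Q) : trunc k Q ≤ 1 := by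
  have : max (1 - k / Q) 0 ≤ 1 := max_le (by linarith [div_nonneg hk hQ.le]) zero_le_one
  exact pow_le_one₀ (le_max_right _ _) this

/-- This is why the positive part is squared: besides making `trunc` of class `C¹`, it bounds `Q f'`
by `√f`, so that `(Q f')²` is controlled by `f`. -/
theorem truncDeriv_mul_le {k Q : ℝ} (hQ : 0 < Q) (h : k < Q) :
    truncDeriv k Q * Q ≤ 2 * √(trunc k Q) := by
  rw [trunc, Real.sqrt_sq (le_max_right _ _), truncDeriv]
  have h2 : k / Q ≤ 1 := (div_le_one hQ).2 h.le
  have h3 : 0 ≤ max (1 - k / Q) 0 := le_max_right _ _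
  have : 2 * max (1 - k / Q) 0 * (k / Q ^ 2) * Q = 2 * max (1 - k / Q) 0 * (k / Q) := by
    field_simp
  rw [this]
  nlinarith

/-- The level function `Q ^ ((q+1)/2) ((1 - k/Q)₊)²`. -/
noncomputable def level (q k Q : ℝ) : ℝ := Q ^ ((q + 1) / 2) * trunc k Q

theorem hasDerivAt_level (q k : ℝ) {Q : ℝ} (hQ : 0 < Q) :
    HasDerivAt (level q k) ((q + 1) / 2 * Q ^ ((q + 1) / 2 - 1) * trunc k Q +
      Q ^ ((q + 1) / 2) * truncDeriv k Q) Q :=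
  (Real.hasDerivAt_rpow_const (Or.inl hQ.ne')).fun_mul (hasDerivAt_trunc k hQ)

theorem contDiffOn_level (q k : ℝ) : ContDiffOn ℝ 1 (level q k) (Ioi 0) :=
  ContDiffOn.mul (fun _ hQ => (Real.contDiffAt_rpow_const (Or.inl (ne_of_gt hQ))).contDiffWithinAt)
    (contDiffOn_trunc k)

theorem level_of_le {q k Q : ℝ} (hQ : 0 < Q) (h : Q ≤ k) : level q k Q = 0 := by
  simp [level, trunc_of_le hQ h]

theorem level_sq_le {q k Q : ℝ} (hk : 0 ≤ k) (hQ : 0 < Q) :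
    level q k Q ^ 2 ≤ Q ^ (q + 1) * trunc k Q := by
  have h1 := trunc_le_one hk hQ
  have h0 := trunc_nonneg k Q
  have h2 : (Q ^ ((q + 1) / 2)) ^ 2 = Q ^ (q + 1) := by
    rw [← Real.rpow_natCast, ← Real.rpow_mul hQ.le]
    congr 1
    push_cast
    ring
  rw [level, mul_pow, h2]
  have : 0 ≤ Q ^ (q + 1) := by positivity
  gcongr
  nlinarith

/-- Since `|∇Q|² ≤ 4Q|∇ω|²`, this bounds `|∇ level(Q)|²` by a multiple of `Q^q f |∇ω|²`, the
quantity controlled by the Caccioppoli estimate. -/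
theorem deriv_level_sq_mul_le {q k Q : ℝ} (hq : 0 < q) (hk : 0 ≤ k) (hQ : 0 < Q) :
    ((q + 1) / 2 * Q ^ ((q + 1) / 2 - 1) * trunc k Q + Q ^ ((q + 1) / 2) * truncDeriv k Q) ^ 2 * Q
      ≤ (q + 5) ^ 2 / 4 * Q ^ q * trunc k Q := by
  rcases le_or_gt Q k with h | h
  · simp [trunc_of_le hQ h, truncDeriv_of_le hQ h]
  have h0 := trunc_nonneg k Q
  have h1 := trunc_le_one hk hQ
  have h2 := truncDeriv_mul_le hQ h
  have h3 := truncDeriv_nonneg hk Q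
  have h4 : Q ^ ((q + 1) / 2) = Q ^ ((q + 1) / 2 - 1) * Q := by
    rw [← Real.rpow_add_one hQ.ne']; ring_nf
  have h5 : (Q ^ ((q + 1) / 2 - 1)) ^ 2 * Q = Q ^ q := by
    rw [← Real.rpow_natCast, ← Real.rpow_mul hQ.le, ← Real.rpow_add_one hQ.ne']
    congr 1
    push_cast
    ring
  have h6 : trunc k Q ≤ √(trunc k Q) := by
    nth_rewrite 1 [← Real.sq_sqrt h0]
    have := Real.sqrt_le_one.2 h1
    nlinarith [Real.sqrt_nonneg (trunc k Q)]
  have h7 : (q + 1) / 2 * trunc k Q + truncDeriv k Q * Q ≤ (q + 5) / 2 * √(trunc k Q) := by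
    nlinarith
  calc _ = ((q + 1) / 2 * trunc k Q + truncDeriv k Q * Q) ^ 2 *
        ((Q ^ ((q + 1) / 2 - 1)) ^ 2 * Q) := by rw [h4]; ring
    _ ≤ ((q + 5) / 2 * √(trunc k Q)) ^ 2 * Q ^ q := by rw [h5]; gcongr
    _ = _ := by rw [mul_pow, Real.sq_sqrt h0]; ring

end Truncation

/-! ### The pointwise energy inequality for a solution. -/

section Energy

open ContinuousAlternatingMap
open scoped RealInnerProductSpace Topology

variable {n p : ℕ} {V W : Type*} [NormedAddCommGroup V] [InnerProductSpace ℝ V]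
  [NormedAddCommGroup W] [NormedSpace ℝ W]

theorem inner_gradNormSq (D : Space n →L[ℝ] Space n [⋀^Fin p]→L[ℝ] V)
    (ω : Space n [⋀^Fin p]→L[ℝ] V) (v : Space n) :
    ⟪gradNormSq D ω, v⟫ = 2 * ⟪coords (D v), coords ω⟫ := by
  conv_rhs => rw [← sum_smul_basisVec v]
  rw [_root_.map_sum, _root_.map_sum, sum_inner, Finset.mul_sum, PiLp.inner_apply]
  refine Finset.sum_congr rfl fun k _ => ?_
  rw [map_smul, map_smul, real_inner_smul_left, gradNormSq]
  change v k * (2 * ⟪coords (D (basisVec k)), coords ω⟫) = _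
  ring

theorem inner_basisVec (v : Space n) (k : Fin n) : ⟪v, basisVec k⟫ = v k := by
  simp [basisVec, EuclideanSpace.inner_single_right]

theorem hasFDerivAt_normSq {ω : Space n → Space n [⋀^Fin p]→L[ℝ] V} {x : Space n}
    (hω : DifferentiableAt ℝ ω x) :
    HasFDerivAt (fun y => normSq (ω y)) (innerSL ℝ (gradNormSq (fderiv ℝ ω x) (ω x))) x := by
  have h := (((coords (n := n) (p := p) (V := V)).hasFDerivAt (x := ω x)).comp x
    hω.hasFDerivAt).norm_sq
  have h1 : (fun y => ‖((coords (n := n) (p := p) (V := V)) ∘ ω) y‖ ^ 2) =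
      fun y => normSq (ω y) := by
    ext y
    exact norm_coords_sq (ω y)
  rw [h1] at h
  refine h.congr_fderiv ?_
  ext v
  rw [innerSL_apply_apply, inner_gradNormSq]
  simp [real_inner_comm]

theorem fderiv_scaled_form_apply {ω : Space n → Space n [⋀^Fin p]→L[ℝ] V} {x : Space n}
    (hω : DifferentiableAt ℝ ω x) {ρ : ℝ → ℝ} (hρ : DifferentiableAt ℝ ρ (normSq (ω x)))
    (k : Fin n) :
    fderiv ℝ (fun y => ρ (normSq (ω y)) • ω y) x (basisVec k) =
      ρ (normSq (ω x)) • fderiv ℝ ω x (basisVec k) +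
        (deriv ρ (normSq (ω x)) * gradNormSq (fderiv ℝ ω x) (ω x) k) • ω x := by
  have h1 : HasFDerivAt (fun y => ρ (normSq (ω y))) _ x :=
    hρ.hasDerivAt.comp_hasFDerivAt x (hasFDerivAt_normSq hω)
  rw [(h1.fun_smul hω.hasFDerivAt).fderiv]
  simp [inner_basisVec]

theorem fderiv_test_form_apply {ω : Space n → Space n [⋀^Fin p]→L[ℝ] V} {x : Space n}
    (hω : DifferentiableAt ℝ ω x) {f : ℝ → ℝ} {f' : ℝ} (hf : HasDerivAt f f' (normSq (ω x)))
    {η : Space n → ℝ} (hη : DifferentiableAt ℝ η x) {g : Space n}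
    (hg : ∀ v, fderiv ℝ η x v = ⟪g, v⟫) (k : Fin n) :
    fderiv ℝ (fun y => (η y ^ 2 * f (normSq (ω y))) • ω y) x (basisVec k) =
      (η x ^ 2 * f (normSq (ω x))) • fderiv ℝ ω x (basisVec k) +
        (2 * η x * f (normSq (ω x)) * g k +
          η x ^ 2 * f' * gradNormSq (fderiv ℝ ω x) (ω x) k) • ω x := by
  have h1 : HasFDerivAt (fun y => f (normSq (ω y))) _ x :=
    hf.comp_hasFDerivAt x (hasFDerivAt_normSq hω)
  have h2 : HasFDerivAt (fun y => η y ^ 2) ((2 * η x) • fderiv ℝ η x) x := by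
    refine (hη.hasFDerivAt.fun_mul hη.hasFDerivAt).congr_fderiv ?_ |>.congr_of_eventuallyEq
      (Filter.Eventually.of_forall fun y => pow_two _)
    ext v
    simp
    ring
  rw [((h2.fun_mul h1).fun_smul hω.hasFDerivAt).fderiv]
  simp only [_root_.add_apply, _root_.smul_apply,
    ContinuousLinearMap.smulRight_apply, innerSL_apply_apply, inner_basisVec, hg, smul_eq_mul]
  congr 2
  ring

theorem norm_fderiv_mul_level_sq_le {ω : Space n → Space n [⋀^Fin p]→L[ℝ] V} {x : Space n}
    (hω : DifferentiableAt ℝ ω x) {q k : ℝ} (hq : 0 < q) (hk : 0 ≤ k) (hQ : 0 < normSq (ω x))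
    {η : Space n → ℝ} (hη : DifferentiableAt ℝ η x) :
    ‖fderiv ℝ (fun y => η y * level q k (normSq (ω y))) x‖ ^ 2 ≤
      2 * (normSq (ω x) ^ (q + 1) * trunc k (normSq (ω x)) * ‖fderiv ℝ η x‖ ^ 2) +
      2 * (q + 5) ^ 2 * (normSq (ω x) ^ q *
        (η x ^ 2 * trunc k (normSq (ω x)) * gradSq (fderiv ℝ ω x))) := by
  have h1 : HasFDerivAt (fun y => level q k (normSq (ω y))) _ x :=
    HasDerivAt.comp_hasFDerivAt (h₂ := level q k) x (hasDerivAt_level q k hQ)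
      (hasFDerivAt_normSq hω)
  have h2 := norm_gradNormSq_sq_le (fderiv ℝ ω x) (ω x)
  have h3 := deriv_level_sq_mul_le hq hk hQ
  have h4 := level_sq_le (q := q) hk hQ
  rw [(hη.hasFDerivAt.fun_mul h1).fderiv]
  set l' := (q + 1) / 2 * normSq (ω x) ^ ((q + 1) / 2 - 1) * trunc k (normSq (ω x)) +
      normSq (ω x) ^ ((q + 1) / 2) * truncDeriv k (normSq (ω x))
  set l := level q k (normSq (ω x))
  set Q := normSq (ω x)
  have h5 : (l' * ‖gradNormSq (fderiv ℝ ω x) (ω x)‖) ^ 2 ≤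
      (q + 5) ^ 2 * Q ^ q * trunc k Q * gradSq (fderiv ℝ ω x) :=
    calc _ = l' ^ 2 * ‖gradNormSq (fderiv ℝ ω x) (ω x)‖ ^ 2 := by ring
      _ ≤ l' ^ 2 * (4 * Q * gradSq (fderiv ℝ ω x)) := by gcongr
      _ = 4 * (l' ^ 2 * Q) * gradSq (fderiv ℝ ω x) := by ring
      _ ≤ 4 * ((q + 5) ^ 2 / 4 * Q ^ q * trunc k Q) * gradSq (fderiv ℝ ω x) := by
        have := gradSq_nonneg (fderiv ℝ ω x)
        gcongr
      _ = _ := by ring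
  have h6 : ‖η x • l' • (innerSL ℝ) (gradNormSq (fderiv ℝ ω x) (ω x)) + l • fderiv ℝ η x‖ ≤
      |η x| * |l' * ‖gradNormSq (fderiv ℝ ω x) (ω x)‖| + |l| * ‖fderiv ℝ η x‖ := by
    refine (norm_add_le _ _).trans (le_of_eq ?_)
    rw [norm_smul, norm_smul, norm_smul, innerSL_apply_norm, abs_mul, abs_norm]
    rfl
  calc _ ≤ (|η x| * |l' * ‖gradNormSq (fderiv ℝ ω x) (ω x)‖| + |l| * ‖fderiv ℝ η x‖) ^ 2 := by
        gcongr
    _ ≤ 2 * (|η x| * |l' * ‖gradNormSq (fderiv ℝ ω x) (ω x)‖|) ^ 2 +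
        2 * (|l| * ‖fderiv ℝ η x‖) ^ 2 := by
      nlinarith [sq_nonneg (|η x| * |l' * ‖gradNormSq (fderiv ℝ ω x) (ω x)‖| -
        |l| * ‖fderiv ℝ η x‖)]
    _ = 2 * (l ^ 2 * ‖fderiv ℝ η x‖ ^ 2) + 2 * (η x ^ 2 *
        (l' * ‖gradNormSq (fderiv ℝ ω x) (ω x)‖) ^ 2) := by
      rw [mul_pow, mul_pow, sq_abs, sq_abs, sq_abs]; ring
    _ ≤ 2 * (Q ^ (q + 1) * trunc k Q * ‖fderiv ℝ η x‖ ^ 2) + 2 * (η x ^ 2 *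
        ((q + 5) ^ 2 * Q ^ q * trunc k Q * gradSq (fderiv ℝ ω x))) := by gcongr
    _ = _ := by ring

/-- The constant in the pointwise energy inequality. -/
noncomputable def energyConst (q c Θ CE : ℝ) : ℝ :=
  4 * (q + 5) ^ 2 / c * ((20 * Θ ^ 2 / c + Θ) * (3 * CE + 1)) + 2

theorem energyConst_nonneg {q c Θ CE : ℝ} (hc : 0 < c) (hΘ : 0 < Θ) (hCE : 0 ≤ CE) :
    0 ≤ energyConst q c Θ CE := by unfold energyConst; positivity

/-- For `Q ≤ k` the truncation and its derivative vanish, so the left side and the mixed form are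
zero. For `Q > k ≥ 1` the ellipticity bounds apply, and `f ≤ 1` with `Q f' ≤ 2` accounts for the
factor `3 * CE + 1`. Degeneracy at small `Q` never enters. -/
theorem norm_fderiv_le_mixedForm {ω : Space n → Space n [⋀^Fin (p + 1)]→L[ℝ] V} {x : Space n}
    (hω : DifferentiableAt ℝ ω x) {q k c Θ CE N : ℝ} {ρ : ℝ → ℝ} (hq : 0 < q) (hk : 1 ≤ k)
    (hc : 0 < c) (hΘ : 0 < Θ) (hQ : 0 < normSq (ω x))
    (hρd : DifferentiableAt ℝ ρ (normSq (ω x)))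
    (hρ : 1 ≤ normSq (ω x) →
      (c * normSq (ω x) ^ q ≤ ρ (normSq (ω x)) ∧ ρ (normSq (ω x)) ≤ Θ * normSq (ω x) ^ q) ∧
      c * normSq (ω x) ^ q ≤
        ρ (normSq (ω x)) + 2 * normSq (ω x) * deriv ρ (normSq (ω x)) ∧
      ρ (normSq (ω x)) + 2 * normSq (ω x) * deriv ρ (normSq (ω x)) ≤ Θ * normSq (ω x) ^ q)
    (hCE : 0 ≤ CE) (hN : 0 ≤ N)
    (hE : ∑ k, ‖coords (contract (basisVec k) (alternatizeUncurryFin (fderiv ℝ ω x)))‖ ^ 2 ≤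
      CE * (N * normSq (ω x)))
    {η : Space n → ℝ} (hη : DifferentiableAt ℝ η x) :
    ‖fderiv ℝ (fun y => η y * level q k (normSq (ω y))) x‖ ^ 2 ≤
      4 * (q + 5) ^ 2 / c * mixedForm (fderiv ℝ (fun y => ρ (normSq (ω y)) • ω y) x)
        (fderiv ℝ (fun y => (η y ^ 2 * trunc k (normSq (ω y))) • ω y) x) +
      energyConst q c Θ CE * (if k < normSq (ω x) then normSq (ω x) ^ (q + 1) *
        (‖fderiv ℝ η x‖ ^ 2 + η x ^ 2 * N) else 0) := by
  have hk0 : 0 ≤ k := by linarith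
  set g := (InnerProductSpace.toDual ℝ (Space n)).symm (fderiv ℝ η x) with hg
  have hgn : ‖g‖ = ‖fderiv ℝ η x‖ := LinearIsometryEquiv.norm_map _ _
  have hgv : ∀ v, fderiv ℝ η x v = ⟪g, v⟫ := fun v => by
    rw [hg, InnerProductSpace.toDual_symm_apply]
  have ha := fderiv_scaled_form_apply hω hρd
  have hb := fderiv_test_form_apply hω (hasDerivAt_trunc k hQ) hη hgv
  have h1 := norm_fderiv_mul_level_sq_le hω hq hk0 hQ hη
  rcases le_or_gt (normSq (ω x)) k with hle | hlt
  · rw [if_neg (not_lt.2 hle)]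
    rw [trunc_of_le hQ hle] at h1 hb
    rw [truncDeriv_of_le hQ hle] at hb
    have : mixedForm (fderiv ℝ (fun y => ρ (normSq (ω y)) • ω y) x)
        (fderiv ℝ (fun y => (η y ^ 2 * trunc k (normSq (ω y))) • ω y) x) = 0 := by
      simp [mixedForm, hb]
    rw [this]
    simpa using h1
  · obtain ⟨⟨hρ1, hρ2⟩, hρ3, hρ4⟩ := hρ (hk.trans hlt.le)
    rw [if_pos hlt]
    have h2 := caccioppoli_mixedForm hc hΘ (by positivity) hQ (trunc_nonneg k _)
      (truncDeriv_nonneg hk0 _) hρ1 hρ2 hρ3 hρ4 ha hb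
    have hf0 := trunc_nonneg k (normSq (ω x))
    have hf1 := trunc_le_one hk0 hQ
    have hf2 : truncDeriv k (normSq (ω x)) * normSq (ω x) ≤ 2 :=
      (truncDeriv_mul_le hQ hlt).trans (by linarith [Real.sqrt_le_one.2 hf1])
    have hf3 := mul_nonneg (truncDeriv_nonneg hk0 (normSq (ω x))) hQ.le
    rw [hgn] at h2
    set mix := mixedForm (fderiv ℝ (fun y => ρ (normSq (ω y)) • ω y) x)
        (fderiv ℝ (fun y => (η y ^ 2 * trunc k (normSq (ω y))) • ω y) x)
    set SE := ∑ k, ‖coords (contract (basisVec k) (alternatizeUncurryFin (fderiv ℝ ω x)))‖ ^ 2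
    set Q := normSq (ω x)
    have hQq : Q ^ (q + 1) = Q ^ q * Q := Real.rpow_add_one hQ.ne' q
    have hW : 0 < Q ^ q := by positivity
    have h3 : (η x ^ 2 * trunc k Q + η x ^ 2 * truncDeriv k Q * Q) * SE +
        trunc k Q * (‖fderiv ℝ η x‖ ^ 2 * Q) ≤
        (3 * CE + 1) * (Q * (‖fderiv ℝ η x‖ ^ 2 + η x ^ 2 * N)) := by
      calc _ = η x ^ 2 * (trunc k Q + truncDeriv k Q * Q) * SE +
            trunc k Q * (‖fderiv ℝ η x‖ ^ 2 * Q) := by ring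
        _ ≤ η x ^ 2 * 3 * (CE * (N * Q)) + 1 * (‖fderiv ℝ η x‖ ^ 2 * Q) := by
          gcongr
          linarith
        _ ≤ _ := by
          have : 0 ≤ 3 * CE * (Q * ‖fderiv ℝ η x‖ ^ 2) := by positivity
          have : 0 ≤ Q * (η x ^ 2 * N) := by positivity
          linarith
    have h4 : 2 * (q + 5) ^ 2 * (Q ^ q * (η x ^ 2 * trunc k Q * gradSq (fderiv ℝ ω x))) ≤
        4 * (q + 5) ^ 2 / c * (mix + (20 * Θ ^ 2 / c + Θ) * Q ^ q *
          ((3 * CE + 1) * (Q * (‖fderiv ℝ η x‖ ^ 2 + η x ^ 2 * N)))) := by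
      calc _ = 4 * (q + 5) ^ 2 / c *
          (c / 2 * Q ^ q * (η x ^ 2 * trunc k Q * gradSq (fderiv ℝ ω x))) := by
            field_simp; ring
        _ ≤ _ := by
          gcongr
          refine h2.trans ?_
          gcongr
    have h5 : 2 * (Q ^ (q + 1) * trunc k Q * ‖fderiv ℝ η x‖ ^ 2) ≤
        2 * (Q ^ (q + 1) * (‖fderiv ℝ η x‖ ^ 2 + η x ^ 2 * N)) := by
      have : 0 ≤ η x ^ 2 * N := by positivity
      calc _ = 2 * (Q ^ (q + 1) * (trunc k Q * ‖fderiv ℝ η x‖ ^ 2)) := by ring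
        _ ≤ 2 * (Q ^ (q + 1) * (1 * ‖fderiv ℝ η x‖ ^ 2)) := by gcongr
        _ ≤ _ := by gcongr; linarith
    refine h1.trans ((add_le_add h5 h4).trans (le_of_eq ?_))
    rw [energyConst, hQq]
    ring

end Energy

/-! ### The integrated Caccioppoli inequality away from the singular set. -/

section EnergyIntegral

open ContinuousAlternatingMap
open scoped RealInnerProductSpace Topology

variable {n p : ℕ} {V W : Type*} [NormedAddCommGroup V] [InnerProductSpace ℝ V]
  [NormedAddCommGroup W] [NormedSpace ℝ W]

/-- When `∫ I = 0`, the positive and negative parts of `I` have the same finite integral; add the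
negative part to both sides, compare, and cancel. Neither `u` nor `h` need be integrable. -/
theorem lintegral_ofReal_le_of_le_add {α : Type*} [MeasurableSpace α] {μ : Measure α}
    {u I h : α → ℝ} (hu : ∀ x, 0 ≤ u x) (hh : ∀ x, 0 ≤ h x) (hI : Integrable I μ)
    (hI0 : ∫ x, I x ∂μ = 0) (hle : ∀ x, u x ≤ I x + h x) :
    ∫⁻ x, ENNReal.ofReal (u x) ∂μ ≤ ∫⁻ x, ENNReal.ofReal (h x) ∂μ := by
  have hm : AEMeasurable (fun x => ENNReal.ofReal (I x)) μ := hI.aestronglyMeasurable.aemeasurable.ennreal_ofReal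
  have hm' : AEMeasurable (fun x => ENNReal.ofReal (-I x)) μ :=
    hI.aestronglyMeasurable.aemeasurable.neg.ennreal_ofReal
  have hfin : ∫⁻ x, ENNReal.ofReal (-I x) ∂μ ≠ ∞ := hI.neg.lintegral_lt_top.ne
  have heq : ∫⁻ x, ENNReal.ofReal (I x) ∂μ = ∫⁻ x, ENNReal.ofReal (-I x) ∂μ := by
    have := integral_eq_lintegral_pos_part_sub_lintegral_neg_part hI
    rw [hI0, eq_comm, sub_eq_zero] at this
    exact (ENNReal.toReal_eq_toReal_iff' hI.lintegral_lt_top.ne hfin).1 this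
  have h1 : ∫⁻ x, ENNReal.ofReal (u x) ∂μ + ∫⁻ x, ENNReal.ofReal (-I x) ∂μ ≤
      ∫⁻ x, ENNReal.ofReal (h x) ∂μ + ∫⁻ x, ENNReal.ofReal (-I x) ∂μ := by
    conv_rhs => rw [← heq]
    rw [← lintegral_add_right' _ hm', ← lintegral_add_right' _ hm]
    refine lintegral_mono fun x => ?_
    rcases le_total 0 (I x) with h0 | h0
    · rw [ENNReal.ofReal_of_nonpos (neg_nonpos.2 h0), add_zero, ← ENNReal.ofReal_add (hh x) h0]
      exact ENNReal.ofReal_le_ofReal (by linarith [hle x])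
    · rw [ENNReal.ofReal_of_nonpos h0, add_zero,
        ← ENNReal.ofReal_add (hu x) (neg_nonneg.2 h0)]
      exact ENNReal.ofReal_le_ofReal (by linarith [hle x])
  exact (ENNReal.add_le_add_iff_right hfin).1 h1

theorem ofReal_norm_sq {E : Type*} [SeminormedAddGroup E] (y : E) :
    ENNReal.ofReal (‖y‖ ^ 2) = ‖y‖ₑ ^ 2 := by
  rw [ENNReal.ofReal_pow (norm_nonneg _), ofReal_norm]

theorem normSq_nonneg (ω : Space n [⋀^Fin p]→L[ℝ] V) : 0 ≤ normSq ω := by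
  rw [← norm_coords_sq]; positivity

theorem eq_zero_of_normSq_eq_zero {ω : Space n [⋀^Fin p]→L[ℝ] V} (h : normSq ω = 0) : ω = 0 := by
  apply ContinuousAlternatingMap.toAlternatingMap_injective
  refine (EuclideanSpace.basisFun (Fin n) ℝ).toBasis.ext_alternating fun I _ => ?_
  have h1 := norm_apply_basisVec_sq_le ω I
  rw [h, mul_zero] at h1
  have h2 : ω (fun j => basisVec (I j)) = 0 := by
    rw [← norm_eq_zero]
    exact pow_eq_zero_iff two_ne_zero |>.1 (le_antisymm h1 (by positivity))
  simpa [basisVec] using h2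

/-- The powers of `Q`, the truncation and `ρ` are `C¹` only for `Q > 0`. A point of `O` with `Q = 0`
has a neighbourhood where `Q < k`, and a point outside `O` has one where `η = 0`; in both cases `G`
vanishes nearby and extends by zero. -/
theorem contDiff_of_vanishing {H : Type*} [NormedAddCommGroup H] [NormedSpace ℝ H]
    {O : Set (Space n)} (hO : IsOpen O) {Q : Space n → ℝ} (hQ : ContinuousOn Q O)
    {η : Space n → ℝ}
    (hηc : HasCompactSupport η) (hηO : tsupport η ⊆ O) {k : ℝ} (hk : 0 < k) {G : Space n → H}
    (hG : ContDiffOn ℝ 1 G {x ∈ O | 0 < Q x}) (h1 : ∀ x, η x = 0 → G x = 0)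
    (h2 : ∀ x ∈ O, Q x < k → G x = 0) :
    (∀ x ∉ {x ∈ O | 0 < Q x}, G =ᶠ[𝓝 x] fun _ => 0) ∧
    ContDiff ℝ 1 G ∧ HasCompactSupport G ∧ tsupport G ⊆ {x ∈ O | 0 < Q x} := by
  have hU : IsOpen {x ∈ O | 0 < Q x} := hQ.isOpen_inter_preimage hO isOpen_Ioi
  have key : ∀ x ∉ {x ∈ O | 0 < Q x}, G =ᶠ[𝓝 x] fun _ => 0 := by
    intro x hx
    by_cases hxO : x ∈ O
    · have hQx : Q x < k := by
        by_contra h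
        exact hx ⟨hxO, by linarith⟩
      filter_upwards [(hQ.isOpen_inter_preimage hO isOpen_Iio).mem_nhds
        (⟨hxO, hQx⟩ : x ∈ O ∩ Q ⁻¹' Iio k)] with y hy
      exact h2 y hy.1 hy.2
    · have : x ∉ tsupport η := fun h => hxO (hηO h)
      filter_upwards [notMem_tsupport_iff_eventuallyEq.1 this] with y hy
      exact h1 y hy
  refine ⟨key, ?_, hηc.mono fun x hx h => hx (h1 x h), fun x hx => ?_⟩
  · rw [contDiff_iff_contDiffAt]
    intro x
    by_cases hx : x ∈ {x ∈ O | 0 < Q x}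
    · exact hG.contDiffAt (hU.mem_nhds hx)
    · exact contDiffAt_const.congr_of_eventuallyEq (key x hx)
  · by_contra h
    exact notMem_tsupport_iff_eventuallyEq.2 (key x h) hx

theorem level_eq_zero {q k Q : ℝ} (hq : 0 < q) (hQ : 0 ≤ Q) (h : Q ≤ k) : level q k Q = 0 := by
  rcases hQ.eq_or_lt with rfl | h0
  · rw [level, Real.zero_rpow (by positivity), zero_mul]
  · exact level_of_le h0 h

theorem contDiffOn_normSq {ω : Space n → Space n [⋀^Fin p]→L[ℝ] V} {O : Set (Space n)}
    (hω : ContDiffOn ℝ 1 ω O) : ContDiffOn ℝ 1 (fun x => normSq (ω x)) O := by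
  have h := (coords (n := n) (p := p) (V := V)).contDiff.comp_contDiffOn hω |>.norm_sq ℝ
  refine h.congr fun x _ => ?_
  simp [norm_coords_sq]

/-- The ellipticity constants of the class of densities. -/
noncomputable def energyBound (m : W →L[ℝ] V →L[ℝ] V) (n p : ℕ) (κ q M : ℝ) : ℝ :=
  energyConst q (κ⁻¹ / 2 * (1 / 4) ^ q) (κ * (1 + M) ^ q)
    (n * ((n : ℝ) ^ (p + 1 + 1) * ((p + 1 : ℕ) + 1) ^ 2 * ‖m‖ ^ 2 * (p + 1).factorial))

/-- The Caccioppoli inequality away from the singular set. -/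
theorem energy_inequality {m : W →L[ℝ] V →L[ℝ] V} {κ q M k₀ : ℝ} {Qcrit : ℝ≥0∞} {ρ : ℝ → ℝ}
    {O : Set (Space n)} {ω : Space n → Space n [⋀^Fin (p + 1)]→L[ℝ] V}
    {ν : Space n → Space n →L[ℝ] W} (hκ : 0 < κ) (hq : 0 < q) (hk₀ : 0 ≤ k₀) (hM : k₀ ≤ M)
    (hρ : PowerDensity κ q k₀ Qcrit ρ) (hO : IsOpen O)
    (hsol : IsClassicalSolution m Qcrit ρ O ω ν) {k : ℝ} (hk : 1 ≤ k) {η : Space n → ℝ}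
    (hη : ContDiff ℝ 1 η) (hηc : HasCompactSupport η) (hηO : tsupport η ⊆ O) :
    ContDiff ℝ 1 (fun x => η x * level q k (normSq (ω x))) ∧
    HasCompactSupport (fun x => η x * level q k (normSq (ω x))) ∧
    ∫⁻ x, ‖fderiv ℝ (fun x => η x * level q k (normSq (ω x))) x‖ₑ ^ 2 ≤
      ENNReal.ofReal (energyBound m n p κ q M) * ∫⁻ x in {x ∈ O | k < normSq (ω x)},
        ENNReal.ofReal (normSq (ω x) ^ (q + 1)) *
          (‖fderiv ℝ η x‖ₑ ^ 2 + ‖η x‖ₑ ^ 2 * ‖ν x‖ₑ ^ 2) := by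
  have hk0 : 0 < k := by linarith
  have hQd := contDiffOn_normSq hsol.contDiffOn_form
  set U := {x ∈ O | 0 < normSq (ω x)} with hUdef
  have hU : IsOpen U := hQd.continuousOn.isOpen_inter_preimage hO isOpen_Ioi
  have hUO : U ⊆ O := fun x hx => hx.1
  have hmaps : MapsTo (fun x => normSq (ω x)) U (Ioi 0) := fun x hx => hx.2
  obtain ⟨F0, F1, F2, -⟩ := contDiff_of_vanishing hO hQd.continuousOn hηc hηO hk0 (G := fun x => η x * level q k (normSq (ω x)))
    (hη.contDiffOn.mul ((contDiffOn_level q k).comp (hQd.mono hUO) hmaps))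
    (fun x hx => by simp [hx]) (fun x _ hx => by
      simp [level_eq_zero hq (normSq_nonneg (ω x)) hx.le])
  obtain ⟨b0, b1, b2, b3⟩ := contDiff_of_vanishing hO hQd.continuousOn hηc hηO hk0
    (G := fun x => (η x ^ 2 * trunc k (normSq (ω x))) • ω x)
    (((hη.pow 2).contDiffOn.mul ((contDiffOn_trunc k).comp (hQd.mono hUO) hmaps)).smul
      (hsol.contDiffOn_form.mono hUO))
    (fun x hx => by simp [hx]) (fun x _ hx => by
      rcases (normSq_nonneg (ω x)).eq_or_lt with h | h
      · rw [eq_zero_of_normSq_eq_zero h.symm, smul_zero]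
      · rw [trunc_of_le h hx.le, mul_zero, zero_smul])
  refine ⟨F1, F2, ?_⟩
  have hρU : ContDiffOn ℝ 1 (fun x => ρ (normSq (ω x))) U :=
    hρ.contDiffOn.comp (hQd.mono hUO) fun x hx => ⟨hsol.mem_subcritical x hx.1, hx.2⟩
  have ha : ContDiffOn ℝ 1 (fun x => ρ (normSq (ω x)) • ω x) U :=
    hρU.smul (hsol.contDiffOn_form.mono hUO)
  set I : Space n → ℝ := fun x => mixedForm (fderiv ℝ (fun y => ρ (normSq (ω y)) • ω y) x)
    (fderiv ℝ (fun y => (η y ^ 2 * trunc k (normSq (ω y))) • ω y) x) with hI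
  -- The test form is supported in `{Q > 0}`, where `ρ(Q) ω` is `C¹` although `ρ` need not be
  -- differentiable at zero.
  have hI0 : ∫ x, I x = 0 :=
    integral_mixedForm hU ha b1 b2 b3 fun x hx => hsol.codiff_eq x hx.1
  have hIint : Integrable I := by
    have hc : ContinuousOn I U := continuousOn_mixedForm
      (ha.continuousOn_fderiv_of_isOpen hU le_rfl) (b1.continuous_fderiv one_ne_zero).continuousOn
    refine (integrableOn_iff_integrable_of_support_subset (fun x hx => ?_)).1
      ((hc.mono b3).integrableOn_compact b2.isCompact)
    by_contra h
    apply hx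
    simp [hI, mixedForm, fderiv_of_notMem_tsupport ℝ h]
  set c := κ⁻¹ / 2 * (1 / 4) ^ q with hc
  set Θ := κ * (1 + M) ^ q with hΘ
  set CE : ℝ := n * ((n : ℝ) ^ (p + 1 + 1) * ((p + 1 : ℕ) + 1) ^ 2 * ‖m‖ ^ 2 * (p + 1).factorial)
    with hCE
  have hc0 : 0 < c := by positivity
  have hΘ0 : 0 < Θ := mul_pos hκ (Real.rpow_pos_of_pos (by linarith) _)
  have hCE0 : 0 ≤ CE := by positivity
  have hCb : energyBound m n p κ q M = energyConst q c Θ CE := rfl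
  have hC0 := energyConst_nonneg (q := q) hc0 hΘ0 hCE0
  have hpt : ∀ x, ‖fderiv ℝ (fun x => η x * level q k (normSq (ω x))) x‖ ^ 2 ≤
      4 * (q + 5) ^ 2 / c * I x + energyConst q c Θ CE *
        {x ∈ O | k < normSq (ω x)}.indicator (fun x => normSq (ω x) ^ (q + 1) *
          (‖fderiv ℝ η x‖ ^ 2 + η x ^ 2 * ‖ν x‖ ^ 2)) x := by
    intro x
    by_cases hx : x ∈ U
    · have hd : DifferentiableAt ℝ ω x :=
        (hsol.contDiffOn_form.contDiffAt (hO.mem_nhds hx.1)).differentiableAt one_ne_zero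
      have hE := norm_coords_contract_wedge_sq_le m (ν x) (ω x)
      rw [← hsol.extDeriv_eq x hx.1] at hE
      have h := norm_fderiv_le_mixedForm hd hq hk hc0 hΘ0 hx.2
        (hρ.differentiableAt (hsol.mem_subcritical x hx.1) hx.2)
        (hρ.bounds hκ hq hk₀ hM (hsol.mem_subcritical x hx.1)) hCE0 (sq_nonneg ‖ν x‖) hE
        (hη.differentiable one_ne_zero x)
      refine h.trans (le_of_eq ?_)
      congr 2
      by_cases hlt : k < normSq (ω x)
      · rw [if_pos hlt, indicator_of_mem (show x ∈ {x ∈ O | k < normSq (ω x)} from ⟨hx.1, hlt⟩)]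
      · rw [if_neg hlt, indicator_of_notMem (show x ∉ {x ∈ O | k < normSq (ω x)} from fun h => hlt h.2)]
    · rw [(F0 x hx).fderiv_eq, hI]
      simp only [(b0 x hx).fderiv_eq]
      have h0 : 0 ≤ {x ∈ O | k < normSq (ω x)}.indicator (fun x => normSq (ω x) ^ (q + 1) *
          (‖fderiv ℝ η x‖ ^ 2 + η x ^ 2 * ‖ν x‖ ^ 2)) x :=
        indicator_nonneg (fun y _ => by have := normSq_nonneg (ω y); positivity) x
      simpa [mixedForm] using mul_nonneg hC0 h0
  have hmeas : MeasurableSet {x ∈ O | k < normSq (ω x)} :=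
    (hQd.continuousOn.isOpen_inter_preimage hO isOpen_Ioi).measurableSet
  have h1 := lintegral_ofReal_le_of_le_add (fun x => sq_nonneg _) (fun x => mul_nonneg hC0
    (indicator_nonneg (fun y _ => by have := normSq_nonneg (ω y); positivity) x))
    (hIint.const_mul _) (by rw [integral_const_mul, hI0, mul_zero]) hpt
  simp only [ofReal_norm_sq] at h1
  refine h1.trans (le_of_eq ?_)
  rw [hCb, ← lintegral_indicator hmeas, ← lintegral_const_mul' _ _ ENNReal.ofReal_ne_top]
  refine lintegral_congr fun x => ?_
  rw [ENNReal.ofReal_mul hC0]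
  congr 1
  by_cases hx : x ∈ {x ∈ O | k < normSq (ω x)}
  · rw [indicator_of_mem hx, indicator_of_mem hx, ENNReal.ofReal_mul
      (by have := normSq_nonneg (ω x); positivity), ENNReal.ofReal_add (by positivity)
      (by positivity), ofReal_norm_sq, ENNReal.ofReal_mul (by positivity), ofReal_norm_sq,
      ← sq_abs, ← Real.norm_eq_abs, ofReal_norm_sq]
  · rw [indicator_of_notMem hx, indicator_of_notMem hx, ENNReal.ofReal_zero]

end EnergyIntegral

/-! ### Cutoffs of small capacity around the singular set. -/

section Cutoff

open scoped RealInnerProductSpace Topology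

variable {n : ℕ}

theorem exists_deriv_smoothTransition_bound :
    ∃ L : ℝ, 0 < L ∧ ∀ y, |deriv Real.smoothTransition y| ≤ L := by
  have hc : Continuous (deriv Real.smoothTransition) :=
    (Real.smoothTransition.contDiff (n := 1)).continuous_deriv le_rfl
  obtain ⟨C, hC⟩ := (isCompact_Icc (a := (-1 : ℝ)) (b := 2)).exists_bound_of_continuousOn
    hc.continuousOn
  refine ⟨max C 1, by positivity, fun y => ?_⟩
  by_cases hy : y ∈ Icc (-1 : ℝ) 2
  · exact (hC y hy).trans (le_max_left _ _)
  · have h0 : deriv Real.smoothTransition y = 0 := by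
      rw [mem_Icc, not_and_or, not_le, not_le] at hy
      rcases hy with hy | hy
      · have : Real.smoothTransition =ᶠ[𝓝 y] fun _ => 0 := by
          filter_upwards [Iio_mem_nhds hy] with z hz
          exact Real.smoothTransition.zero_of_nonpos (by linarith [show z < -1 from hz])
        rw [this.deriv_eq, deriv_const]
      · have : Real.smoothTransition =ᶠ[𝓝 y] fun _ => 1 := by
          filter_upwards [Ioi_mem_nhds hy] with z hz
          exact Real.smoothTransition.one_of_one_le (by linarith [show 2 < z from hz])
        rw [this.deriv_eq, deriv_const]
    rw [h0, abs_zero]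
    positivity

theorem deriv_smoothTransition_of_neg {y : ℝ} (hy : y < 0) :
    deriv Real.smoothTransition y = 0 := by
  have : Real.smoothTransition =ᶠ[𝓝 y] fun _ => 0 := by
    filter_upwards [Iio_mem_nhds hy] with z hz
    exact Real.smoothTransition.zero_of_nonpos (le_of_lt (show z < 0 from hz))
  rw [this.deriv_eq, deriv_const]

theorem hasFDerivAt_smoothTransition_comp {f : Space n → ℝ} {f' : Space n →L[ℝ] ℝ} {x : Space n}
    (hf : HasFDerivAt f f' x) :
    HasFDerivAt (fun y => Real.smoothTransition (f y))
      (deriv Real.smoothTransition (f x) • f') x :=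
  HasDerivAt.comp_hasFDerivAt (h₂ := Real.smoothTransition) x
    ((Real.smoothTransition.contDiff (n := 1)).differentiable one_ne_zero (f x)).hasDerivAt hf

/-- Radial cutoff functions between concentric balls. -/
theorem exists_radial_cutoff (n : ℕ) : ∃ L : ℝ, 0 < L ∧ ∀ (x₀ : Space n) (a b : ℝ), 0 < a → a < b →
    ∃ η : Space n → ℝ, ContDiff ℝ 1 η ∧ (∀ x, η x ∈ Icc (0 : ℝ) 1) ∧
      (∀ x ∈ Metric.closedBall x₀ a, η x = 1) ∧ (∀ x ∉ Metric.ball x₀ b, η x = 0) ∧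
      (∀ x, ‖fderiv ℝ η x‖ ≤ L / (b - a)) ∧
      ∀ x ∉ Metric.closedBall x₀ b, fderiv ℝ η x = 0 := by
  obtain ⟨L, hL, hLb⟩ := exists_deriv_smoothTransition_bound
  refine ⟨2 * L, by positivity, fun x₀ a b ha hab => ?_⟩
  have hpos : 0 < b ^ 2 - a ^ 2 := by nlinarith
  -- The profile uses the squared distance, which is smooth at the centre as well.
  have hd : ∀ x, HasFDerivAt (fun x : Space n => (b ^ 2 - ‖x - x₀‖ ^ 2) / (b ^ 2 - a ^ 2))
      (-((b ^ 2 - a ^ 2)⁻¹ * 2) • innerSL ℝ (x - x₀)) x := fun x => by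
    have h1 := (((hasFDerivAt_id x).sub_const x₀).norm_sq.const_sub (b ^ 2)).mul_const
      (b ^ 2 - a ^ 2)⁻¹
    refine (h1.congr_of_eventuallyEq (Filter.Eventually.of_forall fun y => ?_)).congr_fderiv ?_
    · simp [div_eq_mul_inv]
    · ext v
      simp
      ring
  have hfd := fun x => (hasFDerivAt_smoothTransition_comp (hd x)).fderiv
  have hout : ∀ x ∉ Metric.closedBall x₀ b, fderiv ℝ (fun x : Space n =>
      Real.smoothTransition ((b ^ 2 - ‖x - x₀‖ ^ 2) / (b ^ 2 - a ^ 2))) x = 0 := by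
    intro x hx
    rw [Metric.mem_closedBall, not_le, dist_eq_norm] at hx
    rw [hfd, deriv_smoothTransition_of_neg, zero_smul]
    refine div_neg_of_neg_of_pos ?_ hpos
    nlinarith
  refine ⟨fun x => Real.smoothTransition ((b ^ 2 - ‖x - x₀‖ ^ 2) / (b ^ 2 - a ^ 2)), ?_, ?_, ?_, ?_,
    ?_, hout⟩
  · refine Real.smoothTransition.contDiff.comp (ContDiff.div_const ?_ _)
    exact contDiff_const.sub ((contDiff_id.sub contDiff_const).norm_sq ℝ)
  · exact fun x => ⟨Real.smoothTransition.nonneg _, Real.smoothTransition.le_one _⟩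
  · intro x hx
    rw [Metric.mem_closedBall, dist_eq_norm] at hx
    refine Real.smoothTransition.one_of_one_le ?_
    rw [le_div_iff₀ hpos]
    have : ‖x - x₀‖ ^ 2 ≤ a ^ 2 := by gcongr
    linarith
  · intro x hx
    rw [Metric.mem_ball, not_lt, dist_eq_norm] at hx
    refine Real.smoothTransition.zero_of_nonpos (div_nonpos_of_nonpos_of_nonneg ?_ hpos.le)
    have : b ^ 2 ≤ ‖x - x₀‖ ^ 2 := by gcongr; linarith
    linarith
  · intro x
    by_cases hx : x ∈ Metric.closedBall x₀ b
    · rw [Metric.mem_closedBall, dist_eq_norm] at hx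
      rw [hfd, norm_smul, norm_smul, innerSL_apply_norm, Real.norm_eq_abs, Real.norm_eq_abs,
        abs_neg, abs_of_pos (show 0 < (b ^ 2 - a ^ 2)⁻¹ * 2 by positivity)]
      calc _ ≤ L * ((b ^ 2 - a ^ 2)⁻¹ * 2 * b) := by gcongr; exact hLb _
        _ ≤ L * (2 / (b - a)) := by
          have h1 : 0 < b - a := by linarith
          have : (b ^ 2 - a ^ 2)⁻¹ * 2 * b = 2 / (b - a) * (b / (b + a)) := by
            have : b ^ 2 - a ^ 2 = (b - a) * (b + a) := by ring
            rw [this]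
            have : b + a ≠ 0 := by linarith
            field_simp
          rw [this]
          gcongr
          exact mul_le_of_le_one_right (by positivity) (div_le_one_of_le₀ (by linarith) (by linarith))
        _ = _ := by ring
    · rw [hout x hx, norm_zero]
      exact div_nonneg (by positivity) (by linarith)

/-- A compact set of vanishing Hausdorff measure is covered by finitely many small balls with small
total content. -/
theorem exists_finite_cover_of_hausdorffMeasure_eq_zero {X : Type*} [MetricSpace X]
    [MeasurableSpace X] [BorelSpace X] {S : Set X} (hS : IsCompact S) (hne : S.Nonempty) {d : ℝ}
    (hd : 0 < d) (hH : Measure.hausdorffMeasure d S = 0) {δ : ℝ} (hδ : 0 < δ) :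
    ∃ (I : Finset ℕ) (c : ℕ → X) (r : ℕ → ℝ), (∀ i, c i ∈ S) ∧ (∀ i, 0 < r i) ∧ (∀ i, r i < δ) ∧
      S ⊆ ⋃ i ∈ I, Metric.ball (c i) (r i) ∧ ∑ i ∈ I, ENNReal.ofReal (r i ^ d) ≤ ENNReal.ofReal δ := by
  have hε : 0 < ENNReal.ofReal (δ / 2) := by simpa using hδ
  rw [Measure.hausdorffMeasure_apply] at hH
  have h1 := le_of_eq hH
  rw [iSup₂_le_iff] at h1
  have h2 := (h1 (ENNReal.ofReal (δ / 2)) hε).trans_lt hε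
  simp only [iInf_lt_iff] at h2
  obtain ⟨t, hSt, htd, hsum⟩ := h2
  obtain ⟨ε, hε0, hεs⟩ := ENNReal.exists_pos_sum_of_countable hε.ne' ℕ
  have key : ∀ i, ∃ (c : X) (r : ℝ), c ∈ S ∧ 0 < r ∧ r < δ ∧ t i ∩ S ⊆ Metric.ball c r ∧
      ENNReal.ofReal (r ^ d) ≤ (⨆ _ : (t i).Nonempty, Metric.ediam (t i) ^ d) + ε i := by
    intro i
    have hfin : Metric.ediam (t i) ≠ ∞ := ((htd i).trans_lt ENNReal.ofReal_lt_top).ne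
    set D := (Metric.ediam (t i)).toReal with hD
    have hD0 : 0 ≤ D := ENNReal.toReal_nonneg
    have hDδ : D ≤ δ / 2 := ENNReal.toReal_le_of_le_ofReal (by positivity) (htd i)
    -- The radius is taken slightly above the diameter, at a cost below the summable `ε i`; sets of
    -- diameter zero thus get balls of positive radius too.
    have hcont : Filter.Tendsto (fun r : ℝ => r ^ d) (𝓝[>] D) (𝓝 (D ^ d)) :=
      (Real.continuousAt_rpow_const D d (Or.inr hd.le)).tendsto.mono_left nhdsWithin_le_nhds
    have hev : ∀ᶠ r in 𝓝[>] D, r ^ d < D ^ d + ε i :=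
      hcont.eventually_lt_const (by simpa using hε0 i)
    obtain ⟨r, hr1, hr2⟩ := (hev.and (Ioo_mem_nhdsGT (show D < δ by linarith))).exists
    have hbound : ENNReal.ofReal (r ^ d) ≤
        (⨆ _ : (t i).Nonempty, Metric.ediam (t i) ^ d) + ε i := by
      have h3 : ENNReal.ofReal (D ^ d) ≤ ⨆ _ : (t i).Nonempty, Metric.ediam (t i) ^ d := by
        rcases (t i).eq_empty_or_nonempty with h | h
        · have : D = 0 := by simp [hD, h]
          rw [this, Real.zero_rpow hd.ne']
          simp
        · rw [iSup_pos h, ← ENNReal.ofReal_rpow_of_nonneg hD0 hd.le, hD, ENNReal.ofReal_toReal hfin]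
      calc ENNReal.ofReal (r ^ d) ≤ ENNReal.ofReal (D ^ d + ε i) := ENNReal.ofReal_le_ofReal hr1.le
        _ = ENNReal.ofReal (D ^ d) + ε i := by
          rw [ENNReal.ofReal_add (by positivity) (by positivity), ENNReal.ofReal_coe_nnreal]
        _ ≤ _ := by gcongr
    have hr0 : 0 < r := hD0.trans_lt hr2.1
    rcases (t i ∩ S).eq_empty_or_nonempty with h | ⟨c, hc⟩
    · exact ⟨hne.some, r, hne.some_mem, hr0, hr2.2, by simp [h], hbound⟩
    · refine ⟨c, r, hc.2, hr0, hr2.2, fun y hy => ?_, hbound⟩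
      rw [Metric.mem_ball]
      have : edist y c ≤ Metric.ediam (t i) := Metric.edist_le_ediam_of_mem hy.1 hc.1
      refine lt_of_le_of_lt ?_ hr2.1
      rw [dist_edist]
      exact ENNReal.toReal_mono hfin this
  choose c r hcS hr0 hrδ hcov hb using key
  obtain ⟨I, hI⟩ := hS.elim_finite_subcover (fun i => Metric.ball (c i) (r i))
    (fun _ => Metric.isOpen_ball) fun x hx => by
      obtain ⟨i, hi⟩ := mem_iUnion.1 (hSt hx)
      exact mem_iUnion.2 ⟨i, hcov i ⟨hi, hx⟩⟩
  refine ⟨I, c, r, hcS, hr0, hrδ, hI, ?_⟩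
  calc ∑ i ∈ I, ENNReal.ofReal (r i ^ d)
      ≤ ∑ i ∈ I, ((⨆ _ : (t i).Nonempty, Metric.ediam (t i) ^ d) + ε i) :=
        Finset.sum_le_sum fun i _ => hb i
    _ ≤ ∑' i, ((⨆ _ : (t i).Nonempty, Metric.ediam (t i) ^ d) + ε i) := ENNReal.sum_le_tsum _
    _ = ∑' i, (⨆ _ : (t i).Nonempty, Metric.ediam (t i) ^ d) + ∑' i, (ε i : ℝ≥0∞) :=
        ENNReal.tsum_add
    _ ≤ ENNReal.ofReal (δ / 2) + ENNReal.ofReal (δ / 2) := add_le_add hsum.le hεs.le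
    _ = ENNReal.ofReal δ := by
      rw [← ENNReal.ofReal_add (by positivity) (by positivity), add_halves]

/-- Hölder with the conjugate `t' = t/(t-1)`. The condition `N ≥ t` is `(N-1) t' ≥ N`, so `∑
χ^((N-1)t') ≤ ∑ χ^N ≤ 1`. It lets gradients of overlapping cutoffs be summed without any bound on
the overlap. -/
theorem sum_pow_mul_rpow_le {ι : Type*} (I : Finset ι) {χ a : ι → ℝ} {t : ℝ} {N : ℕ} (ht : 1 < t)
    (hN : t ≤ N) (hχ : ∀ i, χ i ∈ Icc (0 : ℝ) 1) (ha : ∀ i, 0 ≤ a i)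
    (hsum : ∑ i ∈ I, χ i ^ N ≤ 1) :
    (∑ i ∈ I, χ i ^ (N - 1) * a i) ^ t ≤ ∑ i ∈ I, a i ^ t := by
  have ht0 : 0 < t := by linarith
  have hN1 : 1 ≤ N := by
    by_contra h
    have : (N : ℝ) < 1 := by exact_mod_cast not_le.1 h
    linarith
  have hpq := (Real.HolderConjugate.conjExponent ht).symm
  have h1 := Real.inner_le_Lp_mul_Lq I (fun i => χ i ^ (N - 1)) a hpq
  set t' := t.conjExponent with ht'
  have ht'0 : 0 < t' := hpq.pos
  have h2 : ∑ i ∈ I, |χ i ^ (N - 1)| ^ t' ≤ 1 := by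
    refine le_trans (Finset.sum_le_sum fun i _ => ?_) hsum
    have h0 := (hχ i).1
    rw [abs_of_nonneg (by positivity), ← Real.rpow_natCast, ← Real.rpow_natCast, ← Real.rpow_mul h0]
    rcases h0.eq_or_lt with h | h
    · rw [← h]
      rcases hN1.eq_or_lt with rfl | hN2
      · norm_num at hN; linarith
      · have : 0 < (((N - 1 : ℕ) : ℝ)) := by exact_mod_cast Nat.sub_pos_of_lt hN2
        rw [Real.zero_rpow (by positivity), Real.zero_rpow (by positivity)]
    · refine Real.rpow_le_rpow_of_exponent_ge h (hχ i).2 ?_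
      rw [ht', Real.conjExponent, Nat.cast_sub hN1, ← mul_div_assoc, le_div_iff₀ (by linarith)]
      push_cast
      nlinarith
  have h3 : ∑ i ∈ I, χ i ^ (N - 1) * a i ≤ (∑ i ∈ I, a i ^ t) ^ (1 / t) := by
    refine h1.trans ?_
    have h4 : (∑ i ∈ I, |χ i ^ (N - 1)| ^ t') ^ (1 / t') ≤ 1 :=
      Real.rpow_le_one (Finset.sum_nonneg fun _ _ => by positivity) h2 (by positivity)
    have h5 : ∑ i ∈ I, |a i| ^ t = ∑ i ∈ I, a i ^ t :=
      Finset.sum_congr rfl fun i _ => by rw [abs_of_nonneg (ha i)]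
    rw [h5]
    exact mul_le_of_le_one_left (Real.rpow_nonneg (Finset.sum_nonneg fun i _ =>
      Real.rpow_nonneg (ha i) _) _) h4
  have h6 : 0 ≤ ∑ i ∈ I, χ i ^ (N - 1) * a i :=
    Finset.sum_nonneg fun i _ => mul_nonneg (pow_nonneg (hχ i).1 _) (ha i)
  calc _ ≤ ((∑ i ∈ I, a i ^ t) ^ (1 / t)) ^ t := by gcongr
    _ = _ := by
      rw [← Real.rpow_mul (Finset.sum_nonneg fun i _ => Real.rpow_nonneg (ha i) _),
        one_div_mul_cancel ht0.ne', Real.rpow_one]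

/-- Compact sets of vanishing `(n - t)`-dimensional Hausdorff measure have zero `t`-capacity. -/
theorem exists_capacity_cutoff {S : Set (Space n)} (hS : IsCompact S) {t : ℝ} (ht : 1 < t)
    (htn : t < n) (hH : Measure.hausdorffMeasure ((n : ℝ) - t) S = 0) {δ : ℝ} (hδ : 0 < δ) :
    ∃ ξ : Space n → ℝ, ContDiff ℝ 1 ξ ∧ (∀ x, ξ x ∈ Icc (0 : ℝ) 1) ∧ (∀ᶠ x in 𝓝ˢ S, ξ x = 0) ∧
      (∀ x ∉ Metric.thickening δ S, ξ x = 1) ∧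
      ∫⁻ x, ‖fderiv ℝ ξ x‖ₑ ^ t ≤ ENNReal.ofReal δ := by
  rcases S.eq_empty_or_nonempty with rfl | hne
  · refine ⟨fun _ => 1, contDiff_const, fun _ => ⟨zero_le_one, le_rfl⟩, by simp, by simp, ?_⟩
    have h0 : ∀ x, ‖fderiv ℝ (fun _ : Space n => (1 : ℝ)) x‖ₑ ^ t = 0 := fun x => by
      rw [← ofReal_norm, fderiv_const_apply, norm_zero, ENNReal.ofReal_zero,
        ENNReal.zero_rpow_of_pos (by linarith)]
    simp only [h0, lintegral_zero, zero_le]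
  obtain ⟨L, hL, hcut⟩ := exists_radial_cutoff n
  obtain ⟨L', hL', hLb⟩ := exists_deriv_smoothTransition_bound
  obtain ⟨N, hN⟩ := exists_nat_ge t
  have ht0 : 0 < t := by linarith
  set vol1 := (volume (Metric.ball (0 : Space n) 1)).toReal with hvol1
  have hvf : volume (Metric.ball (0 : Space n) 1) ≠ ∞ := measure_ball_lt_top.ne
  -- Each covering ball contributes at most `A r^(n-t)` to the energy. The choice of `δ'` makes the
  -- total at most `A δ/(A+1) ≤ δ` and keeps the doubled balls within distance `δ` of `S`.
  set A : ℝ := (L' * N) ^ t * L ^ t * (2 ^ n * vol1) with hA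
  have hA0 : 0 ≤ A := by positivity
  set δ' : ℝ := min (δ / 2) (δ / (A + 1)) with hδ'
  have hδ'0 : 0 < δ' := by positivity
  obtain ⟨I, c, r, hcS, hr0, hrδ, hcov, hsum⟩ :=
    exists_finite_cover_of_hausdorffMeasure_eq_zero hS hne (sub_pos.2 htn) hH hδ'0
  choose χ hχC hχI hχ1 hχ0 hχd hχd0 using fun i => hcut (c i) (r i) (2 * r i) (hr0 i)
    (by linarith [hr0 i])
  -- The cutoff is `smoothTransition (1 - T)`. It is zero where `T ≥ 1`, in particular on the
  -- covering balls, and one where `T = 0`. Its gradient vanishes where `T > 1`, so the summation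
  -- lemma applies on all of the rest.
  set T : Space n → ℝ := fun x => ∑ i ∈ I, χ i x ^ N with hT
  have hTC : ContDiff ℝ 1 T := ContDiff.sum fun i _ => (hχC i).pow N
  have hN1 : 1 ≤ N := by
    by_contra h
    have : (N : ℝ) < 1 := by exact_mod_cast not_le.1 h
    linarith
  have hTd : ∀ x, HasFDerivAt (fun x => 1 - T x)
      (-∑ i ∈ I, (N * χ i x ^ (N - 1)) • fderiv ℝ (χ i) x) x := fun x => by
    refine (HasFDerivAt.fun_sum fun i _ => ?_).const_sub 1
    have := (hasDerivAt_pow N (χ i x)).comp_hasFDerivAt x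
      ((hχC i).differentiable one_ne_zero x).hasFDerivAt
    exact this
  have hfd := fun x => (hasFDerivAt_smoothTransition_comp (hTd x)).fderiv
  have hpt : ∀ x, ‖fderiv ℝ (fun x => Real.smoothTransition (1 - T x)) x‖ ^ t ≤
      ∑ i ∈ I, (L' * N) ^ t * ‖fderiv ℝ (χ i) x‖ ^ t := by
    intro x
    rw [hfd, ← Finset.mul_sum]
    rcases lt_or_ge 1 (T x) with h | h
    · rw [deriv_smoothTransition_of_neg (by linarith), zero_smul, norm_zero,
        Real.zero_rpow ht0.ne']
      exact mul_nonneg (by positivity) (Finset.sum_nonneg fun _ _ => by positivity)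
    · have h1 : ‖deriv Real.smoothTransition (1 - T x) •
          -∑ i ∈ I, (N * χ i x ^ (N - 1)) • fderiv ℝ (χ i) x‖ ≤
          L' * N * ∑ i ∈ I, χ i x ^ (N - 1) * ‖fderiv ℝ (χ i) x‖ := by
        rw [norm_smul, norm_neg, mul_assoc, Finset.mul_sum]
        gcongr
        · exact hLb _
        · refine (norm_sum_le _ _).trans (Finset.sum_le_sum fun i _ => ?_)
          rw [norm_smul, Real.norm_eq_abs, abs_of_nonneg
            (mul_nonneg (by positivity) (pow_nonneg (hχI i x).1 _)), mul_assoc]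
      have h0 : 0 ≤ ∑ i ∈ I, χ i x ^ (N - 1) * ‖fderiv ℝ (χ i) x‖ :=
        Finset.sum_nonneg fun i _ => mul_nonneg (pow_nonneg (hχI i x).1 _) (norm_nonneg _)
      calc _ ≤ (L' * N * ∑ i ∈ I, χ i x ^ (N - 1) * ‖fderiv ℝ (χ i) x‖) ^ t := by gcongr
        _ = (L' * N) ^ t * (∑ i ∈ I, χ i x ^ (N - 1) * ‖fderiv ℝ (χ i) x‖) ^ t := by
          rw [Real.mul_rpow (by positivity) h0]
        _ ≤ _ := by
          gcongr
          exact sum_pow_mul_rpow_le I ht hN (fun i => hχI i x) (fun i => norm_nonneg _) h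
  have hball : ∀ i, ∫⁻ x, ENNReal.ofReal ((L' * N) ^ t * ‖fderiv ℝ (χ i) x‖ ^ t) ≤
      ENNReal.ofReal (A * r i ^ ((n : ℝ) - t)) := by
    intro i
    have hri := hr0 i
    calc ∫⁻ x, ENNReal.ofReal ((L' * N) ^ t * ‖fderiv ℝ (χ i) x‖ ^ t)
        ≤ ∫⁻ x, (Metric.closedBall (c i) (2 * r i)).indicator
          (fun _ => ENNReal.ofReal ((L' * N) ^ t * (L / r i) ^ t)) x := by
          refine lintegral_mono fun x => ?_
          by_cases hx : x ∈ Metric.closedBall (c i) (2 * r i)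
          · rw [indicator_of_mem hx]
            have := hχd i x
            rw [show 2 * r i - r i = r i by ring] at this
            refine ENNReal.ofReal_le_ofReal ?_
            gcongr
          · simp [hχd0 i x hx, Real.zero_rpow ht0.ne']
      _ = ENNReal.ofReal ((L' * N) ^ t * (L / r i) ^ t) *
          (ENNReal.ofReal ((2 * r i) ^ n) * volume (Metric.ball (0 : Space n) 1)) := by
          rw [lintegral_indicator_const Metric.isClosed_closedBall.measurableSet,
            Measure.addHaar_closedBall _ _ (by positivity)]
          simp
      _ = _ := by
          rw [← ENNReal.ofReal_toReal hvf, ← ENNReal.ofReal_mul (by positivity),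
            ← ENNReal.ofReal_mul (by positivity)]
          congr 1
          rw [hA, Real.div_rpow hL.le hri.le, Real.rpow_sub hri, Real.rpow_natCast, mul_pow]
          field_simp
          exact hvol1.symm
  refine ⟨fun x => Real.smoothTransition (1 - T x), ?_, ?_, ?_, ?_, ?_⟩
  · exact Real.smoothTransition.contDiff.comp (contDiff_const.sub hTC)
  · exact fun x => ⟨Real.smoothTransition.nonneg _, Real.smoothTransition.le_one _⟩
  · rw [eventually_nhdsSet_iff_exists]
    refine ⟨⋃ i ∈ I, Metric.ball (c i) (r i),
      isOpen_biUnion fun _ _ => Metric.isOpen_ball, hcov, fun x hx => ?_⟩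
    obtain ⟨i, hi, hxi⟩ := mem_iUnion₂.1 hx
    refine Real.smoothTransition.zero_of_nonpos ?_
    have h1 : χ i x ^ N ≤ T x := Finset.single_le_sum (f := fun i => χ i x ^ N)
      (fun i _ => pow_nonneg (hχI i x).1 _) hi
    rw [hχ1 i x (Metric.ball_subset_closedBall hxi), one_pow] at h1
    linarith
  · intro x hx
    have : T x = 0 := by
      refine Finset.sum_eq_zero fun i _ => ?_
      rw [hχ0 i x, zero_pow (by omega)]
      intro hxi
      refine hx (Metric.mem_thickening_iff.2 ⟨c i, hcS i, ?_⟩)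
      have h1 := hrδ i
      have h2 : δ' ≤ δ / 2 := min_le_left _ _
      rw [Metric.mem_ball] at hxi
      linarith
    simp [this]
  · calc ∫⁻ x, ‖fderiv ℝ (fun x => Real.smoothTransition (1 - T x)) x‖ₑ ^ t
        ≤ ∫⁻ x, ∑ i ∈ I, ENNReal.ofReal ((L' * N) ^ t * ‖fderiv ℝ (χ i) x‖ ^ t) := by
          refine lintegral_mono fun x => ?_
          rw [← ENNReal.ofReal_sum_of_nonneg fun i _ => by positivity, ← ofReal_norm,
            ENNReal.ofReal_rpow_of_nonneg (norm_nonneg _) ht0.le]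
          exact ENNReal.ofReal_le_ofReal (hpt x)
      _ = ∑ i ∈ I, ∫⁻ x, ENNReal.ofReal ((L' * N) ^ t * ‖fderiv ℝ (χ i) x‖ ^ t) := by
          refine lintegral_finsetSum _ fun i _ => ?_
          refine (Continuous.measurable ?_).ennreal_ofReal
          exact continuous_const.mul ((((hχC i).continuous_fderiv one_ne_zero).norm).rpow_const
            fun _ => Or.inr ht0.le)
      _ ≤ ∑ i ∈ I, ENNReal.ofReal (A * r i ^ ((n : ℝ) - t)) := Finset.sum_le_sum fun i _ => hball i
      _ = ENNReal.ofReal A * ∑ i ∈ I, ENNReal.ofReal (r i ^ ((n : ℝ) - t)) := by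
          rw [Finset.mul_sum]
          exact Finset.sum_congr rfl fun i _ => ENNReal.ofReal_mul hA0
      _ ≤ ENNReal.ofReal A * ENNReal.ofReal (δ / (A + 1)) := by
          gcongr
          exact hsum.trans (ENNReal.ofReal_le_ofReal (min_le_right _ _))
      _ ≤ ENNReal.ofReal δ := by
          rw [← ENNReal.ofReal_mul hA0]
          refine ENNReal.ofReal_le_ofReal ?_
          rw [← mul_div_assoc, div_le_iff₀ (by positivity)]
          nlinarith

end Cutoff

/-! ### Sobolev inequality and removability of the singular set. -/

section SobolevStep

open Filter
open scoped RealInnerProductSpace Topology NNReal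

variable {n : ℕ}

/-- The Sobolev inequality for the Dirichlet integral. -/
theorem exists_sobolev_const (hn : 2 < n) : ∃ C : ℝ≥0, ∀ u : Space n → ℝ, ContDiff ℝ 1 u →
    HasCompactSupport u →
    (∫⁻ x, (‖u x‖ₑ ^ 2) ^ ((n : ℝ) / (n - 2))) ^ (((n : ℝ) - 2) / n) ≤
      C * ∫⁻ x, ‖fderiv ℝ u x‖ₑ ^ 2 := by
  have hn' : (2 : ℝ) < n := by exact_mod_cast hn
  have h2 : 0 < (n : ℝ) - 2 := by linarith
  set χ : ℝ := (n : ℝ) / (n - 2) with hχ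
  have hχ0 : 0 < χ := by positivity
  set p' : ℝ≥0 := ⟨2 * χ, by positivity⟩ with hp'
  have hp'0 : (p' : ℝ) = 2 * χ := rfl
  refine ⟨(SNormLESNormFDerivOfEqConst ℝ (volume : Measure (Space n)) (2 : ℝ≥0)) ^ 2,
    fun u hu huc => ?_⟩
  have h := eLpNorm_le_eLpNorm_fderiv_of_eq (F := ℝ) (volume : Measure (Space n)) hu huc
    (p := 2) (p' := p') (by norm_num) (by simp; omega) (by
      rw [hp'0, hχ]
      simp
      field_simp)
  have e1 : (∫⁻ x, (‖u x‖ₑ ^ 2) ^ χ) ^ (((n : ℝ) - 2) / n) = eLpNorm u p' volume ^ 2 := by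
    have h3 := eLpNorm_nnreal_pow_eq_lintegral (f := u) (μ := (volume : Measure (Space n)))
      (p := p') (fun h => by have := congrArg NNReal.toReal h; rw [hp'0] at this; simp at this; linarith)
    have h4 : ∀ x, (‖u x‖ₑ ^ 2) ^ χ = ‖u x‖ₑ ^ (p' : ℝ) := fun x => by
      rw [← ENNReal.rpow_natCast, ← ENNReal.rpow_mul, hp'0]
      norm_num
    simp_rw [h4]
    rw [← h3, ← ENNReal.rpow_mul, ← ENNReal.rpow_natCast, hp'0, hχ]
    congr 1
    field_simp
    norm_num
  have e2 : ∫⁻ x, ‖fderiv ℝ u x‖ₑ ^ 2 = eLpNorm (fderiv ℝ u) (2 : ℝ≥0) volume ^ 2 := by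
    have h3 := eLpNorm_nnreal_pow_eq_lintegral (f := fderiv ℝ u)
      (μ := (volume : Measure (Space n))) (p := 2) (by norm_num)
    have h5 : ((2 : ℝ≥0) : ℝ) = ((2 : ℕ) : ℝ) := by norm_num
    rw [h5] at h3
    simp only [ENNReal.rpow_natCast] at h3
    exact h3.symm
  rw [e1, e2, ENNReal.coe_pow, ← mul_pow]
  gcongr

theorem enorm_add_sq_le {E : Type*} [NormedAddCommGroup E] (x y : E) :
    ‖x + y‖ₑ ^ 2 ≤ 2 * ‖x‖ₑ ^ 2 + 2 * ‖y‖ₑ ^ 2 := by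
  simp only [← ofReal_norm_sq]
  rw [← ENNReal.ofReal_ofNat 2, ← ENNReal.ofReal_mul (by norm_num), ← ENNReal.ofReal_mul (by norm_num),
    ← ENNReal.ofReal_add (by positivity) (by positivity)]
  refine ENNReal.ofReal_le_ofReal ?_
  have h1 : ‖x + y‖ ^ 2 ≤ (‖x‖ + ‖y‖) ^ 2 := by
    gcongr
    exact norm_add_le x y
  nlinarith [sq_nonneg (‖x‖ - ‖y‖)]

/-- Removability: a Caccioppoli inequality off a set of zero capacity gives a reverse Sobolev
inequality across it. -/
theorem reverse_sobolev_of_caccioppoli {C : ℝ≥0} (hC : ∀ u : Space n → ℝ, ContDiff ℝ 1 u → HasCompactSupport u →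
      (∫⁻ x, (‖u x‖ₑ ^ 2) ^ ((n : ℝ) / (n - 2))) ^ (((n : ℝ) - 2) / n) ≤
      C * ∫⁻ x, ‖fderiv ℝ u x‖ₑ ^ 2) (hn : 2 < n)
    {B S A : Set (Space n)} (hS : IsCompact S) {t : ℝ} (ht : 2 < t)
    (htn : t < n) (hH : Measure.hausdorffMeasure ((n : ℝ) - t) S = 0)
    {U N : Space n → ℝ≥0∞} (hU : AEMeasurable U (volume.restrict A))
    (hUt : ∫⁻ x in A, U x ^ (t / (t - 2)) ≠ ∞)
    {l : Space n → ℝ} {E : ℝ≥0∞} (hE : E ≠ ∞)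
    (hl : ∀ η : Space n → ℝ, ContDiff ℝ 1 η → HasCompactSupport η → tsupport η ⊆ B \ S →
      ContDiff ℝ 1 (fun x => η x * l x) ∧ HasCompactSupport (fun x => η x * l x) ∧
      ∫⁻ x, ‖fderiv ℝ (fun x => η x * l x) x‖ₑ ^ 2 ≤
        E * ∫⁻ x in A, U x * (‖fderiv ℝ η x‖ₑ ^ 2 + ‖η x‖ₑ ^ 2 * N x))
    {η : Space n → ℝ} (hη : ContDiff ℝ 1 η) (hηc : HasCompactSupport η) (hηB : tsupport η ⊆ B)
    (hη1 : ∀ x, ‖η x‖ ≤ 1) (hBS : MeasurableSet (B \ S)) :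
    (∫⁻ x in B \ S, (‖η x * l x‖ₑ ^ 2) ^ ((n : ℝ) / (n - 2))) ^ (((n : ℝ) - 2) / n) ≤
      C * E * (2 * ∫⁻ x in A, U x * (‖fderiv ℝ η x‖ₑ ^ 2 + ‖η x‖ₑ ^ 2 * N x)) := by
  have hn' : (2 : ℝ) < n := by exact_mod_cast hn
  have h2 : 0 < (n : ℝ) - 2 := by linarith
  set χ : ℝ := (n : ℝ) / (n - 2) with hχ
  have hχ0 : 0 < χ := by positivity
  have hχi : ((n : ℝ) - 2) / n = χ⁻¹ := by rw [hχ, inv_div]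
  rw [hχi] at hC ⊢
  set X := ∫⁻ x in A, U x * (‖fderiv ℝ η x‖ₑ ^ 2 + ‖η x‖ₑ ^ 2 * N x) with hX
  have hδ : ∀ j : ℕ, (0 : ℝ) < 1 / (j + 1) := fun j => by positivity
  choose ξ hξC hξI hξS hξ1 hξd using fun j : ℕ =>
    exists_capacity_cutoff hS (by linarith : 1 < t) htn hH (hδ j)
  have htsup : ∀ j, tsupport (fun x => η x * ξ j x) ⊆ B \ S := by
    intro j x hx
    refine ⟨hηB (tsupport_mul_subset_left hx), fun hxS => ?_⟩
    have := eventually_nhdsSet_iff_forall.1 (hξS j) x hxS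
    exact notMem_tsupport_iff_eventuallyEq.2 (this.mono fun y hy => by simp [hy]) hx
  have hηξ := fun j => hl (fun x => η x * ξ j x) (hη.mul (hξC j)) hηc.mul_right (htsup j)
  set K : ℝ≥0∞ := (∫⁻ x in A, U x ^ (t / (t - 2))) ^ (1 / (t / (t - 2))) with hK
  have hKtop : K ≠ ∞ := ENNReal.rpow_ne_top_of_nonneg
    (by have : 0 < t - 2 := by linarith
        positivity) hUt
  -- Hölder with exponents `t/(t-2)` and `t/2`: the weight `U` pays for the singular set, and the
  -- capacity of `ξ j` tends to zero.
  have hξU : ∀ j : ℕ, ∫⁻ x in A, U x * ‖fderiv ℝ (ξ j) x‖ₑ ^ 2 ≤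
      K * ENNReal.ofReal (1 / (j + 1)) ^ (2 / t) := by
    intro j
    have ht2 : 0 < t - 2 := by linarith
    have hpq : (t / (t - 2)).HolderConjugate (t / 2) :=
      Real.holderConjugate_iff.2 ⟨by rw [lt_div_iff₀ ht2]; linarith, by field_simp; ring⟩
    have h3 := ENNReal.lintegral_mul_le_Lp_mul_Lq (volume.restrict A) hpq hU
      (g := fun x => ‖fderiv ℝ (ξ j) x‖ₑ ^ 2)
      (((hξC j).continuous_fderiv one_ne_zero).enorm.measurable.pow_const 2).aemeasurable
    refine h3.trans ?_
    rw [hK]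
    gcongr
    · rw [one_div_div]
      gcongr
      refine (setLIntegral_le_lintegral _ _).trans (le_trans (le_of_eq ?_) (hξd j))
      refine lintegral_congr fun x => ?_
      rw [← ENNReal.rpow_natCast, ← ENNReal.rpow_mul]
      congr 1
      push_cast
      ring
  have hmain : ∀ j : ℕ, (∫⁻ x in B \ S, (‖η x * ξ j x * l x‖ₑ ^ 2) ^ χ) ≤
      (C * (E * (2 * X + 2 * (K * ENNReal.ofReal (1 / (j + 1)) ^ (2 / t))))) ^ χ := by
    intro j
    obtain ⟨c1, c2, c3⟩ := hηξ j
    have h4 : ∫⁻ x in A, U x * (‖fderiv ℝ (fun x => η x * ξ j x) x‖ₑ ^ 2 +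
        ‖η x * ξ j x‖ₑ ^ 2 * N x) ≤ 2 * X + 2 * ∫⁻ x in A, U x * ‖fderiv ℝ (ξ j) x‖ₑ ^ 2 := by
      rw [hX, ← lintegral_const_mul' _ _ ENNReal.ofNat_ne_top,
        ← lintegral_const_mul' _ _ ENNReal.ofNat_ne_top, ← lintegral_add_right']
      · refine lintegral_mono fun x => ?_
        have hd : fderiv ℝ (fun x => η x * ξ j x) x = ξ j x • fderiv ℝ η x + η x • fderiv ℝ (ξ j) x := by
          rw [fderiv_fun_mul (hη.differentiable one_ne_zero x)
            ((hξC j).differentiable one_ne_zero x), add_comm]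
        have hξ1 : ‖ξ j x‖ₑ ≤ 1 := by
          rw [← ofReal_norm, Real.norm_eq_abs, abs_of_nonneg (hξI j x).1]
          exact ENNReal.ofReal_le_one.2 (hξI j x).2
        have hη1' : ‖η x‖ₑ ≤ 1 := by
          rw [← ofReal_norm]
          exact ENNReal.ofReal_le_one.2 (hη1 x)
        have h5 : ‖fderiv ℝ (fun x => η x * ξ j x) x‖ₑ ^ 2 ≤
            2 * ‖fderiv ℝ η x‖ₑ ^ 2 + 2 * ‖fderiv ℝ (ξ j) x‖ₑ ^ 2 := by
          rw [hd]
          refine (enorm_add_sq_le _ _).trans ?_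
          rw [enorm_smul, enorm_smul]
          gcongr
          · exact mul_le_of_le_one_left' hξ1
          · exact mul_le_of_le_one_left' hη1'
        have h6 : ‖η x * ξ j x‖ₑ ^ 2 * N x ≤ 2 * (‖η x‖ₑ ^ 2 * N x) := by
          rw [enorm_mul]
          calc _ ≤ (‖η x‖ₑ * 1) ^ 2 * N x := by gcongr
            _ ≤ _ := by
              rw [mul_one, two_mul]
              exact le_self_add
        calc _ ≤ U x * (2 * ‖fderiv ℝ η x‖ₑ ^ 2 + 2 * ‖fderiv ℝ (ξ j) x‖ₑ ^ 2 +
              2 * (‖η x‖ₑ ^ 2 * N x)) := by gcongr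
          _ = _ := by ring
      · exact (hU.mul (((hξC j).continuous_fderiv one_ne_zero).enorm.measurable.pow_const 2).aemeasurable).const_mul _
    have h7 := hC _ c1 c2
    have h8 : (∫⁻ x, (‖η x * ξ j x * l x‖ₑ ^ 2) ^ χ) ^ χ⁻¹ ≤
        C * (E * (2 * X + 2 * (K * ENNReal.ofReal (1 / (j + 1)) ^ (2 / t)))) := by
      refine h7.trans ?_
      gcongr
      refine c3.trans ?_
      gcongr
      refine h4.trans ?_
      gcongr
      exact hξU j
    refine (setLIntegral_le_lintegral _ _).trans ?_
    rwa [ENNReal.rpow_inv_le_iff hχ0] at h8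
  -- Since `S` is closed, each point off `S` eventually lies outside the shrinking neighbourhoods
  -- where `ξ j ≠ 1`, so the integrands converge pointwise.
  have hfatou : ∫⁻ x in B \ S, (‖η x * l x‖ₑ ^ 2) ^ χ ≤
      liminf (fun j : ℕ => ∫⁻ x in B \ S, (‖η x * ξ j x * l x‖ₑ ^ 2) ^ χ) atTop := by
    refine le_trans (lintegral_mono_ae ?_) (lintegral_liminf_le' fun j => ?_)
    · rw [ae_restrict_iff' hBS]
      refine Eventually.of_forall fun x hx => ?_
      have hpos : 0 < Metric.infEDist x S := by
        rw [Metric.infEDist_pos_iff_notMem_closure, hS.isClosed.closure_eq]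
        exact hx.2
      have hev : ∀ᶠ j : ℕ in atTop, ξ j x = 1 := by
        have h9 : Tendsto (fun j : ℕ => ENNReal.ofReal (1 / ((j : ℝ) + 1))) atTop (𝓝 0) := by
          have := ENNReal.tendsto_ofReal (tendsto_one_div_add_atTop_nhds_zero_nat (𝕜 := ℝ))
          rwa [ENNReal.ofReal_zero] at this
        filter_upwards [h9.eventually_lt_const hpos] with j hj
        refine hξ1 j x fun hx' => ?_
        rw [Metric.mem_thickening_iff_infEDist_lt] at hx'
        exact absurd (hj.trans hx') (lt_irrefl _)
      have hlim : Tendsto (fun j : ℕ => (‖η x * ξ j x * l x‖ₑ ^ 2) ^ χ) atTop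
          (𝓝 ((‖η x * l x‖ₑ ^ 2) ^ χ)) :=
        tendsto_const_nhds.congr' (hev.mono fun j hj => by simp only [hj, mul_one])
      exact hlim.liminf_eq.ge
    · exact (((hηξ j).1.continuous.enorm.measurable.pow_const 2).pow_const χ).aemeasurable
  have hlim : Tendsto (fun j : ℕ => (C * (E * (2 * X + 2 * (K * ENNReal.ofReal (1 / ((j : ℝ) + 1)) ^
      (2 / t))))) ^ χ) atTop (𝓝 ((C * (E * (2 * X + 2 * (K * 0))) : ℝ≥0∞) ^ χ)) := by
    refine (ENNReal.continuous_rpow_const.tendsto _).comp ?_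
    refine ENNReal.Tendsto.const_mul ?_ (Or.inr ENNReal.coe_ne_top)
    refine ENNReal.Tendsto.const_mul ?_ (Or.inr hE)
    refine Tendsto.add tendsto_const_nhds ?_
    refine ENNReal.Tendsto.const_mul ?_ (Or.inr ENNReal.ofNat_ne_top)
    refine ENNReal.Tendsto.const_mul ?_ (Or.inr hKtop)
    have h9 := ENNReal.tendsto_ofReal (tendsto_one_div_add_atTop_nhds_zero_nat (𝕜 := ℝ))
    rw [ENNReal.ofReal_zero] at h9
    have h10 := (ENNReal.continuous_rpow_const (y := 2 / t)).tendsto 0 |>.comp h9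
    rwa [ENNReal.zero_rpow_of_pos (by positivity)] at h10
  have hfin := hfatou.trans ((liminf_le_liminf (Eventually.of_forall hmain)).trans
    hlim.liminf_eq.le)
  rw [ENNReal.rpow_inv_le_iff hχ0]
  refine hfin.trans (le_of_eq ?_)
  rw [mul_zero, mul_zero, add_zero, mul_assoc]

end SobolevStep

/-! ### De Giorgi iteration. -/

section DeGiorgi

open Filter
open scoped RealInnerProductSpace Topology NNReal

variable {n : ℕ}

/-- The geometric ansatz `M a^j` reproduces itself: the gain `(a^θ)^j` of the superlinear factor
cancels the growth `b^j`, and the smallness of `K (M/P)^θ` supplies the next factor `a`. -/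
theorem le_mul_pow_of_superlinear_recursion {Z : ℕ → ℝ≥0∞} {K b a M P : ℝ≥0∞} {θ : ℝ}
    (hθ : 0 < θ) (hb : b * a ^ θ ≤ 1) (hZ0 : Z 0 ≤ M)
    (hstep : ∀ j, Z (j + 1) ≤ K * b ^ j * Z j * (Z j / P) ^ θ) (hP : K * (M / P) ^ θ ≤ a) (j : ℕ) :
    Z j ≤ M * a ^ j := by
  induction j with
  | zero => simpa using hZ0
  | succ j ih =>
    have h1 : (M * a ^ j / P) ^ θ = (M / P) ^ θ * (a ^ θ) ^ j := by
      rw [div_eq_mul_inv, mul_right_comm, ← div_eq_mul_inv, ENNReal.mul_rpow_of_nonneg _ _ hθ.le,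
        ← ENNReal.rpow_natCast, ← ENNReal.rpow_mul, ← ENNReal.rpow_natCast, ← ENNReal.rpow_mul,
        mul_comm (j : ℝ)]
    calc Z (j + 1) ≤ K * b ^ j * Z j * (Z j / P) ^ θ := hstep j
      _ ≤ K * b ^ j * (M * a ^ j) * (M * a ^ j / P) ^ θ := by gcongr
      _ = K * (M / P) ^ θ * (b * a ^ θ) ^ j * (M * a ^ j) := by rw [h1, mul_pow]; ring
      _ ≤ a * 1 ^ j * (M * a ^ j) := by gcongr
      _ = M * a ^ (j + 1) := by rw [one_pow, pow_succ]; ring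

/-- Above a level `l > k` the truncation stays away from zero, so `Q^(q+1)` is recovered from
`level²`. The fourth power appears because `trunc` is already a square. -/
theorem ofReal_rpow_le_level_sq {q k l Q d : ℝ} (hk : 0 ≤ k) (hkl : 0 < l)
    (hlQ : l ≤ Q) (hd : 0 ≤ d) (hdk : d ≤ 1 - k / l) :
    ENNReal.ofReal (d ^ 4) * ENNReal.ofReal (Q ^ (q + 1)) ≤ ‖level q k Q‖ₑ ^ 2 := by
  have hQ : 0 < Q := hkl.trans_le hlQ
  have h1 : d ≤ max (1 - k / Q) 0 := le_max_of_le_left (hdk.trans (by gcongr))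
  have h2 : (Q ^ ((q + 1) / 2)) ^ 2 = Q ^ (q + 1) := by
    rw [← Real.rpow_natCast, ← Real.rpow_mul hQ.le]
    congr 1
    push_cast
    ring
  rw [← ofReal_norm_sq, ← ENNReal.ofReal_mul (by positivity), Real.norm_eq_abs, sq_abs]
  refine ENNReal.ofReal_le_ofReal ?_
  rw [level, mul_pow, h2, trunc, ← pow_mul, mul_comm]
  gcongr

theorem lintegral_mul_add_le {α : Type*} [MeasurableSpace α] {μ : Measure α} {σ s : ℝ}
    (hσs : σ.HolderConjugate s) {U N : α → ℝ≥0∞} (hU : AEMeasurable U μ) (hN : AEMeasurable N μ)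
    {G : ℝ≥0∞} :
    ∫⁻ x, U x * (G + N x) ∂μ ≤ (∫⁻ x, U x ^ σ ∂μ) ^ (1 / σ) *
      (G * μ univ ^ (1 / s) + (∫⁻ x, N x ^ s ∂μ) ^ (1 / s)) := by
  have h1 := ENNReal.lintegral_mul_le_Lp_mul_Lq μ hσs hU (g := fun _ => G) aemeasurable_const
  have h2 := ENNReal.lintegral_mul_le_Lp_mul_Lq μ hσs hU hN
  have hs : s ≠ 0 := hσs.symm.ne_zero
  have h3 : (∫⁻ _, G ^ s ∂μ) ^ (1 / s) = G * μ univ ^ (1 / s) := by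
    rw [lintegral_const, ENNReal.mul_rpow_of_nonneg _ _ (by have := hσs.symm.pos; positivity),
      ← ENNReal.rpow_mul, mul_one_div_cancel hs, ENNReal.rpow_one]
  rw [h3] at h1
  calc _ = ∫⁻ x, (U x * G + U x * N x) ∂μ := by simp only [mul_add]
    _ = ∫⁻ x, U x * G ∂μ + ∫⁻ x, U x * N x ∂μ := lintegral_add_left' (hU.mul_const _) _
    _ ≤ _ := by
      rw [mul_add]
      exact add_le_add h1 h2

/-- The positive power of the measure left over by Hölder becomes the superlinear factor of the
recursion. -/
theorem lintegral_rpow_le_of_lt {α : Type*} [MeasurableSpace α] {μ : Measure α} {σ χ : ℝ}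
    (hσ : 0 < σ) (hσχ : σ < χ) {U : α → ℝ≥0∞} (hU : AEMeasurable U μ) :
    ∫⁻ x, U x ^ σ ∂μ ≤ (∫⁻ x, U x ^ χ ∂μ) ^ (σ / χ) * μ univ ^ (1 - σ / χ) := by
  have hχ : 0 < χ := hσ.trans hσχ
  have hpq : (χ / σ).HolderConjugate (1 - σ / χ)⁻¹ := by
    rw [Real.holderConjugate_iff]
    refine ⟨by rwa [one_lt_div hσ], ?_⟩
    rw [inv_inv, inv_div]
    ring
  have h := ENNReal.lintegral_mul_le_Lp_mul_Lq μ hpq (hU.pow_const σ) (g := fun _ => 1)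
    aemeasurable_const
  simp only [Pi.mul_apply, mul_one, ENNReal.one_rpow, lintegral_const, one_mul, one_div,
    inv_inv, inv_div] at h
  refine h.trans (le_of_eq ?_)
  congr 2
  refine lintegral_congr fun x => ?_
  rw [← ENNReal.rpow_mul]
  congr 1
  field_simp

/-- De Giorgi's iteration. -/
theorem exists_sup_bound_of_reverse_sobolev (hn : 2 < n) (x₀ : Space n) {R₁ R₀ : ℝ} (hR₁ : 0 < R₁)
    (hR : R₁ < R₀) {q s : ℝ} (hq : 0 < q) (hs : (n : ℝ) / 2 < s) {E M₁ M₂ : ℝ≥0∞} (hE : E ≠ ∞)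
    (hM₁ : M₁ ≠ ∞) (hM₂ : M₂ ≠ ∞) :
    ∃ Λ : ℝ, ∀ (S : Set (Space n)) (Q : Space n → ℝ) (N : Space n → ℝ≥0∞), IsClosed S →
      (∀ x, 0 ≤ Q x) → ContinuousOn Q (Metric.ball x₀ R₀ \ S) →
      AEMeasurable N (volume.restrict (Metric.ball x₀ R₀ \ S)) →
      ∫⁻ x in Metric.ball x₀ R₀ \ S, ENNReal.ofReal (Q x ^ (q + 1)) ^ (s / (s - 1)) ≤ M₁ →
      ∫⁻ x in Metric.ball x₀ R₀ \ S, N x ^ s ≤ M₂ →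
      (∀ (k : ℝ) (η : Space n → ℝ), 1 ≤ k → ContDiff ℝ 1 η → HasCompactSupport η →
        tsupport η ⊆ Metric.ball x₀ R₀ → (∀ x, ‖η x‖ ≤ 1) →
        (∫⁻ x in Metric.ball x₀ R₀ \ S, (‖η x * level q k (Q x)‖ₑ ^ 2) ^ ((n : ℝ) / (n - 2))) ^
          (((n : ℝ) - 2) / n) ≤
        E * ∫⁻ x in {x ∈ Metric.ball x₀ R₀ \ S | k < Q x},
          ENNReal.ofReal (Q x ^ (q + 1)) * (‖fderiv ℝ η x‖ₑ ^ 2 + ‖η x‖ₑ ^ 2 * N x)) →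
      ∀ x ∈ Metric.ball x₀ R₁ \ S, Q x ≤ Λ := by
  have hn' : (2 : ℝ) < n := by exact_mod_cast hn
  have h2 : 0 < (n : ℝ) - 2 := by linarith
  have hs1 : 1 < s := by linarith
  have hs1' : 0 < s - 1 := by linarith
  set χ : ℝ := (n : ℝ) / (n - 2) with hχ
  have hχ0 : 0 < χ := by positivity
  have hχi : ((n : ℝ) - 2) / n = χ⁻¹ := by rw [hχ, inv_div]
  -- The conjugate exponent of `s`. The condition `s > n/2` is exactly `σ < χ`, which makes the gain
  -- `θ` positive.
  set σ : ℝ := s / (s - 1) with hσ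
  have hσs : σ.HolderConjugate s := (Real.HolderConjugate.conjExponent hs1).symm
  have hσ0 : 0 < σ := by positivity
  have hσχ : σ < χ := by
    rw [hσ, hχ, div_lt_div_iff₀ hs1' h2]
    linarith
  set θ : ℝ := 1 - σ / χ with hθ
  have hθ0 : 0 < θ := by rw [hθ, sub_pos, div_lt_one hχ0]; exact hσχ
  obtain ⟨L, hL, hcut⟩ := exists_radial_cutoff n
  set R' : ℝ := (R₁ + R₀) / 2 with hR'
  have hR1' : R₁ < R' := by rw [hR']; linarith
  have hR0' : R' < R₀ := by rw [hR']; linarith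
  set D : ℝ := R' - R₁ with hD
  have hD0 : 0 < D := by rw [hD]; linarith
  set Rj : ℕ → ℝ := fun j => R₁ + D * (1 / 2) ^ j with hRj
  have hRjR1 : ∀ j, R₁ < Rj j := fun j => by simp only [hRj]; linarith [show 0 < D * (1 / 2) ^ j by positivity]
  have hRjR' : ∀ j, Rj j ≤ R' := fun j => by
    have : ((1 : ℝ) / 2) ^ j ≤ 1 := pow_le_one₀ (by norm_num) (by norm_num)
    simp only [hRj]
    nlinarith
  have hRjs : ∀ j, Rj j - Rj (j + 1) = D / 2 * (1 / 2) ^ j := fun j => by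
    simp only [hRj, pow_succ]; ring
  have hRjlt : ∀ j, Rj (j + 1) < Rj j := fun j => by
    have := hRjs j
    have : 0 < D / 2 * (1 / 2) ^ j := by positivity
    linarith
  choose η hηC hηI hη1 hη0 hηd hηd0 using fun j =>
    hcut x₀ (Rj (j + 1)) (Rj j) (hR₁.trans (hRjR1 _)) (hRjlt j)
  set V := volume (Metric.ball x₀ R₀) with hV
  have hVfin : V ≠ ∞ := measure_ball_lt_top.ne
  set H : ℝ≥0∞ := ENNReal.ofReal ((2 * L / D) ^ 2) * V ^ (1 / s) + M₂ ^ (1 / s) with hH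
  have hHfin : H ≠ ∞ := by
    refine ENNReal.add_ne_top.2 ⟨ENNReal.mul_ne_top ENNReal.ofReal_ne_top ?_, ?_⟩
    · exact ENNReal.rpow_ne_top_of_nonneg (by positivity) hVfin
    · exact ENNReal.rpow_ne_top_of_nonneg (by positivity) hM₂
  -- Here `64 = 16 · 4`: a factor `16` per step from the fourth power of the level gap, a factor `4`
  -- from the squared cutoff gradient. The `256 = 16²` in `K` comes from the offset in `16^(j+2)`,
  -- and `a` solves `b a^θ = 1`.
  set b : ℝ≥0∞ := 64 ^ σ with hb
  set K : ℝ≥0∞ := (256 * E * H) ^ σ with hK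
  have hKfin : K ≠ ∞ := ENNReal.rpow_ne_top_of_nonneg hσ0.le
    (ENNReal.mul_ne_top (ENNReal.mul_ne_top (by norm_num) hE) hHfin)
  set a : ℝ≥0∞ := (64 ^ (σ / θ))⁻¹ with ha
  have h64 : (1 : ℝ≥0∞) < 64 ^ (σ / θ) := ENNReal.one_lt_rpow (by norm_num) (by positivity)
  have h64f : (64 : ℝ≥0∞) ^ (σ / θ) ≠ ∞ := ENNReal.rpow_ne_top_of_nonneg (by positivity) (by norm_num)
  have ha0 : 0 < a := ENNReal.inv_pos.2 h64f
  have ha1 : a < 1 := ENNReal.inv_lt_one.2 h64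
  have hba : b * a ^ θ ≤ 1 := by
    rw [hb, ha, ENNReal.inv_rpow, ← ENNReal.rpow_mul, div_mul_cancel₀ _ hθ0.ne']
    exact ENNReal.mul_inv_le_one _
  -- The starting smallness is obtained by raising the base level `l`, not by shrinking the energy.
  -- Only `M₁`, `K`, `a` and the exponents enter, so `l` is uniform over all solutions.
  have hev : ∀ᶠ l : ℝ in atTop, K * (M₁ / ENNReal.ofReal (l ^ ((q + 1) * σ))) ^ θ < a := by
    have h3 : Tendsto (fun l : ℝ => ENNReal.ofReal (l ^ ((q + 1) * σ))) atTop (𝓝 ∞) :=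
      ENNReal.tendsto_ofReal_atTop.comp (tendsto_rpow_atTop (by positivity))
    have h4 := ENNReal.Tendsto.const_div h3 (a := M₁) (Or.inr hM₁)
    rw [ENNReal.div_top] at h4
    have h5 := ((ENNReal.continuous_rpow_const (y := θ)).tendsto 0).comp h4
    rw [ENNReal.zero_rpow_of_pos hθ0] at h5
    have h6 := ENNReal.Tendsto.const_mul h5 (a := K) (Or.inr hKfin)
    rw [mul_zero] at h6
    exact h6.eventually_lt_const ha0
  obtain ⟨l, hl, hl1⟩ := (hev.and (eventually_ge_atTop 1)).exists
  refine ⟨2 * l, fun S Q N hS hQ0 hQc hN hU1 hN2 hstep => ?_⟩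
  set O := Metric.ball x₀ R₀ \ S with hO
  have hOo : IsOpen O := Metric.isOpen_ball.sdiff hS
  set U : Space n → ℝ≥0∞ := fun x => ENNReal.ofReal (Q x ^ (q + 1)) with hU
  have hUm : AEMeasurable U (volume.restrict O) := by
    refine AEMeasurable.ennreal_ofReal ?_
    exact (hQc.aemeasurable hOo.measurableSet).pow_const _
  -- Levels rise from `l` towards `2l` while the radii fall from `R'` towards `R₁`, both with
  -- geometrically shrinking gaps.
  set kj : ℕ → ℝ := fun j => l * (2 - (1 / 2) ^ j) with hkj
  have hpow1 : ∀ j : ℕ, ((1 : ℝ) / 2) ^ j ≤ 1 := fun j => pow_le_one₀ (by norm_num) (by norm_num)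
  have hpow0 : ∀ j : ℕ, 0 < ((1 : ℝ) / 2) ^ j := fun j => by positivity
  have hkl : ∀ j, l ≤ kj j := fun j => by simp only [hkj]; nlinarith [hpow1 j]
  have hk2l : ∀ j, kj j ≤ 2 * l := fun j => by simp only [hkj]; nlinarith [hpow0 j]
  have hks : ∀ j, kj (j + 1) - kj j = l / 2 * (1 / 2) ^ j := fun j => by
    simp only [hkj, pow_succ]; ring
  set A : ℕ → Set (Space n) := fun j => {x ∈ O | kj j < Q x} ∩ Metric.closedBall x₀ (Rj j) with hA
  have hAO : ∀ j, A j ⊆ O := fun j x hx => hx.1.1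
  have hAm : ∀ j, MeasurableSet (A j) := fun j =>
    ((hQc.isOpen_inter_preimage hOo isOpen_Ioi).measurableSet).inter
      Metric.isClosed_closedBall.measurableSet
  have hAA : ∀ j, A (j + 1) ⊆ A j := fun j x hx => by
    refine ⟨⟨hx.1.1, lt_of_le_of_lt ?_ hx.1.2⟩, Metric.closedBall_subset_closedBall (hRjlt j).le hx.2⟩
    have := hks j
    have : 0 < l / 2 * (1 / 2) ^ j := by positivity
    linarith
  have hUA : ∀ j, AEMeasurable U (volume.restrict (A j)) := fun j =>
    hUm.mono_measure (Measure.restrict_mono_set _ (hAO j))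
  have hNA : ∀ j, AEMeasurable N (volume.restrict (A j)) := fun j =>
    hN.mono_measure (Measure.restrict_mono_set _ (hAO j))
  set P : ℝ≥0∞ := ENNReal.ofReal (l ^ ((q + 1) * σ)) with hP
  have hP0 : P ≠ 0 := by
    rw [hP, Ne, ENNReal.ofReal_eq_zero, not_le]
    positivity
  have hUP : ∀ x, l < Q x → P ≤ U x ^ σ := fun x hx => by
    rw [hP, hU, Real.rpow_mul (by linarith), ← ENNReal.ofReal_rpow_of_nonneg (by positivity) hσ0.le]
    refine ENNReal.rpow_le_rpow (ENNReal.ofReal_le_ofReal ?_) hσ0.le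
    exact Real.rpow_le_rpow (by linarith) hx.le (by linarith)
  set Z : ℕ → ℝ≥0∞ := fun j => ∫⁻ x in A j, U x ^ σ with hZ
  -- Chebyshev: `U^σ ≥ P` on the superlevel set.
  have hVol : ∀ j, volume (A j) ≤ Z j / P := fun j => by
    rw [ENNReal.le_div_iff_mul_le (Or.inl hP0) (Or.inl ENNReal.ofReal_ne_top), mul_comm,
      ← setLIntegral_const]
    refine setLIntegral_mono' (hAm j) fun x hx => hUP x ((hkl j).trans_lt hx.1.2)
  have hrev : ∀ j, (∫⁻ x in A (j + 1), U x ^ χ) ^ χ⁻¹ ≤ 256 * E * H * 64 ^ j * Z j ^ (1 / σ) := by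
    intro j
    have hsupp : tsupport (η j) ⊆ Metric.closedBall x₀ (Rj j) := by
      refine closure_minimal (fun x hx => ?_) Metric.isClosed_closedBall
      by_contra h
      exact hx (hη0 j x fun h' => h (Metric.ball_subset_closedBall h'))
    have h3 := hstep (kj j) (η j) (hl1.trans (hkl j)) (hηC j)
      ((isCompact_closedBall x₀ (Rj j)).of_isClosed_subset (isClosed_tsupport _) hsupp)
      (hsupp.trans (Metric.closedBall_subset_ball ((hRjR' j).trans_lt hR0')))
      (fun x => by rw [Real.norm_eq_abs, abs_of_nonneg (hηI j x).1]; exact (hηI j x).2)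
    rw [hχi] at h3
    set G : ℝ≥0∞ := ENNReal.ofReal ((2 * L / D) ^ 2) * 4 ^ j with hG
    have hGd : ∀ x, ‖fderiv ℝ (η j) x‖ₑ ^ 2 ≤ G := fun x => by
      rw [← ofReal_norm_sq, hG, ← ENNReal.ofReal_ofNat 4, ← ENNReal.ofReal_pow (by norm_num),
        ← ENNReal.ofReal_mul (by positivity)]
      refine ENNReal.ofReal_le_ofReal ?_
      have h4 := hηd j x
      rw [hRjs] at h4
      calc _ ≤ (L / (D / 2 * (1 / 2) ^ j)) ^ 2 := by gcongr
        _ = _ := by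
          rw [show (4 : ℝ) = 2 ^ 2 by norm_num, ← pow_mul, mul_comm 2 j, pow_mul, ← mul_pow]
          congr 1
          field_simp
          rw [← mul_pow]
          norm_num
    have h4 : ∫⁻ x in {x ∈ O | kj j < Q x}, U x * (‖fderiv ℝ (η j) x‖ₑ ^ 2 + ‖η j x‖ₑ ^ 2 * N x) ≤
        ∫⁻ x in A j, U x * (G + N x) := by
      have hm : MeasurableSet {x ∈ O | kj j < Q x} :=
        (hQc.isOpen_inter_preimage hOo isOpen_Ioi).measurableSet
      rw [← lintegral_indicator hm, ← lintegral_indicator (hAm j)]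
      refine lintegral_mono fun x => ?_
      by_cases hx : x ∈ Metric.closedBall x₀ (Rj j)
      · by_cases hx' : x ∈ {x ∈ O | kj j < Q x}
        · rw [indicator_of_mem hx', indicator_of_mem (show x ∈ A j from ⟨hx', hx⟩)]
          have : ‖η j x‖ₑ ≤ 1 := by
            rw [← ofReal_norm, Real.norm_eq_abs, abs_of_nonneg (hηI j x).1]
            exact ENNReal.ofReal_le_one.2 (hηI j x).2
          gcongr
          · exact hGd x
          · exact mul_le_of_le_one_left' (pow_le_one₀ zero_le this)
        · rw [indicator_of_notMem hx']
          exact zero_le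
      · have h5 : η j x = 0 := hη0 j x fun h' => hx (Metric.ball_subset_closedBall h')
        by_cases hx' : x ∈ {x ∈ O | kj j < Q x}
        · rw [indicator_of_mem hx', hηd0 j x hx, h5, ← ofReal_norm, ← ofReal_norm]
          simp
        · rw [indicator_of_notMem hx']
          exact zero_le
    have h5 : ∫⁻ x in A j, U x * (G + N x) ≤ Z j ^ (1 / σ) * (H * 4 ^ j) := by
      refine (lintegral_mul_add_le hσs (hUA j) (hNA j)).trans ?_
      refine mul_le_mul_right ?_ _
      have h6 : (volume.restrict (A j)) univ ^ (1 / s) ≤ V ^ (1 / s) := by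
        rw [Measure.restrict_apply_univ]
        gcongr
        exact measure_mono ((hAO j).trans sdiff_subset)
      have h7 : (∫⁻ x in A j, N x ^ s) ^ (1 / s) ≤ M₂ ^ (1 / s) := by
        gcongr
        exact (lintegral_mono_set (hAO j)).trans hN2
      calc _ ≤ ENNReal.ofReal ((2 * L / D) ^ 2) * 4 ^ j * V ^ (1 / s) + M₂ ^ (1 / s) * 1 := by
            rw [mul_one]
            gcongr
        _ ≤ ENNReal.ofReal ((2 * L / D) ^ 2) * 4 ^ j * V ^ (1 / s) + M₂ ^ (1 / s) * 4 ^ j := by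
            gcongr
            exact one_le_pow₀ (by norm_num)
        _ = H * 4 ^ j := by rw [hH]; ring
    have h6 : (∫⁻ x in A (j + 1), U x ^ χ) ≤ (16 ^ (j + 2)) ^ χ *
        ∫⁻ x in O, (‖η j x * level q (kj j) (Q x)‖ₑ ^ 2) ^ χ := by
      rw [← lintegral_const_mul' _ _ (ENNReal.rpow_ne_top_of_nonneg hχ0.le
        (ENNReal.pow_ne_top (by norm_num)))]
      refine le_trans ?_ (lintegral_mono_set (hAO (j + 1)))
      refine setLIntegral_mono' (hAm (j + 1)) fun x hx => ?_
      rw [hη1 j x hx.2, one_mul, ← ENNReal.mul_rpow_of_nonneg _ _ hχ0.le]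
      refine ENNReal.rpow_le_rpow ?_ hχ0.le
      have hkpos : 0 < kj (j + 1) := by linarith [hkl (j + 1)]
      -- The relative gap `(l/2) 2^(-j) / kj (j + 1)` is at least `2^(-(j+2))`, because `kj (j + 1)
      -- ≤ 2l`.
      have h7 := ofReal_rpow_le_level_sq (q := q) (k := kj j) (by linarith [hkl j]) hkpos
        hx.1.2.le (d := (1 / 2) ^ (j + 2)) (by positivity) (by
          have : 1 - kj j / kj (j + 1) = (l / 2 * (1 / 2) ^ j) / kj (j + 1) := by
            rw [← hks]; field_simp
          rw [this, le_div_iff₀ hkpos, pow_add]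
          have := hk2l (j + 1)
          have := hpow0 j
          nlinarith)
      have h8 : (16 : ℝ≥0∞) ^ (j + 2) * ENNReal.ofReal (((1 / 2) ^ (j + 2)) ^ 4) = 1 := by
        rw [← ENNReal.ofReal_ofNat 16, ← ENNReal.ofReal_pow (by norm_num),
          ← ENNReal.ofReal_mul (by positivity), ← pow_mul, mul_comm (j + 2) 4, pow_mul, ← mul_pow]
        norm_num
      calc U x = 16 ^ (j + 2) * (ENNReal.ofReal (((1 / 2) ^ (j + 2)) ^ 4) * U x) := by
            rw [← mul_assoc, h8, one_mul]
        _ ≤ _ := by gcongr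
    calc _ ≤ ((16 ^ (j + 2)) ^ χ * ∫⁻ x in O, (‖η j x * level q (kj j) (Q x)‖ₑ ^ 2) ^ χ) ^ χ⁻¹ := by
          gcongr
      _ = 16 ^ (j + 2) * (∫⁻ x in O, (‖η j x * level q (kj j) (Q x)‖ₑ ^ 2) ^ χ) ^ χ⁻¹ := by
          rw [ENNReal.mul_rpow_of_nonneg _ _ (by positivity), ENNReal.rpow_rpow_inv hχ0.ne']
      _ ≤ 16 ^ (j + 2) * (E * (Z j ^ (1 / σ) * (H * 4 ^ j))) := by
          gcongr
          refine h3.trans ?_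
          gcongr
          exact h4.trans h5
      _ = _ := by
          rw [pow_add, show (64 : ℝ≥0∞) = 16 * 4 by norm_num, mul_pow]
          rw [show (256 : ℝ≥0∞) = 16 ^ 2 by norm_num]
          ring
  have hrec : ∀ j, Z (j + 1) ≤ K * b ^ j * Z j * (Z j / P) ^ θ := by
    intro j
    have h3 := lintegral_rpow_le_of_lt hσ0 hσχ (hUA (j + 1))
    refine h3.trans ?_
    rw [Measure.restrict_apply_univ]
    refine mul_le_mul' ?_ ?_
    · have h4 : (∫⁻ x in A (j + 1), U x ^ χ) ^ (σ / χ) =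
          ((∫⁻ x in A (j + 1), U x ^ χ) ^ χ⁻¹) ^ σ := by
        rw [← ENNReal.rpow_mul]
        congr 1
        field_simp
      rw [h4]
      refine (ENNReal.rpow_le_rpow (hrev j) hσ0.le).trans (le_of_eq ?_)
      rw [ENNReal.mul_rpow_of_nonneg _ _ hσ0.le, ENNReal.mul_rpow_of_nonneg _ _ hσ0.le,
        ← ENNReal.rpow_mul, one_div_mul_cancel hσ0.ne', ENNReal.rpow_one, hK, hb,
        ← ENNReal.rpow_natCast, ← ENNReal.rpow_natCast, ← ENNReal.rpow_mul, ← ENNReal.rpow_mul,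
        mul_comm (j : ℝ)]
    · exact ENNReal.rpow_le_rpow ((measure_mono (hAA j)).trans (hVol j)) hθ0.le
  have hZj := le_mul_pow_of_superlinear_recursion hθ0 hba
    ((lintegral_mono_set (hAO 0)).trans hU1) hrec hl.le
  intro x hx
  by_contra hxl
  rw [not_le] at hxl
  have hBO : Metric.ball x₀ R₁ \ S ⊆ O := sdiff_subset_sdiff_left (Metric.ball_subset_ball hR.le)
  -- By continuity this set is open, so zero measure forces it to be empty: the bound holds
  -- everywhere off `S`, not just almost everywhere.
  set A' := (Metric.ball x₀ R₁ \ S) ∩ Q ⁻¹' Ioi (2 * l) with hA'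
  have hA'o : IsOpen A' := (hQc.mono hBO).isOpen_inter_preimage (Metric.isOpen_ball.sdiff hS) isOpen_Ioi
  have hA'A : ∀ j, A' ⊆ A j := fun j y hy =>
    ⟨⟨hBO hy.1, (hk2l j).trans_lt hy.2⟩, Metric.ball_subset_closedBall
      (Metric.ball_subset_ball (hRjR1 j).le hy.1.1)⟩
  have hpos : 0 < volume A' := hA'o.measure_pos _ ⟨x, hx, hxl⟩
  have hle : ∀ j, volume A' ≤ M₁ * a ^ j / P := fun j =>
    (measure_mono (hA'A j)).trans ((hVol j).trans (by gcongr; exact hZj j))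
  have hlim : Tendsto (fun j : ℕ => M₁ * a ^ j / P) atTop (𝓝 (M₁ * 0 / P)) := by
    refine ENNReal.Tendsto.div_const ?_ (Or.inr hP0)
    exact ENNReal.Tendsto.const_mul (ENNReal.tendsto_pow_atTop_nhds_zero_of_lt_one ha1) (Or.inr hM₁)
  have := ge_of_tendsto' hlim hle
  rw [mul_zero, ENNReal.zero_div] at this
  exact absurd hpos (not_lt.2 this)

end DeGiorgi

/-! ### Choice of exponents and conversion of norms. -/

open scoped NNReal

/-- Here `t` is the capacity exponent: `t < μ` makes `S` negligible, and the last inequality puts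
`Q^(q+1)` in `L^(t/(t-2))`. For `n > 4` take `t = 2n/(n-2)`, where `t/(t-2) = n/2`. For `n = 3, 4`
take `t = μ - ε`, where `t/(t-2)` is `β` and `γ₁ > 1/2` gives the inequality. -/
theorem AdmissibleExponents.exists_exponent {n : ℕ} {μ ε γ₁ γ₂ q : ℝ} (hn : 2 < n) (hq : 0 < q)
    (hμ : AdmissibleExponents n μ ε γ₁ γ₂) :
    ∃ t P : ℝ, P ∈ integrabilityExponents n q μ ε γ₁ γ₂ ∧ 2 < t ∧ t < n ∧ t < μ ∧
      2 * (q + 1) * (t / (t - 2)) ≤ P := by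
  have hn' : (2 : ℝ) < n := by exact_mod_cast hn
  unfold AdmissibleExponents at hμ
  unfold integrabilityExponents
  split_ifs at hμ ⊢ with h
  · obtain ⟨h1, h2⟩ := hμ
    have h3 : 0 < (n : ℝ) - 2 := by linarith
    have h4 : 2 * (n : ℝ) / (n - 2) - 2 = 4 / (n - 2) := by field_simp; ring
    refine ⟨2 * n / (n - 2), n * (q + 1), rfl, ?_, h1.trans h2, h1, le_of_eq ?_⟩
    · have : 0 < 4 / ((n : ℝ) - 2) := by positivity
      linarith
    · rw [h4]
      field_simp
      ring
  · obtain ⟨_, h2, h3, h4, h5, _⟩ := hμ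
    refine ⟨μ - ε, 4 * (q + 1) * ((μ - ε) / (μ - 2 - ε)) * γ₁, Or.inl rfl, by linarith,
      by linarith, by linarith, ?_⟩
    rw [show μ - ε - 2 = μ - 2 - ε by ring]
    have h6 : 0 < (μ - ε) / (μ - 2 - ε) := div_pos (by linarith) (by linarith)
    have h7 : 0 < (q + 1) * ((μ - ε) / (μ - 2 - ε)) := by positivity
    nlinarith

theorem lintegral_enorm_rpow_le_of_eLpNorm_le {X : Type*} [MeasurableSpace X] {μ : Measure X}
    {f : X → ℝ} (hf : AEStronglyMeasurable f μ) {a P : ℝ} (ha : 0 < a) (haP : a ≤ P) {K v : ℝ≥0∞}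
    (hK : eLpNorm f (ENNReal.ofReal P) μ ≤ K) (hv : μ univ ≤ v) :
    ∫⁻ x, ‖f x‖ₑ ^ a ∂μ ≤ (K * v ^ (1 / a - 1 / P)) ^ a := by
  have hP : 0 < P := ha.trans_le haP
  have h := eLpNorm_le_eLpNorm_mul_rpow_measure_univ (ENNReal.ofReal_le_ofReal haP) hf
  rw [ENNReal.toReal_ofReal ha.le, ENNReal.toReal_ofReal hP.le,
    eLpNorm_eq_lintegral_rpow_enorm_toReal (ENNReal.ofReal_pos.2 ha).ne' ENNReal.ofReal_ne_top,
    ENNReal.toReal_ofReal ha.le] at h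
  have hexp : 0 ≤ 1 / a - 1 / P := sub_nonneg.2 (one_div_le_one_div_of_le ha haP)
  rw [← ENNReal.rpow_inv_le_iff ha, inv_eq_one_div]
  refine h.trans ?_
  gcongr

theorem ofReal_normSq_rpow {n p : ℕ} {V : Type*} [NormedAddCommGroup V] [InnerProductSpace ℝ V]
    (α : Space n [⋀^Fin p]→L[ℝ] V) {b : ℝ} (hb : 0 ≤ b) :
    ENNReal.ofReal (normSq α ^ b) = ‖formNorm α‖ₑ ^ (2 * b) := by
  rw [formNorm, Real.enorm_of_nonneg (Real.sqrt_nonneg _),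
    ENNReal.ofReal_rpow_of_nonneg (Real.sqrt_nonneg _) (by positivity),
    Real.rpow_mul (Real.sqrt_nonneg _), Real.rpow_two, Real.sq_sqrt (normSq_nonneg _)]

theorem hausdorffMeasure_eq_zero_of_dimH_le {n : ℕ} {S : Set (Space n)} {t μ : ℝ} (htn : t < n)
    (htμ : t < μ) (h : dimH S ≤ ENNReal.ofReal (n - μ)) :
    Measure.hausdorffMeasure ((n : ℝ) - t) S = 0 := by
  have h1 : dimH S < (((n : ℝ) - t).toNNReal : ℝ≥0∞) :=
    h.trans_lt ((ENNReal.ofReal_lt_ofReal_iff (by linarith)).2 (by linarith))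
  have h2 := hausdorffMeasure_of_dimH_lt h1
  rwa [Real.coe_toNNReal _ (by linarith)] at h2

/-! ### The uniform estimate on a smaller concentric ball. -/

section UniformBound

variable {n p : ℕ} {V W : Type*}
  [NormedAddCommGroup V] [InnerProductSpace ℝ V] [NormedAddCommGroup W] [NormedSpace ℝ W]
  {m : W →L[ℝ] V →L[ℝ] V}

theorem IsClassicalSolution.mono {Qcrit : ℝ≥0∞} {ρ : ℝ → ℝ} {U U' : Set (Space n)}
    {ω : Space n → Space n [⋀^Fin (p + 1)]→L[ℝ] V} {ν : Space n → Space n →L[ℝ] W}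
    (h : IsClassicalSolution m Qcrit ρ U ω ν) (hU : U' ⊆ U) :
    IsClassicalSolution m Qcrit ρ U' ω ν where
  contDiffOn_form := h.contDiffOn_form.mono hU
  contDiffOn_vorticity := h.contDiffOn_vorticity.mono hU
  mem_subcritical x hx := h.mem_subcritical x (hU hx)
  codiff_eq x hx := h.codiff_eq x (hU hx)
  extDeriv_eq x hx := h.extDeriv_eq x (hU hx)

-- Assembly of the three ingredients. The level bound is chosen before the density, the singular set
-- and the solution are introduced; these enter later steps only through `M` and the fixed
-- parameters.
variable (m) in
theorem exists_uniform_bound_on_ball [FiniteDimensional ℝ V] (hn : 2 < n) (p : ℕ)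
    {κ q s μ ε γ₁ γ₂ : ℝ} (hκ : 0 < κ) (hq : 0 < q) (hs : (n : ℝ) / 2 < s)
    (hμ : AdmissibleExponents n μ ε γ₁ γ₂) (x₀ : Space n) {r R : ℝ} (hR : 0 < R) (hRr : R < r)
    (M : ℝ) :
    ∃ C : ℝ, ∀ (k₀ : ℝ) (Qcrit : ℝ≥0∞) (ρ : ℝ → ℝ) (Ω S : Set (Space n))
        (ω : Space n → Space n [⋀^Fin (p + 1)]→L[ℝ] V)
        (ν : Space n → Space n →L[ℝ] W),
      SingularSolution m κ q s μ ε γ₁ γ₂ (Metric.ball x₀ r) k₀ Qcrit ρ Ω S ω ν →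
      k₀ ≤ M →
      (∀ P ∈ integrabilityExponents n q μ ε γ₁ γ₂,
        eLpNorm (fun x => formNorm (ω x)) (ENNReal.ofReal P)
          (volume.restrict (Metric.ball x₀ r \ S)) ≤ ENNReal.ofReal M) →
      eLpNorm (fun x => ‖fderiv ℝ ν x‖ + ‖ν x‖ ^ 2) (ENNReal.ofReal s)
        (volume.restrict (Metric.ball x₀ r \ S)) ≤ ENNReal.ofReal M →
      ∀ x ∈ Metric.ball x₀ R \ S, formNorm (ω x) ≤ C := by
  have hn' : (2 : ℝ) < n := by exact_mod_cast hn
  have hs1 : 1 < s := by linarith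
  have hs1' : 0 < s - 1 := by linarith
  obtain ⟨t, P, hP, ht, htn, htμ, htP⟩ := hμ.exists_exponent hn hq
  obtain ⟨c, hc⟩ := exists_sobolev_const hn
  set v := volume (Metric.ball x₀ r) with hv
  have hvfin : v ≠ ∞ := measure_ball_lt_top.ne
  set E₀ : ℝ≥0∞ := ENNReal.ofReal (energyBound m n p κ q M) with hE₀
  -- Hölder on the ball: `(Q^(q+1))^a = |ω|^(2(q+1)a)`, whose integral is controlled by the `L^P`
  -- norm when `2(q+1)a ≤ P`.
  set bound : ℝ → ℝ≥0∞ := fun a => (ENNReal.ofReal M * v ^ (1 / (2 * (q + 1) * a) - 1 / P)) ^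
    (2 * (q + 1) * a) with hbound
  have hbfin : ∀ a, 0 < a → 2 * (q + 1) * a ≤ P → bound a ≠ ∞ := fun a ha haP =>
    ENNReal.rpow_ne_top_of_nonneg (by positivity) (ENNReal.mul_ne_top ENNReal.ofReal_ne_top
      (ENNReal.rpow_ne_top_of_nonneg (sub_nonneg.2 (one_div_le_one_div_of_le (by positivity) haP))
        hvfin))
  have ht2 : 0 < t - 2 := by linarith
  have hσ0 : 0 < s / (s - 1) := by positivity
  -- The integrability that starts the iteration is weaker than the one for removability: `t < n <
  -- 2s` gives `s/(s-1) ≤ t/(t-2)`.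
  have hσP : 2 * (q + 1) * (s / (s - 1)) ≤ P := by
    refine le_trans ?_ htP
    refine mul_le_mul_of_nonneg_left ?_ (by positivity)
    rw [div_le_div_iff₀ hs1' ht2]
    linarith
  obtain ⟨Λ, hΛ⟩ := exists_sup_bound_of_reverse_sobolev hn x₀ hR hRr hq hs
    (E := c * E₀ * 2) (M₁ := bound (s / (s - 1))) (M₂ := ENNReal.ofReal M ^ s)
    (ENNReal.mul_ne_top (ENNReal.mul_ne_top ENNReal.coe_ne_top ENNReal.ofReal_ne_top) (by norm_num))
    (hbfin _ hσ0 hσP) (ENNReal.rpow_ne_top_of_nonneg (by linarith) ENNReal.ofReal_ne_top)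
  refine ⟨√Λ, fun k₀ Qcrit ρ Ω S ω ν h hk₀ hωM hνM x hx => Real.sqrt_le_sqrt ?_⟩
  set O := Metric.ball x₀ r \ S with hO
  have hOo : IsOpen O := Metric.isOpen_ball.sdiff h.isCompact_sing.isClosed
  have hsol : IsClassicalSolution m Qcrit ρ O ω ν :=
    h.solution.mono (sdiff_subset_sdiff_left h.ball_subset)
  have hQc : ContinuousOn (fun x => normSq (ω x)) O :=
    (contDiffOn_normSq hsol.contDiffOn_form).continuousOn
  have hUa : ∀ a, 0 < a → 2 * (q + 1) * a ≤ P →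
      ∫⁻ x in O, ENNReal.ofReal (normSq (ω x) ^ (q + 1)) ^ a ≤ bound a := fun a ha haP => by
    have h1 : ∀ x, ENNReal.ofReal (normSq (ω x) ^ (q + 1)) ^ a =
        ‖formNorm (ω x)‖ₑ ^ (2 * (q + 1) * a) := fun x => by
      rw [ofReal_normSq_rpow _ (by linarith), ← ENNReal.rpow_mul]
    simp only [h1]
    refine lintegral_enorm_rpow_le_of_eLpNorm_le (h.memLp_form P hP).aestronglyMeasurable
      (by positivity) haP (hωM P hP) ?_
    rw [Measure.restrict_apply_univ]
    exact measure_mono sdiff_subset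
  refine hΛ S (fun x => normSq (ω x)) (fun x => ‖ν x‖ₑ ^ 2) h.isCompact_sing.isClosed
    (fun x => normSq_nonneg _) hQc ?_ (hUa _ hσ0 hσP) ?_ ?_ x hx
  · exact ((hsol.contDiffOn_vorticity.continuousOn.enorm).aemeasurable hOo.measurableSet).pow_const _
  · have hνs := lintegral_enorm_rpow_le_of_eLpNorm_le h.memLp_vorticity.aestronglyMeasurable
      (by linarith : 0 < s) le_rfl hνM le_rfl
    rw [sub_self, ENNReal.rpow_zero, mul_one] at hνs
    refine le_trans (lintegral_mono fun x => ?_) hνs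
    refine ENNReal.rpow_le_rpow ?_ (by linarith)
    rw [← ofReal_norm_sq, Real.enorm_of_nonneg (by positivity)]
    exact ENNReal.ofReal_le_ofReal (by linarith [norm_nonneg (fderiv ℝ ν x)])
  · intro k η hk hη hηc hηB hη1
    have hAO : {x ∈ O | k < normSq (ω x)} ⊆ O := fun x hx => hx.1
    have hst := reverse_sobolev_of_caccioppoli hc hn h.isCompact_sing ht htn
      (hausdorffMeasure_eq_zero_of_dimH_le htn htμ h.dimH_sing_le)
      (A := {x ∈ O | k < normSq (ω x)}) (B := Metric.ball x₀ r)
      (U := fun x => ENNReal.ofReal (normSq (ω x) ^ (q + 1))) (N := fun x => ‖ν x‖ₑ ^ 2)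
      (((hQc.aemeasurable hOo.measurableSet).pow_const _).ennreal_ofReal.mono_measure
        (Measure.restrict_mono_set _ hAO))
      (ne_top_of_le_ne_top (hbfin _ (by positivity) htP)
        ((lintegral_mono_set hAO).trans (hUa _ (by positivity) htP)))
      (l := fun x => level q k (normSq (ω x))) (E := E₀) ENNReal.ofReal_ne_top
      (fun η hη hηc hηO => energy_inequality hκ hq h.k₀_nonneg hk₀ h.density hOo hsol hk hη hηc hηO)
      hη hηc hηB hη1 hOo.measurableSet
    refine hst.trans (le_of_eq ?_)
    ring

end UniformBound

end HodgeVorticity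

/-- First part: `ω` is bounded on (the regular part of) every compact subset of `Ω`. Second part: on
compact subsets of the ball, the bound depends only on the fixed parameters, the compact set and a
bound `M` for `k₀` and the norms; it is uniform over all densities in the class, including `k₀ = 0`
and all `Qcrit`, hence up to both ends of the subcritical range. -/
theorem theorem6 {n : ℕ} (hn : 2 < n) (p : ℕ) {V W : Type*}
    [NormedAddCommGroup V] [InnerProductSpace ℝ V] [FiniteDimensional ℝ V]
    [NormedAddCommGroup W] [NormedSpace ℝ W] [FiniteDimensional ℝ W]
    (m : W →L[ℝ] V →L[ℝ] V)
    (κ q s μ ε γ₁ γ₂ : ℝ) (hκ : 0 < κ) (hq : 0 < q) (hs : (n : ℝ) / 2 < s)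
    (hμ : AdmissibleExponents n μ ε γ₁ γ₂)
    (x₀ : Space n) (r : ℝ) (hr : 0 < r) :
    (∀ (k₀ : ℝ) (Qcrit : ℝ≥0∞) (ρ : ℝ → ℝ) (Ω S : Set (Space n))
        (ω : Space n → Space n [⋀^Fin (p + 1)]→L[ℝ] V)
        (ν : Space n → Space n →L[ℝ] W),
      SingularSolution m κ q s μ ε γ₁ γ₂ (Metric.ball x₀ r) k₀ Qcrit ρ Ω S ω ν →
      ∀ K : Set (Space n), IsCompact K → K ⊆ Ω →
        ∃ C : ℝ, ∀ x ∈ K \ S, formNorm (ω x) ≤ C) ∧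
    (∀ K : Set (Space n), IsCompact K → K ⊆ Metric.ball x₀ r → ∀ M : ℝ, ∃ C : ℝ,
      ∀ (k₀ : ℝ) (Qcrit : ℝ≥0∞) (ρ : ℝ → ℝ) (Ω S : Set (Space n))
        (ω : Space n → Space n [⋀^Fin (p + 1)]→L[ℝ] V)
        (ν : Space n → Space n →L[ℝ] W),
      SingularSolution m κ q s μ ε γ₁ γ₂ (Metric.ball x₀ r) k₀ Qcrit ρ Ω S ω ν →
      k₀ ≤ M →
      (∀ P ∈ integrabilityExponents n q μ ε γ₁ γ₂,
        eLpNorm (fun x => formNorm (ω x)) (ENNReal.ofReal P)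
          (volume.restrict (Metric.ball x₀ r \ S)) ≤ ENNReal.ofReal M) →
      eLpNorm (fun x => ‖fderiv ℝ ν x‖ + ‖ν x‖ ^ 2) (ENNReal.ofReal s)
        (volume.restrict (Metric.ball x₀ r \ S)) ≤ ENNReal.ofReal M →
      ∀ x ∈ K \ S, formNorm (ω x) ≤ C) := by
  have hradius : ∀ K : Set (Space n), IsCompact K → K ⊆ Metric.ball x₀ r →
      ∃ R, 0 < R ∧ R < r ∧ K ⊆ Metric.ball x₀ R := fun K hK hKB => by
    obtain ⟨R, hR, hKR⟩ := exists_lt_subset_ball hK.isClosed hKB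
    refine ⟨max R (r / 2), lt_max_of_lt_right (by linarith), max_lt hR (by linarith), ?_⟩
    exact hKR.trans (Metric.ball_subset_ball (le_max_left _ _))
  refine ⟨fun k₀ Qcrit ρ Ω S ω ν h K hK hKΩ => ?_, fun K hK hKB M => ?_⟩
  · obtain ⟨R, hR, hRr, hSR⟩ := hradius S h.isCompact_sing h.sing_subset
    have hfin : (integrabilityExponents n q μ ε γ₁ γ₂).Finite := by
      unfold integrabilityExponents
      split_ifs
      · exact finite_singleton _
      · exact toFinite _
    obtain ⟨M₁, hM₁⟩ := (hfin.image fun P => (eLpNorm (fun x => formNorm (ω x)) (ENNReal.ofReal P)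
      (volume.restrict (Metric.ball x₀ r \ S))).toReal).bddAbove
    set M₂ := (eLpNorm (fun x => ‖fderiv ℝ ν x‖ + ‖ν x‖ ^ 2) (ENNReal.ofReal s)
      (volume.restrict (Metric.ball x₀ r \ S))).toReal with hM₂
    obtain ⟨C₁, hC₁⟩ := exists_uniform_bound_on_ball m hn p hκ hq hs hμ x₀ hR hRr
      (max k₀ (max M₁ M₂))
    have hb := hC₁ k₀ Qcrit ρ Ω S ω ν h (le_max_left _ _)
      (fun P hP => (ENNReal.le_ofReal_iff_toReal_le (h.memLp_form P hP).eLpNorm_ne_top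
        (le_max_of_le_left h.k₀_nonneg)).2
          (le_max_of_le_right (le_max_of_le_left (hM₁ (mem_image_of_mem _ hP)))))
      ((ENNReal.le_ofReal_iff_toReal_le h.memLp_vorticity.eLpNorm_ne_top
        (le_max_of_le_left h.k₀_nonneg)).2 (le_max_of_le_right (le_max_right _ _)))
    have hc : ContinuousOn (fun x => formNorm (ω x)) (K \ Metric.ball x₀ R) :=
      ((contDiffOn_normSq h.solution.contDiffOn_form).continuousOn.mono
        fun x hx => ⟨hKΩ hx.1, fun hxS => hx.2 (hSR hxS)⟩).sqrt
    obtain ⟨C₂, hC₂⟩ := (hK.diff Metric.isOpen_ball).bddAbove_image hc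
    refine ⟨max C₁ C₂, fun x hx => ?_⟩
    by_cases hxR : x ∈ Metric.ball x₀ R
    · exact le_max_of_le_left (hb x ⟨hxR, hx.2⟩)
    · exact le_max_of_le_right (hC₂ (mem_image_of_mem _ ⟨hx.1, hxR⟩))
  · obtain ⟨R, hR, hRr, hKR⟩ := hradius K hK hKB
    obtain ⟨C, hC⟩ := exists_uniform_bound_on_ball m hn p hκ hq hs hμ x₀ hR hRr M
    exact ⟨C, fun k₀ Qcrit ρ Ω S ω ν h hk hω hν x hx =>
      hC k₀ Qcrit ρ Ω S ω ν h hk hω hν x ⟨hKR hx.1, hx.2⟩⟩
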